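/- **Setting.** For a unital $\mathrm C^*$-algebra $A$ let $U^\infty(A)=\varinjlim U_n(A)$ (along $u\mapsto\mathrm{diag}(u,1)$, with the inductive limit topology), where $U_n(A)$ is the unitary group of $M_n(A)$; let $DU^\infty(A)$ be its commutator subgroup and $U_0^\infty(A)$ the subgroup of the classes of unitary matrices that are connected to $1$ by a path in some $U_n(A)$. Put $\overline{\mathrm K}_1(A)=U^\infty(A)/\overline{DU^\infty(A)}$ and $\mathrm K_1(A)=U^\infty(A)/U^\infty_0(A)$, and write $\overline u$ and $[u]$ for the classes of $u$. Let $\mathrm{Aff}\,T_1(A)$ be the space of continuous real affine functions on the space $T_1(A)$ of tracial states (weak-* topology), with the supremum norm, write $\mathrm{ev}_h(\tau)=\tau(h)$ for self-adjoint $h\in A$, and let $\mathrm H(A)=\mathrm{Aff}\,T_1(A)/\overline{\mathrm{K}_0(A)}$, where $\overline{\mathrm K_0(A)}$ is the closure of the subgroup generated by the functions $\tau\mapsto\sum_i\tau(p_{ii})$ for projections $p\in M_n(A)$, $n\ge 0$. Let $\overline\Delta\colon U_0^\infty(A)\to \mathrm H(A)$ be the determinant: $\overline\Delta(u)$ is the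 class of $\tau\mapsto\frac1{2\pi i}\int_0^1\sum_j\tau\big((\xi'(t)\xi(t)^{-1})_{jj}\big)\,dt$, for any smooth path $\xi$ of unitary matrices from $1$ to $u$ (it does not depend on $\xi$). Let $i_A\colon \mathrm H(A)\to\overline{\mathrm K}_1(A)$ be the injective homomorphism with $i_A(\overline\Delta(u))=\overline u$ for $u\in U_0^\infty(A)$. A *Nielsen–Thomsen basis* of $A$ is a family $\mathcal C=\{c_k\}_{k\in\mathrm K_1(A)}$ in $U^\infty(A)$ with $c_0=1$ and $[c_k]=k$ for all $k$, such that $s_A\colon k\mapsto\overline{c_k}$ is a homomorphism $\mathrm K_1(A)\to\overline{\mathrm K}_1(A)$. It induces a unique retract $r_A\colon\overline{\mathrm K}_1(A)\to\mathrm H(A)$ of $i_A$ with $r_A\circ s_A=0$, and a unique group isomorphism $\nu_{\mathcal C}\colon\overline{\mathrm K}_1(A)\to\mathrm H(A)\oplus\mathrm K_1(A)$ such that $\nu_{\mathcal C}(\overline u)=(\overline\Delta(\mathrm{diag}(u,c_{[u]}^*)),[u])$. Here and below $c_k$ may be represented by a unitary matrix of any size. **Theorem.** Let $\phi\colon A\to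 B$ be a $*$-homomorphism between unital $\mathrm C^*$-algebras, and let $\mathcal C=\{c_k\}$ and $\mathcal D=\{d_k\}$ be Nielsen–Thomsen bases of $A$ and $B$, with $s_A$ the section induced by $\mathcal C$ and $r_B$ the retract induced by $\mathcal D$. For a unitary matrix $u\in M_n(A)$ let $\phi(u)$ denote the entrywise image of $u$ if $\phi$ is unital, and this image plus $1-\phi(1_{M_n(A)})$ in general. Let $\overline{\mathrm K}_1(\phi)$ and $\mathrm K_1(\phi)$ be the maps induced by $u\mapsto\phi(u)$, and let $\mathrm H(\phi)$ be induced by the map $\mathrm{Aff}\,T_1(A)\to\mathrm{Aff}\,T_1(B)$ that sends $f$ to $\sigma\mapsto\sigma(\phi(1))\,f\big(\sigma\circ\phi/\sigma(\phi(1))\big)$, with the value $0$ where $\sigma(\phi(1))=0$ (for unital $\phi$ this is $\sigma\mapsto f(\sigma\circ\phi)$); thus $\mathrm H(\phi)[\mathrm{ev}_h]=[\mathrm{ev}_{\phi(h)}]$. Then, for every $k\in\mathrm K_1(A)$, the class of $\mathrm{diag}\big(\phi(c_k),d^*_{\mathrm K_1(\phi)(k)}\big)$ lies in $U^\infty_0(B)$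 and $$\big(r_B\circ\overline{\mathrm K}_1(\phi)\circ s_A\big)(k)=\overline\Delta\begin{pmatrix}\phi(c_k)&0\\0&d^*_{\mathrm K_1(\phi)(k)}\end{pmatrix}.$$ Moreover, writing $R_{\mathcal C\mathcal D}(\phi)=r_B\circ\overline{\mathrm K}_1(\phi)\circ s_A\colon\mathrm K_1(A)\to\mathrm H(B)$ (the *rotation map*), there is a unique $2\times2$ matrix $M=\mathrm{Mat}_{\mathcal C\mathcal D}(\overline{\mathrm K}_1(\phi))$ of group homomorphisms with $\nu_{\mathcal D}\circ\overline{\mathrm K}_1(\phi)=M\circ\nu_{\mathcal C}$, and $$\mathrm{Mat}_{\mathcal C\mathcal D}(\overline{\mathrm K}_1(\phi))=\begin{pmatrix}\mathrm H(\phi)&R_{\mathcal C\mathcal D}(\phi)\\0&\mathrm K_1(\phi)\end{pmatrix}.$$ -/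

import Mathlib

noncomputable section

open Set Topology
open scoped ContDiff ComplexOrder

namespace NielsenThomsen

/-- The unitary group `U_n(A)` of the C⋆-algebra `M_n(A)`. -/
abbrev Un (A : Type*) [CStarAlgebra A] (n : ℕ) : Type _ :=
  unitary (CStarMatrix (Fin n) (Fin n) A)

section Pad

variable {A : Type*} [CStarAlgebra A]

/-- The matrix `diag(u, 1)` of size `m`, for a matrix `u` of size `n ≤ m`. -/
def padMat (n m : ℕ) (u : CStarMatrix (Fin n) (Fin n) A) : CStarMatrix (Fin m) (Fin m) A :=
  CStarMatrix.ofMatrix fun i j =>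
    if h : (i : ℕ) < n ∧ (j : ℕ) < n then u ⟨i, h.1⟩ ⟨j, h.2⟩ else if i = j then 1 else 0

theorem padMat_apply {n m : ℕ} (u : CStarMatrix (Fin n) (Fin n) A) (i j : Fin m) :
    padMat n m u i j =
      if h : (i : ℕ) < n ∧ (j : ℕ) < n then u ⟨i, h.1⟩ ⟨j, h.2⟩ else if i = j then 1 else 0 :=
  rfl

theorem padMat_one {n m : ℕ} : padMat n m (1 : CStarMatrix (Fin n) (Fin n) A) = 1 := by
  refine CStarMatrix.ext fun i j => ?_
  rw [padMat_apply]
  by_cases h : (i : ℕ) < n ∧ (j : ℕ) < n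
  · rw [dif_pos h, CStarMatrix.one_apply, CStarMatrix.one_apply]
    simp [Fin.ext_iff]
  · rw [dif_neg h, CStarMatrix.one_apply]

theorem padMat_mul {n m : ℕ} (h : n ≤ m) (u v : CStarMatrix (Fin n) (Fin n) A) :
    padMat n m (u * v) = padMat n m u * padMat n m v := by
  obtain ⟨k, rfl⟩ := Nat.exists_eq_add_of_le h
  refine CStarMatrix.ext fun i j => ?_
  rw [CStarMatrix.mul_apply, Fin.sum_univ_add]
  simp only [padMat_apply]
  have h1 : ∀ (a : Fin n) (b : Fin k), ¬ (n + (b : ℕ) = a) := fun a b => by omega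
  have h2 : ∀ (a : Fin n) (b : Fin k), ¬ ((a : ℕ) = n + b) := fun a b => by omega
  refine Fin.addCases (fun i => ?_) (fun i => ?_) i <;>
  refine Fin.addCases (fun j => ?_) (fun j => ?_) j
  · simp [CStarMatrix.mul_apply, Fin.ext_iff, h1, h2]
  · simp [Fin.ext_iff, h2]
  · simp [Fin.ext_iff, h1]
  · simp [Fin.ext_iff, h1, h2]
    simp [Fin.val_inj]

theorem padMat_star {n m : ℕ} (u : CStarMatrix (Fin n) (Fin n) A) :
    padMat n m (star u) = star (padMat n m u) := by
  refine CStarMatrix.ext fun i j => ?_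
  rw [CStarMatrix.star_apply, padMat_apply, padMat_apply]
  by_cases h : (i : ℕ) < n ∧ (j : ℕ) < n
  · rw [dif_pos h, dif_pos h.symm, CStarMatrix.star_apply]
  · rw [dif_neg h, dif_neg (fun h' => h h'.symm)]
    by_cases hij : i = j
    · simp [hij]
    · simp [hij, Ne.symm hij]

/-- The embedding `U_n(A) → U_m(A)`, `u ↦ diag(u, 1)`, for `n ≤ m`. -/
def pad (n m : ℕ) (h : n ≤ m) : Un A n →* Un A m where
  toFun u := ⟨padMat n m u, by
    rw [Unitary.mem_iff, ← padMat_star, ← padMat_mul h, ← padMat_mul h,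
      Unitary.star_mul_self_of_mem u.2, Unitary.mul_star_self_of_mem u.2, padMat_one]
    exact ⟨rfl, rfl⟩⟩
  map_one' := Subtype.ext padMat_one
  map_mul' u v := Subtype.ext (padMat_mul h _ _)

instance : DirectedSystem (Un A) (fun n m h => ⇑(pad (A := A) n m h)) where
  map_self n u := by
    refine Subtype.ext (CStarMatrix.ext fun i j => ?_)
    change padMat n n (u : CStarMatrix (Fin n) (Fin n) A) i j = _
    simp [padMat_apply]
  map_map k j i hij hjk u := by
    refine Subtype.ext (CStarMatrix.ext fun a b => ?_)
    change padMat j k (padMat i j (u : CStarMatrix (Fin i) (Fin i) A)) a b =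
      padMat i k (u : CStarMatrix (Fin i) (Fin i) A) a b
    simp only [padMat_apply]
    by_cases h : (a : ℕ) < i ∧ (b : ℕ) < i
    · have h' : (a : ℕ) < j ∧ (b : ℕ) < j := ⟨h.1.trans_le hij, h.2.trans_le hij⟩
      simp [h, h']
    · by_cases h' : (a : ℕ) < j ∧ (b : ℕ) < j
      · simp [h, h', Fin.ext_iff]
      · simp [h, h']

theorem Un.continuous_entry {n : ℕ} (i j : Fin n) :
    Continuous fun u : Un A n => (u : CStarMatrix (Fin n) (Fin n) A) i j :=
  (continuous_apply_apply (ρ := fun _ _ => A) i j).comp continuous_subtype_val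

theorem continuous_pad (n m : ℕ) (h : n ≤ m) : Continuous (pad (A := A) n m h) := by
  refine Continuous.subtype_mk ?_ _
  refine continuous_pi fun i => continuous_pi fun j => ?_
  change Continuous fun u : Un A n => padMat n m (u : CStarMatrix (Fin n) (Fin n) A) i j
  simp only [padMat_apply]
  by_cases hij : (i : ℕ) < n ∧ (j : ℕ) < n
  · simp only [hij, and_self, dite_true]
    exact Un.continuous_entry _ _
  · simp only [hij, dite_false]
    exact continuous_const

end Pad

instance (A : Type*) [CStarAlgebra A] (n : ℕ) :
    ContinuousMul (CStarMatrix (Fin n) (Fin n) A) where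
  continuous_mul := by
    refine continuous_pi fun i => continuous_pi fun j => ?_
    simp only [CStarMatrix.mul_apply]
    refine continuous_finsetSum _ fun k _ => ?_
    exact ((continuous_apply_apply (ρ := fun _ _ => A) i k).comp continuous_fst).mul
      ((continuous_apply_apply (ρ := fun _ _ => A) k j).comp continuous_snd)

instance (A : Type*) [CStarAlgebra A] (n : ℕ) :
    ContinuousStar (CStarMatrix (Fin n) (Fin n) A) where
  continuous_star := by
    refine continuous_pi fun i => continuous_pi fun j => ?_
    exact (continuous_apply_apply (ρ := fun _ _ => A) j i).star


/-! ### The group `U^∞(A)` -/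

/-- `U^∞(A)`, the inductive limit of the groups `U_n(A)` along `u ↦ diag(u, 1)`, with the inductive
limit topology. -/
def UInf (A : Type*) [CStarAlgebra A] : Type _ :=
  DirectLimit (Un A) (pad (A := A))

section UInf

variable {A : Type*} [CStarAlgebra A]

instance : Group (UInf A) := inferInstanceAs (Group (DirectLimit (Un A) (pad (A := A))))

/-- The final topology for the maps `U_n(A) → U^∞(A)`. -/
instance : TopologicalSpace (UInf A) :=
  inferInstanceAs (TopologicalSpace (Quotient (DirectLimit.setoid (pad (A := A)))))

/-- The class in `U^∞(A)` of a unitary matrix. -/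
def UInf.of (n : ℕ) : Un A n →* UInf A where
  toFun u := (⟦⟨n, u⟩⟧ : DirectLimit (Un A) (pad (A := A)))
  map_one' := (DirectLimit.one_def (f := pad (A := A)) n).symm
  map_mul' u v := (DirectLimit.mul_def (f := pad (A := A)) n u v).symm

theorem UInf.of_pad {n m : ℕ} (h : n ≤ m) (u : Un A n) :
    UInf.of m (pad n m h u) = UInf.of n u :=
  DirectLimit.mk_apply (f := pad (A := A)) n m u h

theorem UInf.exists_of (x : UInf A) : ∃ n u, x = UInf.of n u :=
  DirectLimit.exists_eq_mk (pad (A := A)) x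

theorem UInf.exists_of₂ (x y : UInf A) : ∃ n u v, x = UInf.of n u ∧ y = UInf.of n v :=
  DirectLimit.exists_eq_mk₂ (pad (A := A)) x y

theorem UInf.continuous_of (n : ℕ) : Continuous (UInf.of (A := A) n) :=
  continuous_quotient_mk'.comp continuous_sigmaMk

theorem UInf.continuous_iff {X : Type*} [TopologicalSpace X] {f : UInf A → X} :
    Continuous f ↔ ∀ n, Continuous fun u : Un A n => f (UInf.of n u) := by
  refine ⟨fun h n => h.comp (UInf.continuous_of n), fun h => ?_⟩
  exact continuous_coinduced_dom.2 (continuous_sigma fun n => h n)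

theorem UInf.continuous_mul_left (x : UInf A) : Continuous fun y => x * y := by
  obtain ⟨m, v, rfl⟩ := x.exists_of
  refine UInf.continuous_iff.2 fun n => ?_
  have h : (fun u : Un A n => UInf.of m v * UInf.of n u) = fun u =>
      UInf.of (max m n) (pad m _ (le_max_left m n) v * pad n _ (le_max_right m n) u) := by
    funext u
    rw [map_mul, UInf.of_pad, UInf.of_pad]
  rw [h]
  exact (UInf.continuous_of _).comp (continuous_const.mul (continuous_pad _ _ _))

theorem UInf.continuous_mul_right (x : UInf A) : Continuous fun y => y * x := by
  obtain ⟨m, v, rfl⟩ := x.exists_of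
  refine UInf.continuous_iff.2 fun n => ?_
  have h : (fun u : Un A n => UInf.of n u * UInf.of m v) = fun u =>
      UInf.of (max m n) (pad n _ (le_max_right m n) u * pad m _ (le_max_left m n) v) := by
    funext u
    rw [map_mul, UInf.of_pad, UInf.of_pad]
  rw [h]
  exact (UInf.continuous_of _).comp ((continuous_pad _ _ _).mul continuous_const)

theorem UInf.continuous_inv : Continuous fun y : UInf A => y⁻¹ := by
  refine UInf.continuous_iff.2 fun n => ?_
  simp only [← map_inv]
  exact (UInf.continuous_of n).comp ContinuousInv.continuous_inv

variable (A)

/-- The closure in `U^∞(A)` of the commutator subgroup `DU^∞(A)`. -/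
def closureDU : Subgroup (UInf A) where
  carrier := closure (commutator (UInf A) : Set (UInf A))
  one_mem' := subset_closure (one_mem _)
  inv_mem' {x} hx := map_mem_closure UInf.continuous_inv hx fun y hy => inv_mem hy
  mul_mem' {x y} hx hy := by
    have h : ∀ z ∈ commutator (UInf A),
        z * y ∈ closure (commutator (UInf A) : Set (UInf A)) := fun z hz =>
      map_mem_closure (UInf.continuous_mul_left z) hy fun w hw => mul_mem hz hw
    have := map_mem_closure (UInf.continuous_mul_right y) hx h
    rwa [closure_closure] at this

instance : (closureDU A).Normal where
  conj_mem _ hx g := map_mem_closure (f := fun y => g * y * g⁻¹)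
    ((UInf.continuous_mul_right g⁻¹).comp (UInf.continuous_mul_left g)) hx
    fun y hy => Subgroup.Normal.conj_mem inferInstance y hy g

/-- `U^∞_0(A)`, the subgroup of the classes of the unitary matrices that are connected to `1` by a
continuous path in some `U_n(A)`. -/
def UInf0 : Subgroup (UInf A) where
  carrier := {x | ∃ (n : ℕ) (u : Un A n), Joined 1 u ∧ UInf.of n u = x}
  one_mem' := ⟨0, 1, Joined.refl _, map_one _⟩
  inv_mem' := by
    rintro _ ⟨n, u, hu, rfl⟩
    refine ⟨n, u⁻¹, ?_, map_inv _ _⟩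
    have := hu.map (ContinuousInv.continuous_inv (G := Un A n))
    rwa [inv_one] at this
  mul_mem' := by
    rintro _ _ ⟨n, u, hu, rfl⟩ ⟨m, v, hv, rfl⟩
    refine ⟨max n m, pad n _ (le_max_left n m) u * pad m _ (le_max_right n m) v, ?_, ?_⟩
    · have h1 := hu.map (continuous_pad n _ (le_max_left n m))
      have h2 := hv.map (continuous_pad m _ (le_max_right n m))
      rw [map_one] at h1 h2
      simpa using h1.mul h2
    · rw [map_mul, UInf.of_pad, UInf.of_pad]

instance : (UInf0 A).Normal where
  conj_mem := by
    rintro _ ⟨n, u, hu, rfl⟩ g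
    obtain ⟨m, v, rfl⟩ := g.exists_of
    refine ⟨max n m, pad m _ (le_max_right n m) v * pad n _ (le_max_left n m) u *
      (pad m _ (le_max_right n m) v)⁻¹, ?_, ?_⟩
    · have h1 := hu.map ((continuous_const (y := pad m _ (le_max_right n m) v)).mul
        (continuous_pad n _ (le_max_left n m)) |>.mul
        (continuous_const (y := (pad m _ (le_max_right n m) v)⁻¹)))
      simpa using h1
    · rw [map_mul, map_mul, map_inv, UInf.of_pad, UInf.of_pad]

/-- The Hausdorffized algebraic `K₁`-group `U^∞(A) / closure (DU^∞(A))`, written additively. -/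
def K1bar : Type _ := Additive (UInf A ⧸ closureDU A)

instance : AddGroup (K1bar A) := inferInstanceAs (AddGroup (Additive (UInf A ⧸ closureDU A)))

instance : AddCommGroup (K1bar A) :=
  { (inferInstance : AddGroup (K1bar A)) with
    add_comm := fun x y => by
      have h : commutator (UInf A) ≤ closureDU A := fun z hz => subset_closure hz
      exact congrArg Additive.ofMul ((Subgroup.Normal.quotient_commutative_iff_commutator_le.2
        h).is_comm.comm (Additive.toMul x) (Additive.toMul y)) }

/-- The group `K₁(A) = U^∞(A) / U^∞_0(A)`, written additively. -/
def K1 : Type _ := Additive (UInf A ⧸ UInf0 A)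

instance : AddGroup (K1 A) := inferInstanceAs (AddGroup (Additive (UInf A ⧸ UInf0 A)))

variable {A}

/-- The class of `u ∈ U^∞(A)` in the Hausdorffized algebraic `K₁`-group. -/
def toK1bar (u : UInf A) : K1bar A := Additive.ofMul (QuotientGroup.mk u)

/-- The class of `u ∈ U^∞(A)` in `K₁(A)`. -/
def toK1 (u : UInf A) : K1 A := Additive.ofMul (QuotientGroup.mk u)

/-- The matrix `diag(u, v)`. -/
def blockMat {n m : ℕ} (u : CStarMatrix (Fin n) (Fin n) A) (v : CStarMatrix (Fin m) (Fin m) A) :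
    CStarMatrix (Fin (n + m)) (Fin (n + m)) A :=
  CStarMatrix.ofMatrix ((Matrix.fromBlocks (CStarMatrix.ofMatrix.symm u) 0 0
    (CStarMatrix.ofMatrix.symm v)).submatrix finSumFinEquiv.symm finSumFinEquiv.symm)

theorem blockMat_mul {n m : ℕ} (u u' : CStarMatrix (Fin n) (Fin n) A)
    (v v' : CStarMatrix (Fin m) (Fin m) A) :
    blockMat u v * blockMat u' v' = blockMat (u * u') (v * v') := by
  have h : ∀ (a a' : Matrix (Fin n) (Fin n) A) (b b' : Matrix (Fin m) (Fin m) A),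
      (Matrix.fromBlocks a 0 0 b).submatrix finSumFinEquiv.symm finSumFinEquiv.symm *
        (Matrix.fromBlocks a' 0 0 b').submatrix finSumFinEquiv.symm finSumFinEquiv.symm =
      (Matrix.fromBlocks (a * a') 0 0 (b * b')).submatrix
        finSumFinEquiv.symm finSumFinEquiv.symm := by
    intro a a' b b'
    rw [Matrix.submatrix_mul_equiv, Matrix.fromBlocks_multiply]
    simp
  exact h _ _ _ _

theorem blockMat_one {n m : ℕ} :
    blockMat (1 : CStarMatrix (Fin n) (Fin n) A) (1 : CStarMatrix (Fin m) (Fin m) A) = 1 := by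
  have h : (Matrix.fromBlocks (1 : Matrix (Fin n) (Fin n) A) 0 0
      (1 : Matrix (Fin m) (Fin m) A)).submatrix finSumFinEquiv.symm finSumFinEquiv.symm = 1 := by
    rw [Matrix.fromBlocks_one, Matrix.submatrix_one_equiv]
  exact h

theorem blockMat_star {n m : ℕ} (u : CStarMatrix (Fin n) (Fin n) A)
    (v : CStarMatrix (Fin m) (Fin m) A) :
    star (blockMat u v) = blockMat (star u) (star v) := by
  have h : ∀ (a : Matrix (Fin n) (Fin n) A) (b : Matrix (Fin m) (Fin m) A),
      ((Matrix.fromBlocks a 0 0 b).submatrix finSumFinEquiv.symm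
        finSumFinEquiv.symm).conjTranspose =
      (Matrix.fromBlocks a.conjTranspose 0 0 b.conjTranspose).submatrix
        finSumFinEquiv.symm finSumFinEquiv.symm := by
    intro a b
    rw [Matrix.conjTranspose_submatrix, Matrix.fromBlocks_conjTranspose]
    simp
  exact h _ _

/-- The unitary matrix `diag(u, v)` of size `n + m`. -/
def blockDiag {n m : ℕ} (u : Un A n) (v : Un A m) : Un A (n + m) :=
  ⟨blockMat u v, by
    rw [Unitary.mem_iff, blockMat_star, blockMat_mul, blockMat_mul,
      Unitary.star_mul_self_of_mem u.2, Unitary.mul_star_self_of_mem u.2,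
      Unitary.star_mul_self_of_mem v.2, Unitary.mul_star_self_of_mem v.2, blockMat_one]
    exact ⟨rfl, rfl⟩⟩

end UInf

/-! ### Functoriality of the unitary groups -/

section Map

variable {A B : Type*} [CStarAlgebra A] [CStarAlgebra B] (φ : A →⋆ₙₐ[ℂ] B)

/-- A `*`-homomorphism `Φ`, not necessarily unital, sends a unitary `u` to the unitary
`Φ(u) + 1 - Φ(1)`, which is `Φ(u)` when `Φ` is unital. -/
def unitaryMap {R S : Type*} [Ring R] [StarRing R] [Module ℂ R] [Ring S] [StarRing S] [Module ℂ S]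
    (Φ : R →⋆ₙₐ[ℂ] S) : unitary R →* unitary S where
  toFun u := ⟨Φ u + (1 - Φ 1), by
    have h1 : star (Φ 1) = Φ 1 := by rw [← map_star, star_one]
    have h2 : Φ 1 * Φ 1 = Φ 1 := by rw [← map_mul, one_mul]
    rw [Unitary.mem_iff, star_add, star_sub, star_one, h1, ← map_star]
    constructor
    · simp only [add_mul, mul_add, sub_mul, mul_sub, one_mul, mul_one, ← map_mul,
        Unitary.star_mul_self_of_mem u.2]
      abel
    · simp only [add_mul, mul_add, sub_mul, mul_sub, one_mul, mul_one, ← map_mul,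
        Unitary.mul_star_self_of_mem u.2]
      abel⟩
  map_one' := Subtype.ext (by simp)
  map_mul' u v := Subtype.ext (by
    simp only [Submonoid.coe_mul, add_mul, mul_add, sub_mul, mul_sub, one_mul, mul_one, ← map_mul]
    abel)

/-- The homomorphism `U_n(A) → U_n(B)` induced by `φ`. -/
def Un.map (n : ℕ) : Un A n →* Un B n := unitaryMap (CStarMatrix.mapₙₐ φ)

theorem Un.map_apply (n : ℕ) (u : Un A n) (i j : Fin n) :
    (Un.map φ n u : CStarMatrix (Fin n) (Fin n) B) i j =
      φ ((u : CStarMatrix (Fin n) (Fin n) A) i j) + if i = j then 1 - φ 1 else 0 := by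
  change φ ((u : CStarMatrix (Fin n) (Fin n) A) i j) +
    ((1 : CStarMatrix (Fin n) (Fin n) B) i j - φ ((1 : CStarMatrix (Fin n) (Fin n) A) i j)) = _
  rw [CStarMatrix.one_apply, CStarMatrix.one_apply]
  split_ifs <;> simp

theorem continuous_hom : Continuous φ :=
  AddMonoidHomClass.continuous_of_bound φ 1 fun a => by
    simpa using NonUnitalStarAlgHom.norm_apply_le φ a

theorem Un.continuous_map (n : ℕ) : Continuous (Un.map φ n) := by
  rw [continuous_induced_rng]
  refine continuous_pi fun i => continuous_pi fun j => ?_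
  change Continuous fun u : Un A n => (Un.map φ n u : CStarMatrix (Fin n) (Fin n) B) i j
  simp only [Un.map_apply]
  exact ((continuous_hom φ).comp (Un.continuous_entry i j)).add continuous_const

theorem Un.map_pad (n m : ℕ) (h : n ≤ m) (u : Un A n) :
    pad n m h (Un.map φ n u) = Un.map φ m (pad n m h u) := by
  refine Subtype.ext (CStarMatrix.ext fun i j => ?_)
  rw [Un.map_apply]
  change padMat n m (Un.map φ n u : CStarMatrix (Fin n) (Fin n) B) i j =
    φ (padMat n m (u : CStarMatrix (Fin n) (Fin n) A) i j) + _
  rw [padMat_apply, padMat_apply]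
  by_cases hij : (i : ℕ) < n ∧ (j : ℕ) < n
  · rw [dif_pos hij, dif_pos hij, Un.map_apply]
    simp [Fin.ext_iff]
  · rw [dif_neg hij, dif_neg hij]
    split_ifs <;> simp

/-- The homomorphism `U^∞(A) → U^∞(B)` induced by `φ`. -/
def UInf.map : UInf A →* UInf B where
  toFun := DirectLimit.map (pad (A := A)) (pad (A := B)) (fun n => Un.map φ n)
    (fun n m h u => Un.map_pad φ n m h u)
  map_one' := by
    refine (congrArg _ (map_one (UInf.of (A := A) 0)).symm).trans ?_
    change UInf.of 0 (Un.map φ 0 1) = 1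
    rw [map_one, map_one]
  map_mul' x y := by
    obtain ⟨n, u, v, rfl, rfl⟩ := UInf.exists_of₂ x y
    refine (congrArg _ (map_mul (UInf.of n) u v).symm).trans ?_
    change UInf.of n (Un.map φ n (u * v)) = UInf.of n (Un.map φ n u) * UInf.of n (Un.map φ n v)
    rw [map_mul, map_mul]

theorem UInf.map_of (n : ℕ) (u : Un A n) : UInf.map φ (UInf.of n u) = UInf.of n (Un.map φ n u) :=
  rfl

theorem UInf.continuous_map : Continuous (UInf.map φ) :=
  UInf.continuous_iff.2 fun n => (UInf.continuous_of n).comp (Un.continuous_map φ n)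

theorem closureDU_le : closureDU A ≤ (closureDU B).comap (UInf.map φ) := fun x hx =>
  map_mem_closure (UInf.continuous_map φ) hx fun y hy => by
    have h : (commutator (UInf A)).map (UInf.map φ) ≤ commutator (UInf B) := by
      rw [commutator_def, Subgroup.map_commutator, commutator_def]
      exact Subgroup.commutator_mono le_top le_top
    exact h (Subgroup.mem_map_of_mem _ hy)

theorem UInf0_le : UInf0 A ≤ (UInf0 B).comap (UInf.map φ) := by
  rintro _ ⟨n, u, hu, rfl⟩
  have h := hu.map (Un.continuous_map φ n)
  rw [map_one] at h
  exact ⟨n, _, h, rfl⟩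

/-- The homomorphism between the Hausdorffized algebraic `K₁`-groups induced by `φ`. -/
def K1bar.map : K1bar A →+ K1bar B :=
  MonoidHom.toAdditive (QuotientGroup.map (closureDU A) (closureDU B) (UInf.map φ)
    (closureDU_le φ))

/-- The homomorphism `K₁(φ)`. -/
def K1.map : K1 A →+ K1 B :=
  MonoidHom.toAdditive (QuotientGroup.map (UInf0 A) (UInf0 B) (UInf.map φ) (UInf0_le φ))

end Map

/-! ### Tracial states and `Aff T₁(A)` -/

section Traces

/-- The tracial states of `A`, with the weak-* topology. -/
abbrev TracialState (A : Type*) [CStarAlgebra A] : Type _ :=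
  {τ : WeakDual ℂ A // (∀ a, 0 ≤ τ (star a * a)) ∧ τ 1 = 1 ∧ ∀ a b, τ (a * b) = τ (b * a)}

variable {A B : Type*} [CStarAlgebra A] [CStarAlgebra B]

theorem positive_bound (μ : A →ₗ[ℂ] ℂ) (hμ : ∀ a, 0 ≤ μ (star a * a)) (a : A) :
    ‖μ a‖ ≤ (μ 1).re * ‖a‖ := by
  let _ := CStarAlgebra.spectralOrder A
  have _ := CStarAlgebra.spectralOrderedRing A
  have hpos : ∀ x : A, 0 ≤ x → 0 ≤ μ x := by
    intro x hx
    obtain ⟨b, rfl⟩ := CStarAlgebra.nonneg_iff_eq_star_mul_self.1 hx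
    exact hμ b
  let f : A →ₚ[ℂ] ℂ := PositiveLinearMap.mk₀ μ hpos
  have hcs := norm_inner_le_norm (𝕜 := ℂ) (f.toPreGNS 1) (f.toPreGNS a)
  have h1 : inner ℂ (f.toPreGNS 1) (f.toPreGNS a) = μ a := by
    rw [PositiveLinearMap.preGNS_inner_def]
    simp [f]
    rfl
  have h2 : ‖f.toPreGNS 1‖ = √(μ 1).re := by
    rw [PositiveLinearMap.preGNS_norm_def]
    simp [f]
    rfl
  have h3 : ‖f.toPreGNS a‖ = √(μ (star a * a)).re := by
    rw [PositiveLinearMap.preGNS_norm_def]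
    rfl
  have h0 : 0 ≤ (μ 1).re := by
    have := hμ 1
    rw [star_one, one_mul] at this
    exact (Complex.nonneg_iff.1 this).1
  have h4 : (μ (star a * a)).re ≤ ‖a‖ ^ 2 * (μ 1).re := by
    have h := hpos _ (sub_nonneg.2 (CStarAlgebra.star_mul_le_algebraMap_norm_sq (a := a)))
    rw [map_sub] at h
    have h5 := (Complex.nonneg_iff.1 h).1
    have h6 : algebraMap ℝ A (‖a‖ ^ 2) = ((‖a‖ ^ 2 : ℝ) : ℂ) • (1 : A) := by
      rw [Algebra.algebraMap_eq_smul_one, Complex.coe_smul]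
    rw [h6, map_smul, smul_eq_mul, Complex.sub_re, Complex.re_ofReal_mul] at h5
    linarith
  rw [h1, h2, h3] at hcs
  calc ‖μ a‖ ≤ √(μ 1).re * √(μ (star a * a)).re := hcs
    _ ≤ √(μ 1).re * √(‖a‖ ^ 2 * (μ 1).re) := by gcongr
    _ = (μ 1).re * ‖a‖ := by
      rw [Real.sqrt_mul (by positivity), Real.sqrt_sq (norm_nonneg a)]
      linear_combination ‖a‖ * Real.mul_self_sqrt h0

namespace TracialState

theorem norm_le (τ : TracialState A) (a : A) : ‖τ.1 a‖ ≤ ‖a‖ := by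
  have := positive_bound (τ.1 : A →ₗ[ℂ] ℂ) τ.2.1 a
  have h : (τ.1 : A →ₗ[ℂ] ℂ) 1 = 1 := τ.2.2.1
  rw [h] at this
  simpa using this

theorem continuous_eval (a : A) : Continuous fun τ : TracialState A => τ.1 a :=
  (WeakDual.eval_continuous a).comp continuous_subtype_val

instance : CompactSpace (TracialState A) := by
  refine isCompact_iff_compactSpace.1 ?_
  have hcl : IsClosed {τ : WeakDual ℂ A |
      (∀ a, 0 ≤ τ (star a * a)) ∧ τ 1 = 1 ∧ ∀ a b, τ (a * b) = τ (b * a)} := by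
    simp only [Set.ofPred_and, Set.ofPred_forall]
    refine (isClosed_iInter fun a => ?_).inter (IsClosed.inter ?_
      (isClosed_iInter fun a => isClosed_iInter fun b => ?_))
    · exact isClosed_le continuous_const (WeakDual.eval_continuous _)
    · exact isClosed_eq (WeakDual.eval_continuous _) continuous_const
    · exact isClosed_eq (WeakDual.eval_continuous _) (WeakDual.eval_continuous _)
  refine (WeakDual.isCompact_closedBall (𝕜 := ℂ) (E := A) 0 1).of_isClosed_subset hcl ?_
  intro τ hτ
  rw [mem_preimage, mem_closedBall_zero_iff]
  refine ContinuousLinearMap.opNorm_le_bound _ zero_le_one fun a => ?_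
  rw [one_mul]
  exact norm_le ⟨τ, hτ⟩ a

end TracialState

variable (A)

/-- `Aff T₁(A)`, the continuous affine functions `T₁(A) → ℝ`, with the supremum norm. -/
def AffT1 : Submodule ℝ C(TracialState A, ℝ) where
  carrier := {f | ∀ (ρ σ τ : TracialState A) (t : ℝ), 0 ≤ t → t ≤ 1 →
    (∀ a, ρ.1 a = (t : ℂ) * σ.1 a + (1 - t : ℂ) * τ.1 a) → f ρ = t * f σ + (1 - t) * f τ}
  zero_mem' := by intro ρ σ τ t _ _ _; simp
  add_mem' := by
    intro f g hf hg ρ σ τ t h0 h1 h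
    rw [ContinuousMap.add_apply, hf ρ σ τ t h0 h1 h, hg ρ σ τ t h0 h1 h]
    simp only [ContinuousMap.add_apply]
    ring
  smul_mem' := by
    intro c f hf ρ σ τ t h0 h1 h
    rw [ContinuousMap.smul_apply, hf ρ σ τ t h0 h1 h]
    simp only [ContinuousMap.smul_apply, smul_eq_mul]
    ring

variable {A}

/-- The affine function `ev_a : τ ↦ τ(a)` of a self-adjoint element `a` (on which tracial states are
real-valued; in general, `τ ↦ Re τ(a)`). -/
def ev (a : A) : AffT1 A where
  val := ⟨fun τ => (τ.1 a).re, Complex.continuous_re.comp (TracialState.continuous_eval a)⟩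
  property := by
    intro ρ σ τ t _ _ h
    change (ρ.1 a).re = t * (σ.1 a).re + (1 - t) * (τ.1 a).re
    have h' : (1 - t : ℂ) = ((1 - t : ℝ) : ℂ) := by push_cast; rfl
    rw [h a, Complex.add_re, h', Complex.re_ofReal_mul, Complex.re_ofReal_mul]

variable (A)

/-- The image of the homomorphism `K₀(A) → Aff T₁(A)`, `[p] ↦ ev_p`: the subgroup generated by the
functions `τ ↦ ∑ i, τ(p i i)` of projections `p ∈ M_n(A)`. -/
def imageK0 : AddSubgroup (AffT1 A) :=
  AddSubgroup.closure {f | ∃ (n : ℕ) (p : CStarMatrix (Fin n) (Fin n) A),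
    IsStarProjection p ∧ f = ev (∑ i, p i i)}

/-- The group `H(A) = Aff T₁(A) / closure (im K₀(A))`. -/
def H : Type _ := AffT1 A ⧸ (imageK0 A).topologicalClosure

instance : AddCommGroup (H A) :=
  inferInstanceAs (AddCommGroup (AffT1 A ⧸ (imageK0 A).topologicalClosure))

variable {A}

/-- The class in `H(A)` of a function in `Aff T₁(A)`. -/
def toH (f : AffT1 A) : H A := QuotientAddGroup.mk f

/-! ### Functoriality of `Aff T₁` and `H` -/

variable (φ : A →⋆ₙₐ[ℂ] B)

theorem comp_bound (σ : TracialState B) (a : A) : ‖σ.1 (φ a)‖ ≤ (σ.1 (φ 1)).re * ‖a‖ := by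
  refine positive_bound ((σ.1 : B →ₗ[ℂ] ℂ) ∘ₗ (φ : A →ₗ[ℂ] B)) (fun b => ?_) a
  change 0 ≤ σ.1 (φ (star b * b))
  rw [map_mul, map_star]
  exact σ.2.1 _

theorem mass_nonneg (σ : TracialState B) : 0 ≤ σ.1 (φ 1) := by
  have h := σ.2.1 (φ 1)
  rwa [← map_star, ← map_mul, star_one, one_mul] at h

/-- The mass `σ(φ(1))` of the trace `σ ∘ φ`. -/
def mass (σ : TracialState B) : ℝ := (σ.1 (φ 1)).re

theorem mass_eq (σ : TracialState B) : σ.1 (φ 1) = (mass φ σ : ℂ) :=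
  Complex.ext rfl (by simpa using (Complex.nonneg_iff.1 (mass_nonneg φ σ)).2.symm)

theorem mass_nonneg' (σ : TracialState B) : 0 ≤ mass φ σ :=
  (Complex.nonneg_iff.1 (mass_nonneg φ σ)).1

theorem mass_le (σ : TracialState B) : mass φ σ ≤ 1 := by
  have h1 : mass φ σ ≤ ‖σ.1 (φ 1)‖ := Complex.re_le_norm _
  have h2 := NonUnitalStarAlgHom.norm_apply_le φ (1 : A)
  have h3 : ‖(1 : A)‖ ≤ 1 := by
    rcases subsingleton_or_nontrivial A with h | h
    · rw [Subsingleton.elim (1 : A) 0, norm_zero]; exact zero_le_one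
    · rw [CStarRing.norm_one]
  exact h1.trans ((σ.norm_le _).trans (h2.trans h3))

theorem continuous_mass : Continuous (mass φ) :=
  Complex.continuous_re.comp (TracialState.continuous_eval _)

/-- The tracial state `σ ∘ φ / σ(φ(1))`, for a tracial state `σ` with `σ(φ(1)) ≠ 0`. -/
def TracialState.pull (σ : TracialState B) (h : mass φ σ ≠ 0) : TracialState A where
  val := StrongDual.toWeakDual (((mass φ σ)⁻¹ : ℂ) • ((WeakDual.toStrongDual σ.1).comp
    ⟨(φ : A →ₗ[ℂ] B), continuous_hom φ⟩))
  property := by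
    have key : ∀ a, (StrongDual.toWeakDual (((mass φ σ)⁻¹ : ℂ) • ((WeakDual.toStrongDual σ.1).comp
      ⟨(φ : A →ₗ[ℂ] B), continuous_hom φ⟩))) a = ((mass φ σ)⁻¹ : ℂ) * σ.1 (φ a) := fun a => rfl
    refine ⟨fun a => ?_, ?_, fun a b => ?_⟩
    · rw [key, map_mul, map_star, ← Complex.ofReal_inv]
      exact mul_nonneg (Complex.zero_le_real.2 (inv_nonneg.2 (mass_nonneg' φ σ))) (σ.2.1 _)
    · rw [key, mass_eq]
      exact inv_mul_cancel₀ (Complex.ofReal_ne_zero.2 h)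
    · rw [key, key, map_mul φ, map_mul φ, σ.2.2.2]

theorem TracialState.pull_apply (σ : TracialState B) (h : mass φ σ ≠ 0) (a : A) :
    (σ.pull φ h).1 a = ((mass φ σ)⁻¹ : ℂ) * σ.1 (φ a) := rfl

open Classical in
/-- The function `σ ↦ σ(φ(1)) f(σ ∘ φ / σ(φ(1)))` on `T₁(B)`, with the value `0` where `σ ∘ φ = 0`;
for unital `φ` this is `σ ↦ f(σ ∘ φ)`. -/
def affFun (f : TracialState A → ℝ) (σ : TracialState B) : ℝ :=
  if h : mass φ σ = 0 then 0 else mass φ σ * f (σ.pull φ h)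

theorem affFun_bound (f : C(TracialState A, ℝ)) (σ : TracialState B) :
    |affFun φ f σ| ≤ mass φ σ * ‖f‖ := by
  unfold affFun
  split_ifs with h
  · simp [h]
  · rw [abs_mul, abs_of_nonneg (mass_nonneg' φ σ)]
    exact mul_le_mul_of_nonneg_left (f.norm_coe_le_norm _) (mass_nonneg' φ σ)

theorem continuous_affFun (f : C(TracialState A, ℝ)) : Continuous (affFun φ f) := by
  rw [continuous_iff_continuousAt]
  intro σ
  by_cases h : mass φ σ = 0
  · have h0 : affFun φ f σ = 0 := by simp [affFun, h]
    rw [ContinuousAt, h0]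
    refine squeeze_zero_norm (a := fun τ => mass φ τ * ‖f‖) (fun τ => affFun_bound φ f τ) ?_
    have := ((continuous_mass φ).mul (continuous_const (y := ‖f‖))).tendsto σ
    change Filter.Tendsto _ _ (𝓝 (mass φ σ * ‖f‖)) at this
    rw [h, zero_mul] at this
    exact this
  · have hopen : IsOpen {τ : TracialState B | mass φ τ ≠ 0} :=
      isOpen_ne_fun (continuous_mass φ) continuous_const
    refine ContinuousOn.continuousAt (s := {τ | mass φ τ ≠ 0}) ?_ (hopen.mem_nhds h)
    rw [continuousOn_iff_continuous_domRestrict]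
    have heq : ({τ : TracialState B | mass φ τ ≠ 0}).domRestrict (affFun φ f) =
        fun τ => mass φ τ.1 * f (τ.1.pull φ τ.2) := by
      funext τ
      exact dif_neg τ.2
    rw [heq]
    refine ((continuous_mass φ).comp continuous_subtype_val).mul (f.continuous.comp ?_)
    refine continuous_induced_rng.2 (WeakDual.continuous_of_continuous_eval fun a => ?_)
    change Continuous fun τ : {τ : TracialState B | mass φ τ ≠ 0} =>
      ((mass φ τ.1)⁻¹ : ℂ) * τ.1.1 (φ a)
    refine Continuous.mul ?_ ((TracialState.continuous_eval _).comp continuous_subtype_val)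
    exact (Complex.continuous_ofReal.comp ((continuous_mass φ).comp continuous_subtype_val)).inv₀
      fun τ => Complex.ofReal_ne_zero.2 τ.2

theorem comp_eq_zero {σ : TracialState B} (h : mass φ σ = 0) (a : A) : σ.1 (φ a) = 0 := by
  have := comp_bound φ σ a
  change _ ≤ mass φ σ * _ at this
  rw [h, zero_mul] at this
  exact norm_le_zero_iff.1 this

theorem affFun_affine (f : AffT1 A) (ρ σ τ : TracialState B) (t : ℝ) (h0 : 0 ≤ t) (h1 : t ≤ 1)
    (h : ∀ b, ρ.1 b = (t : ℂ) * σ.1 b + (1 - t : ℂ) * τ.1 b) :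
    affFun φ f.1 ρ = t * affFun φ f.1 σ + (1 - t) * affFun φ f.1 τ := by
  have ht : (1 - t : ℂ) = ((1 - t : ℝ) : ℂ) := by push_cast; rfl
  have hm : mass φ ρ = t * mass φ σ + (1 - t) * mass φ τ := by
    unfold mass
    rw [h, Complex.add_re, ht, Complex.re_ofReal_mul, Complex.re_ofReal_mul]
  have hs := mass_nonneg' φ σ
  have hτ := mass_nonneg' φ τ
  by_cases hr : mass φ ρ = 0
  · have e1 : t * mass φ σ = 0 := by nlinarith [mul_nonneg h0 hs, mul_nonneg (sub_nonneg.2 h1) hτ]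
    have e2 : (1 - t) * mass φ τ = 0 := by linarith
    have z : ∀ (s : ℝ) (w : TracialState B), s * mass φ w = 0 → s * affFun φ f.1 w = 0 := by
      intro s w e
      rcases mul_eq_zero.1 e with e | e
      · rw [e, zero_mul]
      · simp [affFun, e]
    rw [z _ _ e1, z _ _ e2]
    simp [affFun, hr]
  · have hrc : (mass φ ρ : ℂ) ≠ 0 := Complex.ofReal_ne_zero.2 hr
    by_cases hs0 : mass φ σ = 0
    · have ht0 : mass φ τ ≠ 0 := fun e => hr (by rw [hm, hs0, e]; ring)
      have hm' : mass φ ρ = (1 - t) * mass φ τ := by rw [hm, hs0]; ring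
      have hpull : ρ.pull φ hr = τ.pull φ ht0 := by
        refine Subtype.ext (ContinuousLinearMap.ext fun a => ?_)
        change (ρ.pull φ hr).1 a = (τ.pull φ ht0).1 a
        have htc : (mass φ τ : ℂ) ≠ 0 := Complex.ofReal_ne_zero.2 ht0
        rw [TracialState.pull_apply, TracialState.pull_apply, h, comp_eq_zero φ hs0]
        rw [hm', Complex.ofReal_mul, ← ht] at hrc ⊢
        have := left_ne_zero_of_mul hrc
        field_simp
        ring
      have e1 : affFun φ f.1 σ = 0 := by simp [affFun, hs0]
      rw [e1]
      unfold affFun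
      rw [dif_neg hr, dif_neg ht0, hpull, hm']
      ring
    · by_cases ht0 : mass φ τ = 0
      · have hm' : mass φ ρ = t * mass φ σ := by rw [hm, ht0]; ring
        have hpull : ρ.pull φ hr = σ.pull φ hs0 := by
          refine Subtype.ext (ContinuousLinearMap.ext fun a => ?_)
          change (ρ.pull φ hr).1 a = (σ.pull φ hs0).1 a
          have hsc : (mass φ σ : ℂ) ≠ 0 := Complex.ofReal_ne_zero.2 hs0
          rw [TracialState.pull_apply, TracialState.pull_apply, h, comp_eq_zero φ ht0]
          rw [hm', Complex.ofReal_mul] at hrc ⊢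
          have := left_ne_zero_of_mul hrc
          field_simp
          ring
        have e1 : affFun φ f.1 τ = 0 := by simp [affFun, ht0]
        rw [e1]
        unfold affFun
        rw [dif_neg hr, dif_neg hs0, hpull, hm']
        ring
      · have hsc : (mass φ σ : ℂ) ≠ 0 := Complex.ofReal_ne_zero.2 hs0
        have htc : (mass φ τ : ℂ) ≠ 0 := Complex.ofReal_ne_zero.2 ht0
        have hrpos : 0 < mass φ ρ := lt_of_le_of_ne (mass_nonneg' φ ρ) (Ne.symm hr)
        have hf := f.2 (ρ.pull φ hr) (σ.pull φ hs0) (τ.pull φ ht0) (t * mass φ σ / mass φ ρ)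
          (by positivity)
          ((div_le_one hrpos).2 (by nlinarith [mul_nonneg (sub_nonneg.2 h1) hτ]))
          (fun a => by
            rw [TracialState.pull_apply, TracialState.pull_apply, TracialState.pull_apply, h]
            have hmc : (mass φ ρ : ℂ) = t * mass φ σ + (1 - t) * mass φ τ := by
              rw [hm]; push_cast; ring
            push_cast
            have : (1 - (t : ℂ) * mass φ σ / mass φ ρ) = (1 - t) * mass φ τ / mass φ ρ := by
              rw [eq_div_iff hrc, sub_mul, div_mul_cancel₀ _ hrc, hmc]; ring
            rw [this]
            field_simp)
        unfold affFun
        rw [dif_neg hr, dif_neg hs0, dif_neg ht0, hf]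
        have : (1 - t * mass φ σ / mass φ ρ) = (1 - t) * mass φ τ / mass φ ρ := by
          rw [eq_div_iff hr, sub_mul, div_mul_cancel₀ _ hr, hm]; ring
        rw [this]
        field_simp

/-- The homomorphism `Aff T₁(A) → Aff T₁(B)` induced by `φ`, which sends `ev_a` to `ev_{φ(a)}`. -/
def AffT1.map : AffT1 A →+ AffT1 B where
  toFun f := ⟨⟨affFun φ f.1, continuous_affFun φ f.1⟩, affFun_affine φ f⟩
  map_zero' := Subtype.ext (ContinuousMap.ext fun σ => by
    change affFun φ (fun _ => 0) σ = 0
    simp [affFun])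
  map_add' f g := Subtype.ext (ContinuousMap.ext fun σ => by
    change affFun φ (fun τ => f.1 τ + g.1 τ) σ = affFun φ f.1 σ + affFun φ g.1 σ
    unfold affFun
    split_ifs
    · simp
    · ring)

theorem AffT1.map_ev (a : A) : AffT1.map φ (ev a) = ev (φ a) := by
  refine Subtype.ext (ContinuousMap.ext fun σ => ?_)
  change affFun φ (fun τ => (τ.1 a).re) σ = (σ.1 (φ a)).re
  unfold affFun
  split_ifs with h
  · rw [comp_eq_zero φ h, Complex.zero_re]
  · change _ * ((σ.pull φ h).1 a).re = _
    rw [TracialState.pull_apply, ← Complex.ofReal_inv, Complex.re_ofReal_mul,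
      mul_inv_cancel_left₀ h]

theorem AffT1.continuous_map : Continuous (AffT1.map φ) := by
  refine AddMonoidHomClass.continuous_of_bound (AffT1.map φ) 1 fun f => ?_
  rw [one_mul]
  refine (ContinuousMap.norm_le _ (norm_nonneg _)).2 fun σ => ?_
  refine (affFun_bound φ f.1 σ).trans ?_
  exact mul_le_of_le_one_left (norm_nonneg _) (mass_le φ σ)

theorem imageK0_le : imageK0 A ≤ (imageK0 B).comap (AffT1.map φ) := by
  refine (AddSubgroup.closure_le _).2 ?_
  rintro _ ⟨n, p, hp, rfl⟩
  refine AddSubgroup.subset_closure ⟨n, CStarMatrix.mapₙₐ φ p, hp.map _, ?_⟩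
  rw [AffT1.map_ev, map_sum]
  rfl

theorem closure_imageK0_le : (imageK0 A).topologicalClosure ≤
    (imageK0 B).topologicalClosure.comap (AffT1.map φ) := fun _ hx =>
  map_mem_closure (AffT1.continuous_map φ) hx (imageK0_le φ)

/-- The homomorphism `H(φ)`, which sends `[ev_a]` to `[ev_{φ(a)}]`. -/
def H.map : H A →+ H B :=
  QuotientAddGroup.map _ _ (AffT1.map φ) (closure_imageK0_le φ)

end Traces

/-! ### The de la Harpe-Skandalis determinant -/

section Det

variable {A : Type*} [CStarAlgebra A]

/-- `ξ`, restricted to `[0, 1]`, is a smooth path of unitary matrices from `1` to `u`. Smoothness is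
stated entrywise, which is the same as smoothness for the norm of `M_n(A)`. -/
structure IsSmoothPath {n : ℕ} (ξ : ℝ → CStarMatrix (Fin n) (Fin n) A) (u : Un A n) : Prop where
  unitary : ∀ t ∈ Icc (0 : ℝ) 1, ξ t ∈ unitary (CStarMatrix (Fin n) (Fin n) A)
  smooth : ∀ i j, ContDiffOn ℝ ∞ (fun t => ξ t i j) (Icc 0 1)
  source : ξ 0 = 1
  target : ξ 1 = u

/-- `(1 / 2πi) ∫₀¹ tr(ξ'(t) ξ(t)⁻¹) dt ∈ A`, where `tr` is the sum of the diagonal entries and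
`ξ(t)⁻¹ = ξ(t)*`. This element of `A` is self-adjoint, since `ξ' ξ⁻¹` is skew-adjoint. -/
def pathDet {n : ℕ} (ξ : ℝ → CStarMatrix (Fin n) (Fin n) A) : A :=
  ((2 * Real.pi * Complex.I)⁻¹ : ℂ) • ∫ t in (0 : ℝ)..1,
    ∑ i, ∑ j, derivWithin (fun s => ξ s i j) (Icc 0 1) t * star (ξ t i j)

/-- `y` is the class in `H(A)` of `(1 / 2πi) ∫₀¹ Tr(ξ'(t) ξ(t)⁻¹) dt ∈ Aff T₁(A)`, for some smooth
path `ξ` of unitary matrices from `1` to a representative of `x`. -/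
def IsDetBar (x : UInf A) (y : H A) : Prop :=
  ∃ (n : ℕ) (u : Un A n) (ξ : ℝ → CStarMatrix (Fin n) (Fin n) A),
    UInf.of n u = x ∧ IsSmoothPath ξ u ∧ y = toH (ev (pathDet ξ))

open Classical in
/-- The determinant `U^∞_0(A) → H(A)`: its value at `x` is the common value for all smooth paths from
`1` to `x`. (Outside of `U^∞_0(A)`, where there is no such path, the value `0` is irrelevant.) -/
def detBar (x : UInf A) : H A :=
  if h : ∃ y, IsDetBar x y then h.choose else 0

/-- `i` is the homomorphism `H(A) → U^∞(A) / closure (DU^∞(A))` of the Nielsen-Thomsen sequence: the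
inverse of the isomorphism `U^∞_0(A) / closure (DU^∞(A)) → H(A)` given by the determinant, followed by
the inclusion. -/
def IsInclusion (i : H A →+ K1bar A) : Prop :=
  ∀ x ∈ UInf0 A, i (detBar x) = toK1bar x

end Det

/-! ### Nielsen-Thomsen bases -/

/-- A Nielsen-Thomsen basis of `A`: elements `c k ∈ U^∞(A)`, `k ∈ K₁(A)`, whose classes in the
Hausdorffized algebraic `K₁`-group form a section of the projection to `K₁(A)` that is a
homomorphism, with `c 0 = 1`. -/
structure NTBasis (A : Type*) [CStarAlgebra A] where
  c : K1 A → UInf A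
  class_add : ∀ k l, toK1bar (c (k + l)) = toK1bar (c k) + toK1bar (c l)
  class_c : ∀ k, toK1 (c k) = k
  c_zero : c 0 = 1

namespace NTBasis

variable {A : Type*} [CStarAlgebra A] (C : NTBasis A)

/-- The section `k ↦ [c k]` given by a basis. -/
def sec : K1 A →+ K1bar A where
  toFun k := toK1bar (C.c k)
  map_zero' := by rw [C.c_zero]; rfl
  map_add' := C.class_add

/-- `r` is the retract of `i` induced by the basis, i.e. the one that vanishes on the range of the
section given by the basis. -/
def IsInducedRetract (i : H A →+ K1bar A) (r : K1bar A →+ H A) : Prop :=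
  (∀ y, r (i y) = y) ∧ ∀ k, r (C.sec k) = 0

/-- `ν` is the isomorphism induced by the basis: it sends the class of a unitary matrix `u` to
`(Δ(diag(u, v*)), [u])`, for every unitary matrix `v` that represents `c [u]`. -/
def IsInducedIso (ν : K1bar A ≃+ H A × K1 A) : Prop :=
  ∀ (n m : ℕ) (u : Un A n) (v : Un A m), UInf.of m v = C.c (toK1 (UInf.of n u)) →
    UInf.of _ (blockDiag u (star v)) ∈ UInf0 A ∧
    ν (toK1bar (UInf.of n u)) =
      (detBar (UInf.of _ (blockDiag u (star v))), toK1 (UInf.of n u))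

end NTBasis

/-! ### Matrices of homomorphisms -/

/-- A 2-by-2 matrix of homomorphisms, from `G₁ ⊕ G₂` to `G₁' ⊕ G₂'`. -/
structure HomMatrix (G₁ G₂ G₁' G₂' : Type*) [AddGroup G₁] [AddGroup G₂] [AddGroup G₁']
    [AddGroup G₂'] where
  e11 : G₁ →+ G₁'
  e12 : G₂ →+ G₁'
  e21 : G₁ →+ G₂'
  e22 : G₂ →+ G₂'

/-- The map given by a matrix. -/
def HomMatrix.apply {G₁ G₂ G₁' G₂' : Type*} [AddGroup G₁] [AddGroup G₂] [AddGroup G₁']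
    [AddGroup G₂'] (M : HomMatrix G₁ G₂ G₁' G₂') (x : G₁ × G₂) : G₁' × G₂' :=
  (M.e11 x.1 + M.e12 x.2, M.e21 x.1 + M.e22 x.2)

/-- `M` is a matrix of `β` with respect to the isomorphisms `νA`, `νB`: the square with the sides
`νA`, `β`, `νB`, `M` commutes. -/
def IsMatrixOf {A B : Type*} [CStarAlgebra A] [CStarAlgebra B]
    (νA : K1bar A ≃+ H A × K1 A) (νB : K1bar B ≃+ H B × K1 B) (β : K1bar A →+ K1bar B)
    (M : HomMatrix (H A) (K1 A) (H B) (K1 B)) : Prop :=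
  ∀ x, νB (β x) = M.apply (νA x)

end NielsenThomsen

end

open NielsenThomsen

noncomputable section

open Set Topology
open scoped ContDiff ComplexOrder

namespace NielsenThomsen

set_option linter.unusedSectionVars false

/-! ### Logarithmic derivatives of paths of invertible elements -/

/-! The theorem is a diagram chase in the Nielsen–Thomsen sequence `0 → H(A) → K̄₁(A) → K₁(A) → 0`,
once this sequence is known to be exact and natural. A basis splits the sequence, and the retract
and the isomorphism are forced by `i(r(x)) + s([x]) = x`. The class of `diag(φ(c_k), d*)` in
`K̄₁(B)` is the difference of the classes of `φ(c_k)` and `d`. If these agree in `K₁(B)`, the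
difference is the image under `i` of the determinant (`of_blockDiag_star`), and injectivity of `i`
gives `rotation_formula`. The matrix is upper triangular because the determinant is natural
(`detBar_map`), so that `K̄₁(φ)` carries the image of `i` into the image of `i` and acts there as
`H(φ)` (`map_inclusion`, `iso_map`).

The analytic work is in the three facts behind exactness.

The determinant is well defined. Two paths with the same endpoint differ by a loop, so it has to be
shown that the winding number `(1/2πi) ∫ Tr(ξ'ξ⁻¹)` of a loop of invertible matrices lies in the
image of `K₀` (`wind_loop_mem`). Winding numbers of loops do not change under small perturbations
(`InvPath.dlog_eq_of_norm_le`), so the loop may be replaced by a Laurent polynomial in `z =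
exp(2πit)`, and after multiplication by a power of `z` by a polynomial. Enlarging the matrix reduces
the degree to one (`wind_poly_mem`). For a pencil `a + zb` the winding number is the trace of
`(1/2πi) ∮ b(a + zb)⁻¹ dz`, which is an idempotent (`pencil_idempotent`) and hence equivalent to a
projection.

The homomorphism `i` exists. It has to send `ev_h` to the class of `exp(2πih)`. This class is
additive in `h` by the Lie–Trotter formula, since the closure of the commutator subgroup is divided
out (`expClass_add`). It depends only on the trace of `h`: by Hahn–Banach and a Jordan decomposition
of unitarily invariant functionals, the elements killed by all tracial states form the closed span
of the elements `x - uxu*` and `x - x*` (`mem_traceKer_iff`), whose real parts have exponentials of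
trivial class. Every continuous affine function is some `ev_h`, with control of the norm
(`exists_selfAdjoint_ev`), and this control makes the map vanish on the closure of the image of `K₀`
as well (`affHom_of_mem_closure`).

The homomorphism `i` is injective. The kernel of the determinant contains all commutators, since any
two elements commute after one of them is conjugated by an element connected to `1`
(`commutator_le_detKer`). It is also closed (`isClosed_detKer`), so it contains the closure of the
commutator subgroup. -/

/-- A `C¹` path, on `[0, 1]`, of invertible elements of a Banach algebra. -/
structure InvPath (R : Type*) [NormedRing R] [NormedAlgebra ℝ R] where
  val : ℝ → R
  der : ℝ → R
  inv : ℝ → R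
  hasDeriv : ∀ t ∈ Icc (0 : ℝ) 1, HasDerivWithinAt val (der t) (Icc 0 1) t
  cont_der : ContinuousOn der (Icc 0 1)
  mul_inv : ∀ t ∈ Icc (0 : ℝ) 1, val t * inv t = 1
  inv_mul : ∀ t ∈ Icc (0 : ℝ) 1, inv t * val t = 1

namespace InvPath

variable {R : Type*} [NormedRing R] [NormedAlgebra ℝ R] [CompleteSpace R]

theorem cont_val (P : InvPath R) : ContinuousOn P.val (Icc 0 1) := fun t ht =>
  (P.hasDeriv t ht).continuousWithinAt

/-- The value of a path, as a unit. -/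
def unit (P : InvPath R) (t : ℝ) (ht : t ∈ Icc (0 : ℝ) 1) : Rˣ :=
  ⟨P.val t, P.inv t, P.mul_inv t ht, P.inv_mul t ht⟩

theorem inverse_val (P : InvPath R) (t : ℝ) (ht : t ∈ Icc (0 : ℝ) 1) :
    Ring.inverse (P.val t) = P.inv t :=
  Ring.inverse_unit (P.unit t ht)

theorem hasDeriv_inv (P : InvPath R) (t : ℝ) (ht : t ∈ Icc (0 : ℝ) 1) :
    HasDerivWithinAt P.inv (-(P.inv t * P.der t * P.inv t)) (Icc 0 1) t := by
  have h := hasFDerivAt_ringInverse (𝕜 := ℝ) (P.unit t ht)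
  have h2 := HasFDerivAt.comp_hasDerivWithinAt t (f := P.val) h (P.hasDeriv t ht)
  refine (h2.congr (fun s hs => (P.inverse_val s hs).symm) (P.inverse_val t ht).symm).congr_deriv ?_
  simp [unit]

theorem cont_inv (P : InvPath R) : ContinuousOn P.inv (Icc 0 1) := fun t ht =>
  (P.hasDeriv_inv t ht).continuousWithinAt

/-- The pointwise product of paths. -/
def mul (P Q : InvPath R) : InvPath R where
  val t := P.val t * Q.val t
  der t := P.der t * Q.val t + P.val t * Q.der t
  inv t := Q.inv t * P.inv t
  hasDeriv t ht := (P.hasDeriv t ht).mul (Q.hasDeriv t ht)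
  cont_der := (P.cont_der.mul Q.cont_val).add (P.cont_val.mul Q.cont_der)
  mul_inv t ht := by
    rw [mul_assoc, ← mul_assoc (Q.val t), Q.mul_inv t ht, one_mul, P.mul_inv t ht]
  inv_mul t ht := by
    rw [mul_assoc, ← mul_assoc (P.inv t), P.inv_mul t ht, one_mul, Q.inv_mul t ht]

/-- The pointwise inverse of a path. -/
def symm (P : InvPath R) : InvPath R where
  val := P.inv
  der t := -(P.inv t * P.der t * P.inv t)
  inv := P.val
  hasDeriv := P.hasDeriv_inv
  cont_der := ((P.cont_inv.mul P.cont_der).mul P.cont_inv).neg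
  mul_inv := P.inv_mul
  inv_mul := P.mul_inv

variable {F : Type*} [NormedAddCommGroup F] [NormedSpace ℝ F] [CompleteSpace F]

/-- The integral of the image of the logarithmic derivative under a linear map. -/
def dlog (θ : R →L[ℝ] F) (P : InvPath R) : F :=
  ∫ t in (0 : ℝ)..1, θ (P.der t * P.inv t)

theorem cont_dlog (θ : R →L[ℝ] F) (P : InvPath R) :
    ContinuousOn (fun t => θ (P.der t * P.inv t)) (Icc 0 1) :=
  θ.continuous.comp_continuousOn (P.cont_der.mul P.cont_inv)

theorem intervalIntegrable_dlog (θ : R →L[ℝ] F) (P : InvPath R) :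
    IntervalIntegrable (fun t => θ (P.der t * P.inv t)) MeasureTheory.volume 0 1 :=
  ContinuousOn.intervalIntegrable (by rw [uIcc_of_le zero_le_one]; exact P.cont_dlog θ)

theorem integral_congr_Icc {f g : ℝ → F} (h : ∀ t ∈ Icc (0 : ℝ) 1, f t = g t) :
    ∫ t in (0 : ℝ)..1, f t = ∫ t in (0 : ℝ)..1, g t :=
  intervalIntegral.integral_congr (by rw [uIcc_of_le zero_le_one]; exact h)

theorem map_integral (θ : R →L[ℝ] F) {f : ℝ → R}
    (hf : IntervalIntegrable f MeasureTheory.volume 0 1) :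
    ∫ t in (0 : ℝ)..1, θ (f t) = θ (∫ t in (0 : ℝ)..1, f t) :=
  ContinuousLinearMap.intervalIntegral_comp_comm θ hf

theorem inv_congr {P Q : InvPath R} {t : ℝ} (ht : t ∈ Icc (0 : ℝ) 1) (h : P.val t = Q.val t) :
    P.inv t = Q.inv t := by
  rw [← P.inverse_val t ht, ← Q.inverse_val t ht, h]

theorem der_congr {P Q : InvPath R} (h : ∀ t ∈ Icc (0 : ℝ) 1, P.val t = Q.val t)
    {t : ℝ} (ht : t ∈ Icc (0 : ℝ) 1) : P.der t = Q.der t :=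
  (uniqueDiffOn_Icc zero_lt_one t ht).eq_deriv _ (P.hasDeriv t ht)
    ((Q.hasDeriv t ht).congr h (h t ht))

theorem dlog_congr (θ : R →L[ℝ] F) {P Q : InvPath R}
    (h : ∀ t ∈ Icc (0 : ℝ) 1, P.val t = Q.val t) : P.dlog θ = Q.dlog θ :=
  integral_congr_Icc fun t ht => by rw [der_congr h ht, inv_congr ht (h t ht)]

/-- `(PQ)'(PQ)⁻¹ = P'P⁻¹ + P(Q'Q⁻¹)P⁻¹`, and a tracial map does not see the conjugation by `P`. -/
theorem dlog_mul (θ : R →L[ℝ] F) (hθ : ∀ x y, θ (x * y) = θ (y * x)) (P Q : InvPath R) :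
    (P.mul Q).dlog θ = P.dlog θ + Q.dlog θ := by
  rw [dlog, dlog, dlog, ← intervalIntegral.integral_add (P.intervalIntegrable_dlog θ)
    (Q.intervalIntegrable_dlog θ)]
  refine integral_congr_Icc fun t ht => ?_
  change θ ((P.der t * Q.val t + P.val t * Q.der t) * (Q.inv t * P.inv t)) = _
  rw [add_mul, map_add]
  congr 1
  · rw [mul_assoc, ← mul_assoc (Q.val t), Q.mul_inv t ht, one_mul]
  · rw [hθ, ← mul_assoc, mul_assoc (Q.inv t), P.inv_mul t ht, mul_one, hθ]

theorem dlog_symm (θ : R →L[ℝ] F) (hθ : ∀ x y, θ (x * y) = θ (y * x)) (P : InvPath R) :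
    P.symm.dlog θ = -P.dlog θ := by
  rw [dlog, dlog, ← intervalIntegral.integral_neg]
  refine integral_congr_Icc fun t ht => ?_
  change θ (-(P.inv t * P.der t * P.inv t) * P.val t) = _
  rw [neg_mul, map_neg, mul_assoc, P.inv_mul t ht, mul_one, hθ]

/-- The truncation of the power series of `log (1 + x)`. -/
def logSum (K : ℕ) (x : R) : R :=
  ∑ k ∈ Finset.range K, ((-1 : ℝ) ^ k / (k + 1)) • x ^ (k + 1)

/-- The derivative of a power is a sum of words with `x'` in varying positions; cyclicity of `θ`
makes them all equal. The extra factor `y`, commuting with `x t`, is what the induction needs, since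
passing from one power to the next multiplies by `x t`. -/
theorem hasDeriv_pow_trace (θ : R →L[ℝ] F) (hθ : ∀ x y, θ (x * y) = θ (y * x)) {x : ℝ → R}
    {x' : R} {t : ℝ} {s : Set ℝ} (h : HasDerivWithinAt x x' s t) (k : ℕ) :
    ∃ d : R, HasDerivWithinAt (fun t => x t ^ (k + 1)) d s t ∧
      ∀ y, Commute y (x t) → θ (d * y) = (k + 1 : ℝ) • θ (x' * x t ^ k * y) := by
  induction k with
  | zero => exact ⟨x', by simpa using h, by simp⟩
  | succ k ih =>
    obtain ⟨d, hd, e⟩ := ih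
    refine ⟨d * x t + x t ^ (k + 1) * x', ?_, fun y hy => ?_⟩
    · have := hd.mul h
      simp only [pow_succ _ (k + 1)]
      exact this
    · have hc : Commute y (x t ^ (k + 1)) := hy.pow_right _
      have e2 : θ (x t ^ (k + 1) * x' * y) = θ (x' * x t ^ (k + 1) * y) := by
        rw [mul_assoc, hθ, mul_assoc, hc.eq, mul_assoc]
      rw [add_mul, map_add, mul_assoc d, e (x t * y) ((Commute.refl _).mul_left hy), e2,
        pow_succ _ k]
      simp only [mul_assoc]
      push_cast
      simp only [add_smul, one_smul]

/-- The trace of the logarithmic derivative of `1 + x`, up to a truncation error. -/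
theorem hasDeriv_logSum (θ : R →L[ℝ] F) (hθ : ∀ x y, θ (x * y) = θ (y * x)) {x : ℝ → R}
    {x' : R} {t : ℝ} {s : Set ℝ} (h : HasDerivWithinAt x x' s t) (K : ℕ) :
    HasDerivWithinAt (fun t => θ (logSum K (x t)))
      (θ (x' * ∑ k ∈ Finset.range K, (-x t) ^ k)) s t := by
  simp only [logSum, map_sum, map_smul, Finset.mul_sum]
  refine HasDerivWithinAt.fun_sum fun k _ => ?_
  obtain ⟨d, hd, e⟩ := hasDeriv_pow_trace θ hθ h k
  have e1 := e 1 (Commute.one_left _)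
  rw [mul_one, mul_one] at e1
  refine ((θ.hasFDerivAt.comp_hasDerivWithinAt t hd).const_smul
    ((-1 : ℝ) ^ k / (k + 1))).congr_deriv ?_
  rw [e1, smul_smul, div_mul_cancel₀ _ (by positivity), ← map_smul]
  rcases k.even_or_odd with hp | hp <;> simp [hp.neg_pow]

/-- Near `1` the logarithm would be a primitive of the integrand. Its Taylor polynomials already
suffice: each is a function of the endpoints, so its derivative integrates to zero over a loop, and
the derivative of the `K`-th one differs from the integrand by `θ(P'P⁻¹(1 - P)^K)`, which is of
order `r^K`. -/
theorem dlog_eq_zero_of_norm_sub_one_le (θ : R →L[ℝ] F) (hθ : ∀ x y, θ (x * y) = θ (y * x))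
    (P : InvPath R) {r : ℝ} (hr : r < 1) (h : ∀ t ∈ Icc (0 : ℝ) 1, ‖P.val t - 1‖ ≤ r)
    (hP : P.val 0 = P.val 1) : P.dlog θ = 0 := by
  have hr0 : 0 ≤ r := (norm_nonneg _).trans (h 0 (by simp))
  obtain ⟨M, hM⟩ := isCompact_Icc.exists_bound_of_continuousOn (P.cont_der.mul P.cont_inv)
  have key : ∀ K : ℕ, ‖P.dlog θ‖ ≤ ‖θ‖ * M * r ^ K := by
    intro K
    have hd : ∀ t ∈ Icc (0 : ℝ) 1, HasDerivWithinAt (fun t => θ (logSum K (P.val t - 1)))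
        (θ (P.der t * ∑ k ∈ Finset.range K, (-(P.val t - 1)) ^ k)) (Icc 0 1) t := fun t ht =>
      hasDeriv_logSum θ hθ ((P.hasDeriv t ht).sub_const 1) K
    have hc : ContinuousOn (fun t => θ (P.der t * ∑ k ∈ Finset.range K, (-(P.val t - 1)) ^ k))
        (Icc 0 1) := θ.continuous.comp_continuousOn (P.cont_der.mul
          (continuousOn_finsetSum _ fun k _ => (P.cont_val.sub continuousOn_const).neg.pow k))
    have hI := intervalIntegral.integral_eq_sub_of_hasDerivAt_of_le zero_le_one
      (fun t ht => (hd t ht).continuousWithinAt)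
      (fun t ht => (hd t (Ioo_subset_Icc_self ht)).hasDerivAt (Icc_mem_nhds ht.1 ht.2))
      (ContinuousOn.intervalIntegrable (by rwa [uIcc_of_le zero_le_one]))
    rw [hP, sub_self] at hI
    rw [← sub_zero (P.dlog θ), ← hI, dlog, ← intervalIntegral.integral_sub
      (P.intervalIntegrable_dlog θ)
      (ContinuousOn.intervalIntegrable (by rwa [uIcc_of_le zero_le_one]))]
    have := intervalIntegral.norm_integral_le_of_norm_le_const (a := (0 : ℝ)) (b := 1)
      (f := fun t => θ (P.der t * P.inv t) -
        θ (P.der t * ∑ k ∈ Finset.range K, (-(P.val t - 1)) ^ k))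
      (C := ‖θ‖ * M * r ^ K) fun t ht => by
        rw [uIoc_of_le zero_le_one] at ht
        have ht' := Ioc_subset_Icc_self ht
        rw [← map_sub]
        have e : P.der t * P.inv t - P.der t * ∑ k ∈ Finset.range K, (-(P.val t - 1)) ^ k =
            P.der t * P.inv t * (-(P.val t - 1)) ^ K := by
          have g := mul_neg_geom_sum (-(P.val t - 1)) K
          have g2 : ∑ k ∈ Finset.range K, (-(P.val t - 1)) ^ k =
              P.inv t * (1 - (-(P.val t - 1)) ^ K) := by
            rw [← g, ← mul_assoc]
            have : (1 : R) - -(P.val t - 1) = P.val t := by abel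
            rw [this, P.inv_mul t ht', one_mul]
          rw [g2, mul_sub, mul_one, mul_sub, sub_sub_cancel, mul_assoc]
        rw [e]
        calc _ ≤ ‖θ‖ * ‖P.der t * P.inv t * (-(P.val t - 1)) ^ K‖ := θ.le_opNorm _
          _ ≤ ‖θ‖ * (M * r ^ K) := by
            refine mul_le_mul_of_nonneg_left ?_ (norm_nonneg _)
            have hM0 : 0 ≤ M := (norm_nonneg _).trans (hM t ht')
            -- The power `0` is treated apart because `‖1‖ ≤ 1` is not assumed in `R`.
            rcases K with _ | K
            · simpa using hM t ht'
            · refine (norm_mul_le _ _).trans (mul_le_mul (hM t ht') ?_ (norm_nonneg _) hM0)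
              refine (norm_pow_le' _ K.succ_pos).trans ?_
              rw [norm_neg]
              exact pow_le_pow_left₀ (norm_nonneg _) (h t ht') _
          _ = _ := by ring
    simpa using this
  have hlim : Filter.Tendsto (fun K : ℕ => ‖θ‖ * M * r ^ K) Filter.atTop (𝓝 (‖θ‖ * M * 0)) :=
    (tendsto_pow_atTop_nhds_zero_of_lt_one hr0 hr).const_mul _
  rw [mul_zero] at hlim
  exact norm_le_zero_iff.1 (ge_of_tendsto' hlim key)

/-- Two loops that are close to each other have the same integral of the logarithmic derivative. -/
theorem dlog_eq_of_norm_le (θ : R →L[ℝ] F) (hθ : ∀ x y, θ (x * y) = θ (y * x))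
    (P Q : InvPath R) {r : ℝ} (hr : r < 1)
    (h : ∀ t ∈ Icc (0 : ℝ) 1, ‖P.val t * Q.inv t - 1‖ ≤ r)
    (hP : P.val 0 = P.val 1) (hQ : Q.val 0 = Q.val 1) : P.dlog θ = Q.dlog θ := by
  have h0 : (0 : ℝ) ∈ Icc (0 : ℝ) 1 := by simp
  have h1 : (1 : ℝ) ∈ Icc (0 : ℝ) 1 := by simp
  have e := dlog_eq_zero_of_norm_sub_one_le θ hθ (P.mul Q.symm) hr h (by
    change P.val 0 * Q.inv 0 = P.val 1 * Q.inv 1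
    rw [hP, ← Q.inverse_val 0 h0, ← Q.inverse_val 1 h1, hQ])
  rw [dlog_mul θ hθ, dlog_symm θ hθ] at e
  exact sub_eq_zero.1 (by rw [sub_eq_add_neg, e])

end InvPath

/-! ### Idempotents and projections -/

/-- Every idempotent of a C⋆-algebra is equivalent to a projection. -/
theorem exists_projection_of_idempotent {R : Type*} [CStarAlgebra R] {e : R} (he : e * e = e) :
    ∃ p : R, IsStarProjection p ∧ e * p = p ∧ p * e = e := by
  let _ := CStarAlgebra.spectralOrder R
  have _ := CStarAlgebra.spectralOrderedRing R
  have he' : star e * star e = star e := by rw [← star_mul, he]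
  -- Kaplansky's formula: `z` is at least `1`, hence invertible, and commutes with `e` and `e*`; the
  -- projection is `e e* z⁻¹`.
  set z : R := 1 + star (star e - e) * (star e - e) with hz
  have hu : IsUnit z := CStarAlgebra.isUnit_of_le (1 : R)
    (by rw [hz]; exact le_add_of_nonneg_right (star_mul_self_nonneg _))
  have hzs : star z = z := by simp [hz]
  have hez : e * z = e * star e * e := by
    simp only [hz, star_sub, star_star, mul_add, mul_sub, sub_mul, mul_one, he, he',
      ← mul_assoc]
    abel
  have hze : z * e = e * star e * e := by
    simp only [hz, star_sub, star_star, add_mul, mul_sub, sub_mul, one_mul, he, he',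
      mul_assoc]
    abel
  obtain ⟨w, hw⟩ := hu
  have hc : Commute (w : R) e := by rw [hw]; exact hze.trans hez.symm
  have hws : star (w : R) = w := by rw [hw, hzs]
  have hc' : Commute (w : R) (star e) := by
    have := hc.star_star
    rwa [hws] at this
  have hi : Commute (↑w⁻¹ : R) e := hc.units_inv_left
  have hi' : Commute (↑w⁻¹ : R) (star e) := hc'.units_inv_left
  have hwi : star (↑w⁻¹ : R) = ↑w⁻¹ := by
    rw [← Units.coe_star_inv]
    congr 2
    exact Units.ext hws
  rw [← hw] at hez hze
  have hpe : e * star e * ↑w⁻¹ * e = e := by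
    rw [mul_assoc _ _ e, hi.eq, ← mul_assoc, ← hze, hc.eq, Units.mul_inv_cancel_right]
  refine ⟨e * star e * ↑w⁻¹, ⟨?_, ?_⟩, ?_, hpe⟩
  · change e * star e * ↑w⁻¹ * (e * star e * ↑w⁻¹) = _
    rw [← mul_assoc, ← mul_assoc, hpe]
  · change star (e * star e * ↑w⁻¹) = _
    rw [star_mul, star_mul, star_star, hwi]
    exact (hi.mul_right hi').eq
  · rw [← mul_assoc, ← mul_assoc, he]

/-! ### The idempotent of a linear pencil that is invertible on the circle -/

/-- The standard parametrization of the circle. -/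
def cir (t : ℝ) : ℂ := Complex.exp (2 * Real.pi * Complex.I * t)

theorem cir_ne_zero (t : ℝ) : cir t ≠ 0 := Complex.exp_ne_zero _

theorem norm_cir (t : ℝ) : ‖cir t‖ = 1 := by
  have := Complex.norm_exp_ofReal_mul_I (2 * Real.pi * t)
  rw [← this, cir]
  congr 2
  push_cast
  ring

theorem cir_zero : cir 0 = 1 := by simp [cir]

theorem cir_one : cir 1 = 1 := by simp [cir]

theorem cir_zpow (t : ℝ) (k : ℤ) : cir t ^ k = Complex.exp (2 * Real.pi * Complex.I * k * t) := by
  rw [cir, ← Complex.exp_int_mul]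
  congr 1
  ring

theorem continuous_cir : Continuous cir := by
  unfold cir
  fun_prop

theorem continuous_cir_zpow (k : ℤ) : Continuous fun t => cir t ^ k := by
  simp only [cir_zpow]
  fun_prop

theorem integral_cir_zpow (k : ℤ) : ∫ t in (0 : ℝ)..1, cir t ^ k = if k = 0 then 1 else 0 := by
  split_ifs with h
  · simp [h]
  · simp only [cir_zpow]
    have hc : 2 * Real.pi * Complex.I * k ≠ 0 := by simp [h, Real.pi_ne_zero]
    rw [integral_exp_mul_complex hc]
    have : Complex.exp (2 * Real.pi * Complex.I * k * (1 : ℝ)) = 1 := by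
      rw [← cir_zpow, cir_one, one_zpow]
    rw [this]
    simp

section Pencil

variable {R : Type*} [NormedRing R] [NormedAlgebra ℂ R] [CompleteSpace R]

/-- The Fourier coefficients of a function on the circle. -/
def fcoeff (G : ℝ → R) (k : ℤ) : R := ∫ t in (0 : ℝ)..1, cir t ^ (-k) • G t

theorem fcoeff_integrable {G : ℝ → R} (hG : Continuous G) (k : ℤ) :
    IntervalIntegrable (fun t => cir t ^ (-k) • G t) MeasureTheory.volume 0 1 :=
  ((continuous_cir_zpow _).smul hG).intervalIntegrable _ _

theorem mul_fcoeff {G : ℝ → R} (hG : Continuous G) (k : ℤ) (c : R) :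
    c * fcoeff G k = fcoeff (fun t => c * G t) k := by
  unfold fcoeff
  have := ContinuousLinearMap.intervalIntegral_comp_comm (ContinuousLinearMap.mul ℂ R c)
    (fcoeff_integrable hG k)
  simpa using this.symm

theorem fcoeff_mul {G : ℝ → R} (hG : Continuous G) (k : ℤ) (c : R) :
    fcoeff G k * c = fcoeff (fun t => G t * c) k := by
  unfold fcoeff
  have := ContinuousLinearMap.intervalIntegral_comp_comm ((ContinuousLinearMap.mul ℂ R).flip c)
    (fcoeff_integrable hG k)
  simpa using this.symm

theorem fcoeff_add {G G' : ℝ → R} (hG : Continuous G) (hG' : Continuous G') (k : ℤ) :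
    fcoeff (fun t => G t + G' t) k = fcoeff G k + fcoeff G' k := by
  unfold fcoeff
  rw [← intervalIntegral.integral_add (fcoeff_integrable hG k) (fcoeff_integrable hG' k)]
  simp only [smul_add]

theorem fcoeff_cir_smul (G : ℝ → R) (k : ℤ) :
    fcoeff (fun t => cir t • G t) k = fcoeff G (k - 1) := by
  unfold fcoeff
  congr 1
  funext t
  rw [smul_smul, ← zpow_add_one₀ (cir_ne_zero t)]
  congr 2
  ring

theorem fcoeff_one (k : ℤ) : fcoeff (fun _ => (1 : R)) k = if k = 0 then 1 else 0 := by
  unfold fcoeff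
  rw [intervalIntegral.integral_smul_const, integral_cir_zpow]
  simp only [neg_eq_zero]
  split_ifs <;> simp

/-- The Riemann–Lebesgue lemma on the line, applied to `G` cut off to one period. -/
theorem tendsto_fcoeff (G : ℝ → R) :
    Filter.Tendsto (fun n : ℕ => fcoeff G n) Filter.atTop (𝓝 0) := by
  have h := Real.tendsto_integral_exp_smul_cocompact ((Ioc (0 : ℝ) 1).indicator G)
  have h1 : Filter.Tendsto (fun n : ℕ => (n : ℝ)) Filter.atTop (Filter.cocompact ℝ) :=
    (tendsto_natCast_atTop_atTop (R := ℝ)).mono_right atTop_le_cocompact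
  refine (h.comp h1).congr fun n => ?_
  rw [fcoeff, intervalIntegral.integral_of_le zero_le_one, Function.comp_apply,
    ← MeasureTheory.integral_indicator measurableSet_Ioc]
  congr 1
  funext t
  have e : (Real.fourierChar (-(t * (n : ℝ))) : ℂ) = cir t ^ (-(n : ℤ)) := by
    rw [Real.fourierChar_apply, cir_zpow]
    congr 1
    push_cast
    ring
  by_cases ht : t ∈ Ioc (0 : ℝ) 1
  · rw [indicator_of_mem ht, indicator_of_mem ht, Circle.smul_def, e]
  · rw [indicator_of_notMem ht, indicator_of_notMem ht, smul_zero]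

theorem norm_fcoeff_le {G : ℝ → R} (hG : Continuous G) : ∃ M, ∀ k, ‖fcoeff G k‖ ≤ M := by
  obtain ⟨M, hM⟩ := isCompact_Icc.exists_bound_of_continuousOn (s := Icc (0 : ℝ) 1) hG.continuousOn
  refine ⟨M, fun k => ?_⟩
  have := intervalIntegral.norm_integral_le_of_norm_le_const (a := (0 : ℝ)) (b := 1)
    (f := fun t => cir t ^ (-k) • G t) (C := M) fun t ht => by
      rw [uIoc_of_le zero_le_one] at ht
      rw [norm_smul, norm_zpow, norm_cir, one_zpow, one_mul]
      exact hM t (Ioc_subset_Icc_self ht)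
  simpa [fcoeff] using this

theorem continuous_inverse_of_isUnit {f : ℝ → R} (hf : Continuous f) (h : ∀ t, IsUnit (f t)) :
    Continuous fun t => Ring.inverse (f t) := by
  rw [continuous_iff_continuousAt]
  intro t
  obtain ⟨u, hu⟩ := h t
  have := NormedRing.inverse_continuousAt u
  rw [hu] at this
  exact this.comp hf.continuousAt

/-- The idempotent `(1 / 2πi) ∮ b (a + z b)⁻¹ dz` of a pencil `a + z b` that is invertible on the
unit circle. -/
theorem pencil_idempotent (a b : R) (h : ∀ t, IsUnit (a + cir t • b)) :
    IsIdempotentElem (∫ t in (0 : ℝ)..1, cir t • (b * Ring.inverse (a + cir t • b))) := by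
  set G : ℝ → R := fun t => Ring.inverse (a + cir t • b) with hGdef
  have hG : Continuous G := continuous_inverse_of_isUnit
    (continuous_const.add (continuous_cir.smul continuous_const)) h
  have hGz : Continuous fun t => cir t • G t := continuous_cir.smul hG
  have hP : (∫ t in (0 : ℝ)..1, cir t • (b * Ring.inverse (a + cir t • b))) =
      b * fcoeff G (-1) := by
    rw [mul_fcoeff hG, fcoeff]
    simp
    rfl
  -- With `z = cir t`, the relations `hl` and `hr` compare Fourier coefficients in `(a + zb)G = 1 =
  -- G(a + zb)`.
  have hl : ∀ k, a * fcoeff G k + b * fcoeff G (k - 1) = if k = 0 then 1 else 0 := by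
    intro k
    have h1 : Continuous fun t => a * G t := continuous_const.mul hG
    have h2 : Continuous fun t => b * cir t • G t := continuous_const.mul hGz
    rw [← fcoeff_cir_smul, mul_fcoeff hG, mul_fcoeff hGz, ← fcoeff_add h1 h2, ← fcoeff_one]
    congr 1
    funext t
    rw [mul_smul_comm, ← smul_mul_assoc, ← add_mul]
    exact Ring.mul_inverse_cancel _ (h t)
  have hr : ∀ k, fcoeff G k * a + fcoeff G (k - 1) * b = if k = 0 then 1 else 0 := by
    intro k
    have h1 : Continuous fun t => G t * a := hG.mul continuous_const
    have h2 : Continuous fun t => cir t • G t * b := hGz.mul continuous_const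
    rw [← fcoeff_cir_smul, fcoeff_mul hG, fcoeff_mul hGz, ← fcoeff_add h1 h2, ← fcoeff_one]
    congr 1
    funext t
    rw [smul_mul_assoc, ← mul_smul_comm, ← mul_add]
    exact Ring.inverse_mul_cancel _ (h t)
  -- For nonzero index the relations read `G_{n+1} a = -G_n b` and `a G_{-n-1} = -b G_{-n-2}`, so
  -- the product `G_n a G_{-n-1}` does not depend on `n`.
  have hstep : ∀ n : ℕ, fcoeff G n * a * fcoeff G (-n - 1) = fcoeff G 0 * a * fcoeff G (-1) := by
    intro n
    induction n with
    | zero => simp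
    | succ n ih =>
      rw [← ih]
      have e1 := hr (n + 1)
      rw [if_neg (by omega), add_sub_cancel_right] at e1
      have e2 := hl (-n - 1)
      rw [if_neg (by omega)] at e2
      have e3 : (-((n + 1 : ℕ) : ℤ) - 1) = -n - 1 - 1 := by push_cast; ring
      rw [e3, Nat.cast_succ, eq_neg_of_add_eq_zero_left e1, mul_assoc (fcoeff G n),
        eq_neg_of_add_eq_zero_left e2, neg_mul, mul_neg, mul_assoc]
  -- The constant product tends to zero by Riemann–Lebesgue. This is the whole obstruction to
  -- idempotency: `b G₋₁ b G₋₁ = b(1 - G₀ a)G₋₁`.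
  have hzero : fcoeff G 0 * a * fcoeff G (-1) = 0 := by
    obtain ⟨M, hM⟩ := norm_fcoeff_le hG
    have hlim : Filter.Tendsto (fun n : ℕ => ‖fcoeff G n‖ * (‖a‖ * M)) Filter.atTop (𝓝 0) := by
      have := (tendsto_fcoeff G).norm.mul_const (‖a‖ * M)
      rwa [norm_zero, zero_mul] at this
    refine norm_le_zero_iff.1 (ge_of_tendsto' hlim fun n => ?_)
    rw [← hstep n, mul_assoc]
    refine (norm_mul_le _ _).trans (mul_le_mul_of_nonneg_left ?_ (norm_nonneg _))
    exact (norm_mul_le _ _).trans (mul_le_mul_of_nonneg_left (hM _) (norm_nonneg _))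
  rw [hP]
  have e := hr 0
  rw [if_pos rfl, zero_sub] at e
  change b * fcoeff G (-1) * (b * fcoeff G (-1)) = b * fcoeff G (-1)
  rw [mul_assoc, ← mul_assoc (fcoeff G (-1)), eq_sub_of_add_eq' e, sub_mul, one_mul, hzero, sub_zero]

end Pencil

attribute [local instance] CStarAlgebra.spectralOrder CStarAlgebra.spectralOrderedRing

/-! ### The trace with values in `Aff T₁(A)` -/

section Trace

variable {A : Type*} [CStarAlgebra A]

theorem isClosed_AffT1 : IsClosed (AffT1 A : Set C(TracialState A, ℝ)) := by
  have : (AffT1 A : Set C(TracialState A, ℝ)) = {f | ∀ (ρ σ τ : TracialState A) (t : ℝ),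
      0 ≤ t → t ≤ 1 → (∀ a, ρ.1 a = (t : ℂ) * σ.1 a + (1 - t : ℂ) * τ.1 a) →
      f ρ = t * f σ + (1 - t) * f τ} := rfl
  rw [this]
  simp only [Set.ofPred_forall]
  refine isClosed_iInter fun ρ => isClosed_iInter fun σ => isClosed_iInter fun τ =>
    isClosed_iInter fun t => isClosed_iInter fun _ => isClosed_iInter fun _ =>
    isClosed_iInter fun _ => isClosed_eq (continuous_eval_const _) ?_
  exact (continuous_const.mul (continuous_eval_const _)).add
    (continuous_const.mul (continuous_eval_const _))

/-- Winding numbers are integrals with values in this space; completeness is what the fundamental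
theorem of calculus and the exchange of integrals with linear maps require. -/
instance : CompleteSpace (AffT1 A) := (isClosed_AffT1 (A := A)).completeSpace_coe

theorem ev_apply (a : A) (τ : TracialState A) : (ev a).1 τ = (τ.1 a).re := rfl

theorem norm_ev_le (a : A) : ‖ev a‖ ≤ ‖a‖ :=
  (ContinuousMap.norm_le _ (norm_nonneg _)).2 fun τ =>
    (Complex.abs_re_le_norm _).trans (τ.norm_le a)

/-- The map `a ↦ ev_a` as a continuous linear map. -/
def evL : A →L[ℝ] AffT1 A :=
  LinearMap.mkContinuous
    { toFun := ev
      map_add' := fun a b => Subtype.ext (ContinuousMap.ext fun τ => by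
        change (τ.1 (a + b)).re = (τ.1 a).re + (τ.1 b).re
        rw [map_add, Complex.add_re])
      map_smul' := fun r a => Subtype.ext (ContinuousMap.ext fun τ => by
        change (τ.1 (r • a)).re = r * (τ.1 a).re
        rw [← Complex.coe_smul, map_smul, smul_eq_mul, Complex.re_ofReal_mul]) } 1
    fun a => by rw [one_mul]; exact norm_ev_le a

theorem evL_apply (a : A) : evL a = ev a := rfl

theorem ev_mul_comm (a b : A) : ev (a * b) = ev (b * a) :=
  Subtype.ext (ContinuousMap.ext fun τ => by rw [ev_apply, ev_apply, τ.2.2.2])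

variable {ι κ : Type} [Fintype ι] [DecidableEq ι] [Fintype κ] [DecidableEq κ]

/-- The sum of the diagonal entries of a matrix. -/
def diagSum (ι : Type) [Fintype ι] [DecidableEq ι] : CStarMatrix ι ι A →L[ℂ] A where
  toFun := fun x => ∑ i, x i i
  map_add' := fun x y => by simp [Finset.sum_add_distrib]
  map_smul' := fun r x => by simp [Finset.smul_sum]
  cont := continuous_finsetSum _ fun i _ => continuous_apply_apply (ρ := fun _ _ => A) i i

/-- The trace of a matrix, as an element of `Aff T₁(A)`. -/
def trL (A : Type*) [CStarAlgebra A] (ι : Type) [Fintype ι] [DecidableEq ι] :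
    CStarMatrix ι ι A →L[ℝ] AffT1 A :=
  evL.comp ((diagSum ι).restrictScalars ℝ)

theorem trL_apply (x : CStarMatrix ι ι A) : trL A ι x = ev (∑ i, x i i) := rfl

theorem trL_mul_comm (x y : CStarMatrix ι ι A) : trL A ι (x * y) = trL A ι (y * x) := by
  simp only [trL_apply, CStarMatrix.mul_apply, ← evL_apply, map_sum]
  rw [Finset.sum_comm]
  refine Finset.sum_congr rfl fun i _ => Finset.sum_congr rfl fun j _ => ?_
  exact ev_mul_comm _ _

/-- The linear map `x ↦ (1 / 2πi) Tr x` with values in `Aff T₁(A)`. -/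
def trI (A : Type*) [CStarAlgebra A] (ι : Type) [Fintype ι] [DecidableEq ι] :
    CStarMatrix ι ι A →L[ℝ] AffT1 A :=
  evL.comp
    ((((2 * Real.pi * Complex.I)⁻¹ : ℂ) • diagSum ι : CStarMatrix ι ι A →L[ℂ] A).restrictScalars ℝ)

theorem trI_apply (x : CStarMatrix ι ι A) :
    trI A ι x = trL A ι (((2 * Real.pi * Complex.I)⁻¹ : ℂ) • x) := by
  change ev (((2 * Real.pi * Complex.I)⁻¹ : ℂ) • diagSum ι x) = ev (diagSum ι _)
  rw [map_smul]

theorem trI_mul_comm (x y : CStarMatrix ι ι A) : trI A ι (x * y) = trI A ι (y * x) := by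
  rw [trI_apply, trI_apply, ← smul_mul_assoc, trL_mul_comm, mul_smul_comm]

theorem trL_reindex (e : ι ≃ κ) (x : CStarMatrix ι ι A) :
    trL A κ (CStarMatrix.reindexₐ ℂ A e x) = trL A ι x := by
  rw [trL_apply, trL_apply]
  congr 1
  exact Fintype.sum_equiv e.symm _ _ fun i => rfl

/-- The trace of an idempotent matrix is in the image of `K₀`. -/
theorem trL_mem_imageK0 {e : CStarMatrix ι ι A} (he : IsIdempotentElem e) :
    trL A ι e ∈ imageK0 A := by
  obtain ⟨p, hp, h1, h2⟩ := exists_projection_of_idempotent he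
  rw [← h2, trL_mul_comm, h1, ← trL_reindex (Fintype.equivFin ι) p]
  exact AddSubgroup.subset_closure ⟨_, _, hp.map _, rfl⟩

end Trace

/-! ### Trigonometric approximation of vector-valued functions on the circle -/

section Approx

variable {E : Type*} [NormedAddCommGroup E] [NormedSpace ℂ E]

local instance : Fact ((0 : ℝ) < 1) := ⟨zero_lt_one⟩

/-- The function `x ↦ f(x) e`, for a scalar function `f`. -/
def smulConst (X : Type*) [TopologicalSpace X] [CompactSpace X] (e : E) : C(X, ℂ) →L[ℂ] C(X, E) :=
  (ContinuousLinearMap.toSpanSingleton ℂ e).compLeftContinuous ℂ X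

theorem smulConst_apply (X : Type*) [TopologicalSpace X] [CompactSpace X] (e : E) (f : C(X, ℂ))
    (x : X) : smulConst X e f x = f x • e := rfl

/-- Functions with finite-dimensional range are dense in `C(X, E)`. -/
theorem exists_sum_smulConst_near {X : Type*} [TopologicalSpace X] [CompactSpace X] [T2Space X]
    (f : C(X, E)) {ε : ℝ} (hε : 0 < ε) :
    ∃ (s : Finset X) (φ : X → C(X, ℂ)) (e : X → E),
      ‖f - ∑ i ∈ s, smulConst X (e i) (φ i)‖ ≤ ε := by
  classical
  obtain ⟨s, -, hs⟩ := isCompact_univ.elim_nhds_subcover (fun x => {y | ‖f y - f x‖ < ε})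
    fun x _ => (isOpen_lt (f.continuous.sub continuous_const).norm continuous_const).mem_nhds
      (by simpa using hε)
  obtain ⟨ρ, hρ⟩ := PartitionOfUnity.exists_isSubordinate (isClosed_univ (X := X))
    (fun i : s => {y | ‖f y - f i‖ < ε})
    (fun i => isOpen_lt (f.continuous.sub continuous_const).norm continuous_const)
    (fun x hx => by
      obtain ⟨i, hi, h⟩ := mem_iUnion₂.1 (hs hx)
      exact mem_iUnion.2 ⟨⟨i, hi⟩, h⟩)
  refine ⟨s, fun x => if h : x ∈ s then ⟨fun y => ((ρ ⟨x, h⟩ y : ℝ) : ℂ),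
    Complex.continuous_ofReal.comp (ρ ⟨x, h⟩).continuous⟩ else 0, f, ?_⟩
  refine (ContinuousMap.norm_le _ hε.le).2 fun x => ?_
  have h1 : ∑ i : s, ρ i x = 1 := by
    rw [← finsum_eq_sum_of_fintype]
    exact ρ.sum_eq_one (mem_univ x)
  have e1 : (f - ∑ i ∈ s, smulConst X (f i) (if h : i ∈ s then ⟨fun y => ((ρ ⟨i, h⟩ y : ℝ) : ℂ),
      Complex.continuous_ofReal.comp (ρ ⟨i, h⟩).continuous⟩ else 0)) x =
      ∑ i : s, ((ρ i x : ℝ) : ℂ) • (f x - f i) := by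
    rw [ContinuousMap.sub_apply, ContinuousMap.sum_apply, ← Finset.sum_coe_sort s]
    simp only [smul_sub, Finset.sum_sub_distrib, ← Finset.sum_smul, ← Complex.ofReal_sum, h1]
    rw [Complex.ofReal_one, one_smul]
    congr 1
    refine Finset.sum_congr rfl fun i _ => ?_
    rw [smulConst_apply, dif_pos i.2]
    rfl
  rw [e1]
  calc ‖∑ i : s, ((ρ i x : ℝ) : ℂ) • (f x - f i)‖ ≤ ∑ i : s, ρ i x * ε := by
        refine norm_sum_le_of_le _ fun i _ => ?_
        rw [norm_smul, Complex.norm_real, Real.norm_of_nonneg (ρ.nonneg i x)]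
        by_cases hx : ρ i x = 0
        · rw [hx]; simp
        · exact mul_le_mul_of_nonneg_left (hρ i (subset_tsupport _ hx)).le (ρ.nonneg i x)
    _ = ε := by rw [← Finset.sum_mul, h1, one_mul]

/-- Trigonometric polynomials with coefficients in `E`. -/
def trigPoly : (ℤ →₀ E) →ₗ[ℂ] C(AddCircle (1 : ℝ), E) where
  toFun c := c.sum fun n e => smulConst (AddCircle (1 : ℝ)) e (fourier n)
  map_add' c c' := Finsupp.sum_add_index' (fun n => by ext; simp [smulConst_apply])
    (fun n e e' => by ext; simp [smulConst_apply])
  map_smul' r c := by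
    rw [Finsupp.sum_smul_index' (fun n => by ext; simp [smulConst_apply]), Finsupp.smul_sum]
    congr 1
    funext n e
    ext x
    simp [smulConst_apply, smul_comm r]

/-- Scalar trigonometric polynomials are dense, so the closure contains every `φ(x)e` with `φ` a
scalar function and `e` a vector. Sums of these are dense by a partition of unity. -/
theorem trigPoly_dense (f : C(AddCircle (1 : ℝ), E)) :
    f ∈ (LinearMap.range (trigPoly (E := E))).topologicalClosure := by
  set T := (LinearMap.range (trigPoly (E := E))).topologicalClosure with hT
  have hTc : IsClosed (T : Set C(AddCircle (1 : ℝ), E)) := Submodule.isClosed_topologicalClosure _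
  have h1 : ∀ (e : E) (φ : C(AddCircle (1 : ℝ), ℂ)), smulConst _ e φ ∈ T := by
    intro e φ
    have h : (Submodule.span ℂ (range (fourier (T := (1 : ℝ))))).topologicalClosure ≤
        T.comap (smulConst (AddCircle (1 : ℝ)) e).toLinearMap := by
      refine Submodule.topologicalClosure_minimal _ (Submodule.span_le.2 ?_)
        (hTc.preimage (smulConst (AddCircle (1 : ℝ)) e).continuous)
      rintro _ ⟨n, rfl⟩
      refine Submodule.le_topologicalClosure _ ⟨Finsupp.single n e, ?_⟩
      have h0 : smulConst (AddCircle (1 : ℝ)) (0 : E) (fourier n) = 0 := by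
        ext
        simp [smulConst_apply]
      exact Finsupp.sum_single_index (h := fun n e => smulConst (AddCircle (1 : ℝ)) e (fourier n)) h0
    rw [span_fourier_closure_eq_top] at h
    exact h Submodule.mem_top
  have h2 : f ∈ closure (T : Set C(AddCircle (1 : ℝ), E)) := by
    refine Metric.mem_closure_iff.2 fun ε hε => ?_
    obtain ⟨s, φ, e, h⟩ := exists_sum_smulConst_near f (half_pos hε)
    exact ⟨_, T.sum_mem fun i _ => h1 (e i) (φ i), by
      rw [dist_eq_norm]; exact h.trans_lt (half_lt_self hε)⟩
  rwa [hTc.closure_eq] at h2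

theorem fourier_eq_cir (n : ℤ) (t : ℝ) : fourier n (t : AddCircle (1 : ℝ)) = cir t ^ n := by
  rw [fourier_coe_apply, cir_zpow]
  congr 1
  push_cast
  ring

/-- The value at `cir t` of a polynomial of degree at most `d`. -/
def polyVal (c : ℕ → E) (d : ℕ) (t : ℝ) : E := ∑ k ∈ Finset.range (d + 1), cir t ^ k • c k

/-- A continuous loop can be approximated by Laurent polynomials. -/
theorem exists_polyVal_near {f : ℝ → E} (hf : ContinuousOn f (Icc 0 1)) (h01 : f 0 = f 1)
    {ε : ℝ} (hε : 0 < ε) : ∃ (d m : ℕ) (c : ℕ → E), ∀ t ∈ Icc (0 : ℝ) 1,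
      ‖polyVal c (m + 1) t - cir t ^ d • f t‖ < ε := by
  have hc : Continuous (AddCircle.liftIco (1 : ℝ) 0 f) :=
    AddCircle.liftIco_continuous (by rw [zero_add]; exact h01) (by rw [zero_add]; exact hf)
  have hval : ∀ t ∈ Icc (0 : ℝ) 1, AddCircle.liftIco (1 : ℝ) 0 f (t : AddCircle (1 : ℝ)) = f t := by
    intro t ht
    rcases ht.2.lt_or_eq with h | h
    · exact AddCircle.liftIco_coe_apply (by rw [zero_add]; exact ⟨ht.1, h⟩)
    · have : ((1 : ℝ) : AddCircle (1 : ℝ)) = ((0 : ℝ) : AddCircle (1 : ℝ)) := by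
        rw [AddCircle.coe_period]; rfl
      rw [h, this, ← h01]
      exact AddCircle.liftIco_coe_apply (by simp)
  obtain ⟨_, ⟨c, rfl⟩, hcl⟩ := Metric.mem_closure_iff.1 (trigPoly_dense ⟨_, hc⟩) ε hε
  obtain ⟨d, hd⟩ : ∃ d : ℕ, ∀ n ∈ c.support, n.natAbs ≤ d :=
    ⟨c.support.sup Int.natAbs, fun n hn => Finset.le_sup (f := Int.natAbs) hn⟩
  -- Multiplying by `z^d` moves the frequencies `-d, …, d` to `0, …, 2d`. The difference `k - d` is
  -- taken in `ℤ`, and the superfluous top coefficient, at `2d + 1`, is zero; it is there because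
  -- the linearization is stated for positive degree bounds.
  refine ⟨d, 2 * d, fun k => c (k - d), fun t ht => ?_⟩
  have e : polyVal (fun k : ℕ => c (k - d)) (2 * d + 1) t = cir t ^ d • trigPoly c t := by
    have e1 : trigPoly c (t : AddCircle (1 : ℝ)) = ∑ n ∈ c.support, cir t ^ n • c n := by
      change (c.sum fun n e => smulConst (AddCircle (1 : ℝ)) e (fourier n)) t = _
      rw [Finsupp.sum, ContinuousMap.sum_apply]
      refine Finset.sum_congr rfl fun n _ => ?_
      rw [smulConst_apply, fourier_eq_cir]
    rw [e1, Finset.smul_sum, polyVal]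
    symm
    refine Finset.sum_of_injOn (fun n : ℤ => (n + d).toNat) ?_ ?_ ?_ ?_
    · intro n hn n' hn' h
      have h1 := hd n hn
      have h2 := hd n' hn'
      simp only at h
      omega
    · intro n hn
      have h1 := hd n hn
      simp only [Finset.coe_range, mem_Iio]
      omega
    · intro k _ hk
      by_contra hne
      have : c (k - d) ≠ 0 := fun h0 => hne (by simp [h0])
      exact hk ⟨k - d, Finsupp.mem_support_iff.2 this, by simp⟩
    · intro n hn
      have h1 := hd n hn
      have h2 : (((n + d).toNat : ℕ) : ℤ) = n + d := Int.toNat_of_nonneg (by omega)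
      rw [smul_smul, ← zpow_natCast, ← zpow_natCast, h2, ← zpow_add₀ (cir_ne_zero t), add_sub_cancel_right,
        add_comm]
  rw [e, ← smul_sub, norm_smul, norm_pow, norm_cir, one_pow, one_mul, ← hval t ht, norm_sub_rev,
    ← dist_eq_norm]
  exact (ContinuousMap.dist_apply_le_dist _).trans_lt hcl

end Approx

/-! ### The winding number of a loop of invertible matrices -/

section PolyPath

variable {R : Type*} [NormedRing R] [NormedAlgebra ℂ R]

theorem hasDerivAt_cir_pow (k : ℕ) (t : ℝ) :
    HasDerivAt (fun t => cir t ^ k) (2 * Real.pi * Complex.I * k * cir t ^ k) t := by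
  have h : (fun t : ℝ => cir t ^ k) =
      fun t : ℝ => Complex.exp (2 * Real.pi * Complex.I * k * t) := by
    funext t
    rw [← zpow_natCast, cir_zpow, Int.cast_natCast]
  have e : cir t ^ k = Complex.exp (2 * Real.pi * Complex.I * k * t) := congrFun h t
  rw [h, e]
  have := ((hasDerivAt_id (t : ℂ)).const_mul (2 * Real.pi * Complex.I * k)).cexp.comp_ofReal
  simpa [mul_comm] using this

theorem continuous_cir_pow (k : ℕ) : Continuous fun t => cir t ^ k := continuous_cir.pow k

/-- The derivative of `polyVal`. -/
def polyDer (c : ℕ → R) (d : ℕ) (t : ℝ) : R :=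
  ∑ k ∈ Finset.range (d + 1), (2 * Real.pi * Complex.I * k * cir t ^ k) • c k

theorem hasDerivAt_polyVal (c : ℕ → R) (d : ℕ) (t : ℝ) :
    HasDerivAt (polyVal c d) (polyDer c d t) t := by
  unfold polyVal polyDer
  exact HasDerivAt.fun_sum fun k _ => (hasDerivAt_cir_pow k t).smul_const (c k)

theorem continuous_polyDer (c : ℕ → R) (d : ℕ) : Continuous (polyDer c d) := by
  unfold polyDer
  exact continuous_finsetSum _ fun k _ =>
    (continuous_const.mul (continuous_cir_pow k)).smul continuous_const

theorem polyVal_add_one (c : ℕ → R) (d : ℕ) (t : ℝ) : polyVal c d (t + 1) = polyVal c d t := by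
  have : cir (t + 1) = cir t := by
    unfold cir
    push_cast
    rw [mul_add, mul_one, Complex.exp_periodic]
  simp only [polyVal, this]

/-- A polynomial that is invertible on the unit circle, as a path of invertible elements. -/
def polyPath (c : ℕ → R) (d : ℕ) (h : ∀ t, IsUnit (polyVal c d t)) : InvPath R where
  val := polyVal c d
  der := polyDer c d
  inv t := Ring.inverse (polyVal c d t)
  hasDeriv t _ := (hasDerivAt_polyVal c d t).hasDerivWithinAt
  cont_der := (continuous_polyDer c d).continuousOn
  mul_inv t _ := Ring.mul_inverse_cancel _ (h t)
  inv_mul t _ := Ring.inverse_mul_cancel _ (h t)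

end PolyPath

/-! ### Linearization of matrix polynomials, and integrality of winding numbers. -/

section Linearize

variable {A : Type*} [CStarAlgebra A] {ι : Type} [Fintype ι] [DecidableEq ι]

/-- The integral over a path of `(1 / 2πi) Tr(ξ' ξ⁻¹)`, as an element of `Aff T₁(A)`. -/
def wind (P : InvPath (CStarMatrix ι ι A)) : AffT1 A :=
  InvPath.dlog (F := AffT1 A) (trI A ι) P

theorem wind_eq (P : InvPath (CStarMatrix ι ι A)) :
    wind P = ∫ t in (0 : ℝ)..1, trI A ι (P.der t * P.inv t) := rfl

theorem wind_congr {P Q : InvPath (CStarMatrix ι ι A)}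
    (h : ∀ t ∈ Icc (0 : ℝ) 1, P.val t = Q.val t) : wind P = wind Q := by
  unfold wind
  exact InvPath.dlog_congr _ h

theorem wind_mul (P Q : InvPath (CStarMatrix ι ι A)) : wind (P.mul Q) = wind P + wind Q := by
  unfold wind
  exact InvPath.dlog_mul _ trI_mul_comm P Q

theorem wind_symm (P : InvPath (CStarMatrix ι ι A)) : wind P.symm = -wind P := by
  unfold wind
  exact InvPath.dlog_symm _ trI_mul_comm P

theorem wind_eq_of_norm_le (P Q : InvPath (CStarMatrix ι ι A)) {r : ℝ} (hr : r < 1)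
    (h : ∀ t ∈ Icc (0 : ℝ) 1, ‖P.val t * Q.inv t - 1‖ ≤ r)
    (hP : P.val 0 = P.val 1) (hQ : Q.val 0 = Q.val 1) : wind P = wind Q := by
  unfold wind
  exact InvPath.dlog_eq_of_norm_le _ trI_mul_comm P Q hr h hP hQ

/-- A block matrix. -/
def blk (a b c d : CStarMatrix ι ι A) : CStarMatrix (ι ⊕ ι) (ι ⊕ ι) A :=
  CStarMatrix.ofMatrix (Matrix.fromBlocks (CStarMatrix.ofMatrix.symm a)
    (CStarMatrix.ofMatrix.symm b) (CStarMatrix.ofMatrix.symm c) (CStarMatrix.ofMatrix.symm d))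

theorem blk_mul (a b c d a' b' c' d' : CStarMatrix ι ι A) :
    blk a b c d * blk a' b' c' d' =
      blk (a * a' + b * c') (a * b' + b * d') (c * a' + d * c') (c * b' + d * d') :=
  Matrix.fromBlocks_multiply (α := A) a b c d a' b' c' d'

theorem blk_add (a b c d a' b' c' d' : CStarMatrix ι ι A) :
    blk a b c d + blk a' b' c' d' = blk (a + a') (b + b') (c + c') (d + d') :=
  Matrix.fromBlocks_add (α := A) a b c d a' b' c' d'

theorem blk_smul (z : ℂ) (a b c d : CStarMatrix ι ι A) :
    z • blk a b c d = blk (z • a) (z • b) (z • c) (z • d) :=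
  Matrix.fromBlocks_smul (α := A) z a b c d

theorem blk_one : blk (1 : CStarMatrix ι ι A) 0 0 1 = 1 :=
  Matrix.fromBlocks_one (α := A)

theorem blk_zero : blk (0 : CStarMatrix ι ι A) 0 0 0 = 0 :=
  Matrix.fromBlocks_zero (α := A)

theorem blk_sum (s : Finset ℕ) (a b c d : ℕ → CStarMatrix ι ι A) :
    ∑ k ∈ s, blk (a k) (b k) (c k) (d k) =
      blk (∑ k ∈ s, a k) (∑ k ∈ s, b k) (∑ k ∈ s, c k) (∑ k ∈ s, d k) := by
  induction s using Finset.cons_induction with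
  | empty => simp [blk_zero]
  | cons k s hk ih => simp only [Finset.sum_cons, ih, blk_add]

theorem trI_blk (a b c d : CStarMatrix ι ι A) :
    trI A (ι ⊕ ι) (blk a b c d) = trI A ι a + trI A ι d := by
  simp only [trI_apply, blk_smul, trL_apply, Fintype.sum_sum_type, ← evL_apply, map_add]
  rfl

theorem polyVal_blk (a b c d : ℕ → CStarMatrix ι ι A) (m : ℕ) (t : ℝ) :
    polyVal (fun k => blk (a k) (b k) (c k) (d k)) m t =
      blk (polyVal a m t) (polyVal b m t) (polyVal c m t) (polyVal d m t) := by
  simp only [polyVal, blk_smul, blk_sum]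

theorem polyDer_blk (a b c d : ℕ → CStarMatrix ι ι A) (m : ℕ) (t : ℝ) :
    polyDer (fun k => blk (a k) (b k) (c k) (d k)) m t =
      blk (polyDer a m t) (polyDer b m t) (polyDer c m t) (polyDer d m t) := by
  simp only [polyDer, blk_smul, blk_sum]

/-- The coefficients of the constant polynomial. -/
def constCoeff {R : Type*} [Zero R] (x : R) (k : ℕ) : R := if k = 0 then x else 0

theorem polyVal_constCoeff {R : Type*} [NormedRing R] [NormedAlgebra ℂ R] (x : R) (m : ℕ) (t : ℝ) :
    polyVal (constCoeff x) m t = x := by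
  rw [polyVal, Finset.sum_eq_single 0 (by intro k _ hk; simp [constCoeff, hk]) (by simp)]
  simp [constCoeff]

theorem polyDer_constCoeff {R : Type*} [NormedRing R] [NormedAlgebra ℂ R] (x : R) (m : ℕ) (t : ℝ) :
    polyDer (constCoeff x) m t = 0 := by
  rw [polyDer]
  refine Finset.sum_eq_zero fun k _ => ?_
  rcases k with _ | k <;> simp [constCoeff]

theorem inverse_eq_of_mul {R : Type*} [Ring R] {x y : R} (h1 : x * y = 1) (h2 : y * x = 1) :
    Ring.inverse x = y :=
  Ring.inverse_unit ⟨x, y, h1, h2⟩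

/-- The logarithmic derivative is strictly triangular, so its trace vanishes at every `t`. -/
theorem wind_upper (b : ℕ → CStarMatrix ι ι A) (m : ℕ)
    (h : ∀ t, IsUnit (polyVal (fun k => blk (constCoeff 1 k) (b k) 0 (constCoeff 1 k)) m t)) :
    wind (polyPath _ m h) = 0 := by
  rw [wind_eq, ← intervalIntegral.integral_zero (E := AffT1 A) (a := (0 : ℝ)) (b := 1)]
  refine InvPath.integral_congr_Icc fun t _ => ?_
  have hz : (fun _ : ℕ => (0 : CStarMatrix ι ι A)) = constCoeff 0 := by
    funext k; simp [constCoeff]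
  have hv := polyVal_blk (constCoeff 1) b (fun _ => 0) (constCoeff 1) m t
  have hd := polyDer_blk (constCoeff 1) b (fun _ => 0) (constCoeff 1) m t
  rw [hz, polyVal_constCoeff, polyVal_constCoeff] at hv
  rw [hz, polyDer_constCoeff, polyDer_constCoeff] at hd
  have hi : Ring.inverse (blk 1 (polyVal b m t) 0 1) = blk 1 (-polyVal b m t) 0 1 :=
    inverse_eq_of_mul (by rw [blk_mul, ← blk_one]; simp) (by rw [blk_mul, ← blk_one]; simp)
  change trI A _ (polyDer _ m t * Ring.inverse (polyVal _ m t)) = _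
  rw [hv, hd, hi, blk_mul, trI_blk]
  simp

theorem wind_lower (b : ℕ → CStarMatrix ι ι A) (m : ℕ)
    (h : ∀ t, IsUnit (polyVal (fun k => blk (constCoeff 1 k) 0 (b k) (constCoeff 1 k)) m t)) :
    wind (polyPath _ m h) = 0 := by
  rw [wind_eq, ← intervalIntegral.integral_zero (E := AffT1 A) (a := (0 : ℝ)) (b := 1)]
  refine InvPath.integral_congr_Icc fun t _ => ?_
  have hz : (fun _ : ℕ => (0 : CStarMatrix ι ι A)) = constCoeff 0 := by
    funext k; simp [constCoeff]
  have hv := polyVal_blk (constCoeff 1) (fun _ => 0) b (constCoeff 1) m t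
  have hd := polyDer_blk (constCoeff 1) (fun _ => 0) b (constCoeff 1) m t
  rw [hz, polyVal_constCoeff, polyVal_constCoeff] at hv
  rw [hz, polyDer_constCoeff, polyDer_constCoeff] at hd
  have hi : Ring.inverse (blk 1 0 (polyVal b m t) 1) = blk 1 0 (-polyVal b m t) 1 :=
    inverse_eq_of_mul (by rw [blk_mul, ← blk_one]; simp) (by rw [blk_mul, ← blk_one]; simp)
  change trI A _ (polyDer _ m t * Ring.inverse (polyVal _ m t)) = _
  rw [hv, hd, hi, blk_mul, trI_blk]
  simp

theorem isUnit_blk_diag {x : CStarMatrix ι ι A} (h : IsUnit x) : IsUnit (blk x 0 0 1) := by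
  obtain ⟨u, rfl⟩ := h
  exact ⟨⟨blk u 0 0 1, blk ↑u⁻¹ 0 0 1, by rw [blk_mul, ← blk_one]; simp,
    by rw [blk_mul, ← blk_one]; simp⟩, rfl⟩

theorem isUnit_blk_upper (x : CStarMatrix ι ι A) : IsUnit (blk 1 x 0 1) :=
  ⟨⟨blk 1 x 0 1, blk 1 (-x) 0 1, by rw [blk_mul, ← blk_one]; simp,
    by rw [blk_mul, ← blk_one]; simp⟩, rfl⟩

theorem isUnit_blk_lower (x : CStarMatrix ι ι A) : IsUnit (blk 1 0 x 1) :=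
  ⟨⟨blk 1 0 x 1, blk 1 0 (-x) 1, by rw [blk_mul, ← blk_one]; simp,
    by rw [blk_mul, ← blk_one]; simp⟩, rfl⟩

theorem wind_diag (c : ℕ → CStarMatrix ι ι A) (m : ℕ) (hc : ∀ t, IsUnit (polyVal c m t))
    (h : ∀ t, IsUnit (polyVal (fun k => blk (c k) 0 0 (constCoeff 1 k)) m t)) :
    wind (polyPath _ m h) = wind (polyPath c m hc) := by
  refine InvPath.integral_congr_Icc fun t _ => ?_
  have hz : (fun _ : ℕ => (0 : CStarMatrix ι ι A)) = constCoeff 0 := by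
    funext k; simp [constCoeff]
  have hv := polyVal_blk c (fun _ => 0) (fun _ => 0) (constCoeff 1) m t
  have hd := polyDer_blk c (fun _ => 0) (fun _ => 0) (constCoeff 1) m t
  rw [hz, polyVal_constCoeff, polyVal_constCoeff] at hv
  rw [hz, polyDer_constCoeff, polyDer_constCoeff] at hd
  have hi : Ring.inverse (blk (polyVal c m t) 0 0 1) = blk (Ring.inverse (polyVal c m t)) 0 0 1 :=
    inverse_eq_of_mul
      (by rw [blk_mul, ← blk_one]; simp [Ring.mul_inverse_cancel _ (hc t)])
      (by rw [blk_mul, ← blk_one]; simp [Ring.inverse_mul_cancel _ (hc t)])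
  change trI A _ (polyDer _ m t * Ring.inverse (polyVal _ m t)) =
    trI A _ (polyDer c m t * Ring.inverse (polyVal c m t))
  rw [hv, hd, hi, blk_mul, trI_blk]
  simp

/-- The winding number of a matrix polynomial of degree one. -/
theorem wind_linear_mem (c : ℕ → CStarMatrix ι ι A) (h : ∀ t, IsUnit (polyVal c 1 t)) :
    wind (polyPath c 1 h) ∈ imageK0 A := by
  have hv : ∀ t, polyVal c 1 t = c 0 + cir t • c 1 := fun t => by
    simp [polyVal, Finset.sum_range_succ]
  have hu : ∀ t, IsUnit (c 0 + cir t • c 1) := fun t => hv t ▸ h t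
  have hG : Continuous fun t => Ring.inverse (c 0 + cir t • c 1) := continuous_inverse_of_isUnit
    (continuous_const.add (continuous_cir.smul continuous_const)) hu
  -- Differentiation in `t` produces `2πi z c₁`; the constant cancels the factor in `trI`, and what
  -- remains under the trace is the idempotent of the pencil.
  have e : wind (polyPath c 1 h) = trL A ι (∫ t in (0 : ℝ)..1,
      cir t • (c 1 * Ring.inverse (c 0 + cir t • c 1))) := by
    have hI : IntervalIntegrable (fun t => cir t • (c 1 * Ring.inverse (c 0 + cir t • c 1)))
        MeasureTheory.volume 0 1 :=
      (continuous_cir.smul (continuous_const.mul hG)).intervalIntegrable _ _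
    have e1 : ∫ t in (0 : ℝ)..1, trL A ι (cir t • (c 1 * Ring.inverse (c 0 + cir t • c 1))) =
        trL A ι (∫ t in (0 : ℝ)..1, cir t • (c 1 * Ring.inverse (c 0 + cir t • c 1))) :=
      InvPath.map_integral _ hI
    rw [← e1]
    refine InvPath.integral_congr_Icc fun t _ => ?_
    change trI A ι (polyDer c 1 t * Ring.inverse (polyVal c 1 t)) = _
    have hd : polyDer c 1 t = (2 * Real.pi * Complex.I : ℂ) • (cir t • c 1) := by
      simp [polyDer, Finset.sum_range_succ, smul_smul]
    rw [hv, hd, trI_apply, smul_mul_assoc, smul_smul, inv_mul_cancel₀ Complex.two_pi_I_ne_zero,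
      one_smul, smul_mul_assoc]
  rw [e]
  exact trL_mem_imageK0 (pencil_idempotent (c 0) (c 1) hu)

/-- The winding number of a matrix polynomial that is invertible on the unit circle. -/
theorem wind_poly_mem (d : ℕ) : ∀ (ι : Type) [Fintype ι] [DecidableEq ι]
    (c : ℕ → CStarMatrix ι ι A) (h : ∀ t, IsUnit (polyVal c (d + 1) t)),
    wind (polyPath c (d + 1) h) ∈ imageK0 A := by
  induction d with
  | zero => intro ι _ _ c h; exact wind_linear_mem c h
  | succ d ih =>
    intro ι _ _ c h
    -- Writing the polynomial as `c₀ + zr`, the matrix `diag(c₀ + zr, 1)` is the product of `[1, -z;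
    -- 0, 1]`, `[c₀, z; -r, 1]` and `[1, 0; r, 1]`. The triangular factors have winding number zero,
    -- and the middle factor has degree bound one less, at the price of doubling the size; therefore
    -- the index type varies in the induction. The entry `z` has degree one, which is why the
    -- induction stops at degree one.
    let X : ℕ → CStarMatrix ι ι A := fun k => if k = 1 then 1 else 0
    let X' : ℕ → CStarMatrix ι ι A := fun k => if k = 1 then -1 else 0
    let r : ℕ → CStarMatrix ι ι A := fun k => c (k + 1)
    have hz : (fun _ : ℕ => (0 : CStarMatrix ι ι A)) = constCoeff 0 := by
      funext k; simp [constCoeff]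
    have hX : ∀ t, polyVal X (d + 1) t = cir t • 1 := fun t => by
      rw [polyVal, Finset.sum_eq_single 1 (by intro k _ hk; simp [X, hk]) (by simp)]
      simp [X]
    have hX' : ∀ t, polyVal X' (d + 1) t = -(cir t • 1) := fun t => by
      rw [polyVal, Finset.sum_eq_single 1 (by intro k _ hk; simp [X', hk]) (by simp)]
      simp [X']
    have hq : ∀ t, polyVal c (d + 2) t = c 0 + cir t • polyVal r (d + 1) t := fun t => by
      rw [polyVal, Finset.sum_range_succ', add_comm, polyVal, Finset.smul_sum]
      simp [r, pow_succ', smul_smul]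
    have vU : ∀ t, polyVal (fun k => blk (constCoeff 1 k) (X' k) 0 (constCoeff 1 k)) (d + 1) t =
        blk 1 (-(cir t • 1)) 0 1 := fun t => by
      have := polyVal_blk (constCoeff 1) X' (fun _ => 0) (constCoeff 1) (d + 1) t
      rw [hz, polyVal_constCoeff, polyVal_constCoeff, hX'] at this
      exact this
    have vV : ∀ t, polyVal (fun k => blk (constCoeff 1 k) 0 (r k) (constCoeff 1 k)) (d + 1) t =
        blk 1 0 (polyVal r (d + 1) t) 1 := fun t => by
      have := polyVal_blk (constCoeff 1) (fun _ => 0) r (constCoeff 1) (d + 1) t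
      rw [hz, polyVal_constCoeff, polyVal_constCoeff] at this
      exact this
    have vD : ∀ t, polyVal (fun k => blk (c k) 0 0 (constCoeff 1 k)) (d + 2) t =
        blk (polyVal c (d + 2) t) 0 0 1 := fun t => by
      have := polyVal_blk c (fun _ => 0) (fun _ => 0) (constCoeff 1) (d + 2) t
      rw [hz, polyVal_constCoeff, polyVal_constCoeff] at this
      exact this
    have vL : ∀ t, polyVal (fun k => blk (constCoeff (c 0) k) (X k) (-r k) (constCoeff 1 k))
        (d + 1) t = blk (c 0) (cir t • 1) (-polyVal r (d + 1) t) 1 := fun t => by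
      have := polyVal_blk (constCoeff (c 0)) X (fun k => -r k) (constCoeff 1) (d + 1) t
      rw [polyVal_constCoeff, polyVal_constCoeff, hX] at this
      rw [this]
      simp [polyVal]
    have key : ∀ t, blk (polyVal c (d + 2) t) 0 0 1 = blk 1 (-(cir t • 1)) 0 1 *
        blk (c 0) (cir t • 1) (-polyVal r (d + 1) t) 1 * blk 1 0 (polyVal r (d + 1) t) 1 := by
      intro t
      rw [blk_mul, blk_mul, hq]
      simp
    have uU := fun t => (vU t).symm ▸ isUnit_blk_upper (A := A) (-(cir t • (1 : CStarMatrix ι ι A)))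
    have uV := fun t => (vV t).symm ▸ isUnit_blk_lower (polyVal r (d + 1) t)
    have uD := fun t => (vD t).symm ▸ isUnit_blk_diag (h t)
    have uL : ∀ t, IsUnit (polyVal (fun k => blk (constCoeff (c 0) k) (X k) (-r k)
        (constCoeff 1 k)) (d + 1) t) := fun t => by
      have h1 := isUnit_blk_diag (h t)
      rw [key t] at h1
      rw [vL]
      obtain ⟨a, ha⟩ := isUnit_blk_upper (A := A) (-(cir t • (1 : CStarMatrix ι ι A)))
      obtain ⟨b, hb⟩ := isUnit_blk_lower (polyVal r (d + 1) t)
      rw [← ha, ← hb] at h1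
      simpa using h1
    have e := wind_congr (P := polyPath _ _ uD)
      (Q := ((polyPath _ _ uU).mul (polyPath _ _ uL)).mul (polyPath _ _ uV)) (fun t _ => by
        change polyVal _ _ t = polyVal _ _ t * polyVal _ _ t * polyVal _ _ t
        rw [vD, vU, vL, vV, key])
    rw [wind_mul, wind_mul, wind_upper, wind_lower,
      wind_diag c _ h, zero_add, add_zero] at e
    rw [e]
    exact ih _ _ uL

/-- The winding number of a loop of invertible matrices is in the image of `K₀`. -/
theorem wind_loop_mem (Q : InvPath (CStarMatrix ι ι A)) (hQ : Q.val 0 = Q.val 1) :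
    wind Q ∈ imageK0 A := by
  obtain ⟨M, hM⟩ := isCompact_Icc.exists_bound_of_continuousOn Q.cont_inv
  have hM0 : 0 ≤ M := (norm_nonneg _).trans (hM 0 (by simp))
  -- With `M` bounding `‖Q⁻¹‖`, this tolerance gives relative error at most `1/2`; the `+ 1` covers
  -- `M = 0`.
  obtain ⟨d, m, c, hc⟩ := exists_polyVal_near Q.cont_val hQ (ε := 1 / (2 * (M + 1))) (by positivity)
  let X : ℕ → CStarMatrix ι ι A := fun k => if k = d then 1 else 0
  have vX : ∀ t, polyVal X (d + 1) t = cir t ^ d • 1 := fun t => by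
    rw [polyVal, Finset.sum_eq_single d (by intro k _ hk; simp [X, hk]) (by simp)]
    simp [X]
  have uX : ∀ t, IsUnit (polyVal X (d + 1) t) := fun t => by
    rw [vX]
    exact ⟨⟨cir t ^ d • 1, (cir t ^ d)⁻¹ • 1, by simp [smul_smul, cir_ne_zero],
      by simp [smul_smul, cir_ne_zero]⟩, rfl⟩
  -- The loop `z^d` is itself a polynomial, so its winding number, introduced by clearing
  -- denominators, can be subtracted again.
  let Z := polyPath X (d + 1) uX
  have hZ : wind Z ∈ imageK0 A := wind_poly_mem d ι X uX
  have hZinv : ∀ t, Z.inv t = (cir t ^ d)⁻¹ • 1 := fun t => by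
    change Ring.inverse (polyVal X (d + 1) t) = _
    rw [vX]
    exact inverse_eq_of_mul (by simp [smul_smul, cir_ne_zero]) (by simp [smul_smul, cir_ne_zero])
  have near : ∀ t ∈ Icc (0 : ℝ) 1,
      ‖polyVal c (m + 1) t * (Z.mul Q).inv t - 1‖ ≤ 1 / 2 := by
    intro t ht
    have e : polyVal c (m + 1) t * (Z.mul Q).inv t - 1 =
        (cir t ^ d)⁻¹ • ((polyVal c (m + 1) t - cir t ^ d • Q.val t) * Q.inv t) := by
      change _ * (Q.inv t * Z.inv t) - 1 = _
      rw [hZinv, sub_mul, smul_mul_assoc, Q.mul_inv t ht, smul_sub, smul_smul,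
        inv_mul_cancel₀ (pow_ne_zero _ (cir_ne_zero t)), one_smul]
      simp
    rw [e, norm_smul, norm_inv, norm_pow, norm_cir, one_pow, inv_one, one_mul]
    calc _ ≤ ‖polyVal c (m + 1) t - cir t ^ d • Q.val t‖ * ‖Q.inv t‖ := norm_mul_le _ _
      _ ≤ 1 / (2 * (M + 1)) * M :=
        mul_le_mul (hc t ht).le (hM t ht) (norm_nonneg _) (by positivity)
      _ ≤ 1 / 2 := by
        rw [div_mul_eq_mul_div, one_mul, div_le_iff₀ (by positivity)]
        linarith
  have uc0 : ∀ t ∈ Icc (0 : ℝ) 1, IsUnit (polyVal c (m + 1) t) := by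
    intro t ht
    have h1 : IsUnit (polyVal c (m + 1) t * (Z.mul Q).inv t) := by
      have := isUnit_one_sub_of_norm_lt_one (x := 1 - polyVal c (m + 1) t * (Z.mul Q).inv t) (by
        rw [norm_sub_rev]
        exact (near t ht).trans_lt (by norm_num))
      rwa [sub_sub_cancel] at this
    have h2 : (Z.mul Q).inv t = ↑((Z.mul Q).unit t ht)⁻¹ := rfl
    rw [h2] at h1
    simpa using h1
  -- The linearization asks for invertibility at every real `t`; the estimate on `[0, 1]` extends by
  -- periodicity.
  have uc : ∀ t, IsUnit (polyVal c (m + 1) t) := by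
    intro t
    have hp : Function.Periodic (polyVal c (m + 1)) 1 := polyVal_add_one c (m + 1)
    have := hp.sub_int_mul_eq ⌊t⌋ (x := t)
    rw [mul_one] at this
    rw [← this]
    exact uc0 _ ⟨(Int.fract_nonneg t), (Int.fract_lt_one t).le⟩
  have hP : wind (polyPath c (m + 1) uc) ∈ imageK0 A := wind_poly_mem m ι c uc
  have e := wind_eq_of_norm_le (polyPath c (m + 1) uc) (Z.mul Q)
    (r := 1 / 2) (by norm_num) near
    (by
      change polyVal c (m + 1) 0 = polyVal c (m + 1) 1
      simpa using (polyVal_add_one c (m + 1) 0).symm)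
    (by
      change polyVal X (d + 1) 0 * Q.val 0 = polyVal X (d + 1) 1 * Q.val 1
      rw [vX, vX, hQ, cir_zero, cir_one])
  rw [wind_mul] at e
  rw [← add_sub_cancel_left (wind Z) (wind Q), ← e]
  exact sub_mem hP hZ

end Linearize

/-! ### Smooth paths of unitary matrices -/

section Entries

variable {A : Type*} [CStarAlgebra A] {n : ℕ}

/-- The matrix with one given entry and zeros elsewhere. -/
def singleL (i j : Fin n) : A →L[ℂ] CStarMatrix (Fin n) (Fin n) A where
  toFun a := CStarMatrix.ofMatrix fun k l => if k = i ∧ l = j then a else 0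
  map_add' a b := CStarMatrix.ext fun k l => by
    change (if k = i ∧ l = j then a + b else 0) =
      (if k = i ∧ l = j then a else 0) + (if k = i ∧ l = j then b else 0)
    split_ifs <;> simp
  map_smul' r a := CStarMatrix.ext fun k l => by
    change (if k = i ∧ l = j then r • a else 0) = r • (if k = i ∧ l = j then a else 0)
    split_ifs <;> simp
  cont := continuous_pi fun k => continuous_pi fun l => by
    change Continuous fun a : A => if k = i ∧ l = j then a else 0
    split_ifs
    · exact continuous_id
    · exact continuous_const

theorem singleL_apply (i j k l : Fin n) (a : A) :
    singleL i j a k l = if k = i ∧ l = j then a else 0 := rfl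

theorem sum_apply' {α : Type*} (s : Finset α) (f : α → CStarMatrix (Fin n) (Fin n) A)
    (i j : Fin n) : (∑ x ∈ s, f x) i j = ∑ x ∈ s, f x i j := by
  induction s using Finset.cons_induction with
  | empty => simp
  | cons x s hx ih => simp [Finset.sum_cons, ih]

theorem sum_singleL (x : CStarMatrix (Fin n) (Fin n) A) : x = ∑ i, ∑ j, singleL i j (x i j) := by
  refine CStarMatrix.ext fun k l => ?_
  simp only [sum_apply', singleL_apply]
  rw [Finset.sum_eq_single k (by intro i _ hi; simp [Ne.symm hi]) (by simp),
    Finset.sum_eq_single l (by intro i _ hi; simp [Ne.symm hi]) (by simp)]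
  simp

theorem hasDerivWithinAt_of_entry {ξ : ℝ → CStarMatrix (Fin n) (Fin n) A}
    {D : CStarMatrix (Fin n) (Fin n) A} {s : Set ℝ} {t : ℝ}
    (h : ∀ i j, HasDerivWithinAt (fun t => ξ t i j) (D i j) s t) : HasDerivWithinAt ξ D s t := by
  have e : ξ = fun t => ∑ i, ∑ j, singleL i j (ξ t i j) := by
    funext t
    exact sum_singleL (ξ t)
  rw [e, sum_singleL D]
  refine HasDerivWithinAt.fun_sum fun i _ => HasDerivWithinAt.fun_sum fun j _ => ?_
  exact (((singleL i j).restrictScalars ℝ).hasFDerivAt.comp_hasDerivWithinAt t (h i j))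

/-- The map `x ↦ x i j`. -/
def entryL (i j : Fin n) : CStarMatrix (Fin n) (Fin n) A →L[ℂ] A where
  toFun x := x i j
  map_add' _ _ := rfl
  map_smul' _ _ := rfl
  cont := continuous_apply_apply (ρ := fun _ _ => A) i j

end Entries

namespace IsSmoothPath

variable {A : Type*} [CStarAlgebra A] {n m : ℕ} {ξ η : ℝ → CStarMatrix (Fin n) (Fin n) A}
  {u v : Un A n}

theorem diff (hξ : IsSmoothPath ξ u) (i j : Fin n) {t : ℝ} (ht : t ∈ Icc (0 : ℝ) 1) :
    HasDerivWithinAt (fun s => ξ s i j) (derivWithin (fun s => ξ s i j) (Icc 0 1) t)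
      (Icc 0 1) t :=
  ((hξ.smooth i j).differentiableOn (by simp) t ht).hasDerivWithinAt

theorem cont_deriv (hξ : IsSmoothPath ξ u) (i j : Fin n) :
    ContinuousOn (derivWithin (fun s => ξ s i j) (Icc 0 1)) (Icc 0 1) :=
  (hξ.smooth i j).continuousOn_derivWithin (uniqueDiffOn_Icc zero_lt_one) (by simp)

theorem cont_entry (hξ : IsSmoothPath ξ u) (i j : Fin n) :
    ContinuousOn (fun s => ξ s i j) (Icc 0 1) := (hξ.smooth i j).continuousOn

/-- A smooth path as a `C¹` path of invertible elements. -/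
def toInv (hξ : IsSmoothPath ξ u) : InvPath (CStarMatrix (Fin n) (Fin n) A) where
  val := ξ
  der t := CStarMatrix.ofMatrix fun i j => derivWithin (fun s => ξ s i j) (Icc 0 1) t
  inv t := star (ξ t)
  hasDeriv _ ht := hasDerivWithinAt_of_entry fun i j => hξ.diff i j ht
  cont_der := continuousOn_pi.2 fun i => continuousOn_pi.2 fun j => hξ.cont_deriv i j
  mul_inv t ht := Unitary.mul_star_self_of_mem (hξ.unitary t ht)
  inv_mul t ht := Unitary.star_mul_self_of_mem (hξ.unitary t ht)

/-- Since `ξ⁻¹ = ξ*`, the double sum of entries is the trace of `ξ'ξ⁻¹`, and evaluation at traces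
commutes with the integral. From here on determinants of paths are computed as winding integrals. -/
theorem ev_pathDet (hξ : IsSmoothPath ξ u) : ev (pathDet ξ) = wind hξ.toInv := by
  let g : ℝ → A := fun t => ∑ i, ∑ j, derivWithin (fun s => ξ s i j) (Icc 0 1) t * star (ξ t i j)
  have hg : ContinuousOn g (Icc 0 1) := continuousOn_finsetSum _ fun i _ =>
    continuousOn_finsetSum _ fun j _ => (hξ.cont_deriv i j).mul (hξ.cont_entry i j).star
  let L : A →L[ℝ] AffT1 A := evL.comp
    ((((2 * Real.pi * Complex.I)⁻¹ : ℂ) • ContinuousLinearMap.id ℂ A : A →L[ℂ] A).restrictScalars ℝ)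
  have hI : IntervalIntegrable g MeasureTheory.volume 0 1 :=
    ContinuousOn.intervalIntegrable (by rwa [uIcc_of_le zero_le_one])
  have e : ∫ t in (0 : ℝ)..1, L (g t) = L (∫ t in (0 : ℝ)..1, g t) := InvPath.map_integral _ hI
  change L (∫ t in (0 : ℝ)..1, g t) = _
  rw [← e, wind_eq]
  refine InvPath.integral_congr_Icc fun t _ => ?_
  rw [trI_apply, trL_apply]
  change ev _ = ev _
  congr 1
  simp only [CStarMatrix.smul_apply, ← Finset.smul_sum, CStarMatrix.mul_apply]
  rfl

theorem mul (hξ : IsSmoothPath ξ u) (hη : IsSmoothPath η v) :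
    IsSmoothPath (fun t => ξ t * η t) (u * v) where
  unitary t ht := mul_mem (hξ.unitary t ht) (hη.unitary t ht)
  smooth i j := by
    simp only [CStarMatrix.mul_apply]
    exact ContDiffOn.sum fun k _ => (hξ.smooth i k).mul (hη.smooth k j)
  source := by rw [hξ.source, hη.source, one_mul]
  target := by rw [hξ.target, hη.target]; rfl

theorem inv (hξ : IsSmoothPath ξ u) : IsSmoothPath (fun t => star (ξ t)) u⁻¹ where
  unitary t ht := Unitary.star_mem (hξ.unitary t ht)
  smooth i j := by
    simp only [CStarMatrix.star_apply]
    exact ((starL' ℝ : A ≃L[ℝ] A).contDiff.comp_contDiffOn (hξ.smooth j i))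
  source := by rw [hξ.source, star_one]
  target := by rw [hξ.target]; rfl

theorem ev_pathDet_mul (hξ : IsSmoothPath ξ u) (hη : IsSmoothPath η v) :
    ev (pathDet fun t => ξ t * η t) = ev (pathDet ξ) + ev (pathDet η) := by
  rw [(hξ.mul hη).ev_pathDet, hξ.ev_pathDet, hη.ev_pathDet, ← wind_mul]
  exact wind_congr fun t _ => rfl

theorem ev_pathDet_inv (hξ : IsSmoothPath ξ u) :
    ev (pathDet fun t => star (ξ t)) = -ev (pathDet ξ) := by
  rw [hξ.inv.ev_pathDet, hξ.ev_pathDet, ← wind_symm]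
  exact wind_congr fun t _ => rfl

theorem conj (hξ : IsSmoothPath ξ u) (v : Un A n) :
    IsSmoothPath (fun t => (v : CStarMatrix (Fin n) (Fin n) A) * ξ t * star (v : CStarMatrix _ _ A))
      (v * u * v⁻¹) where
  unitary t ht := mul_mem (mul_mem v.2 (hξ.unitary t ht)) (Unitary.star_mem v.2)
  smooth i j := by
    simp only [CStarMatrix.mul_apply]
    exact ContDiffOn.sum fun k _ => (ContDiffOn.sum fun l _ => contDiffOn_const.mul
      (hξ.smooth l k)).mul contDiffOn_const
  source := by rw [hξ.source, mul_one, Unitary.mul_star_self_of_mem v.2]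
  target := by rw [hξ.target]; rfl

/-- A constant path. -/
def constPath (v : Un A n) : InvPath (CStarMatrix (Fin n) (Fin n) A) where
  val _ := v
  der _ := 0
  inv _ := star (v : CStarMatrix (Fin n) (Fin n) A)
  hasDeriv _ _ := hasDerivWithinAt_const _ _ _
  cont_der := continuousOn_const
  mul_inv _ _ := Unitary.mul_star_self_of_mem v.2
  inv_mul _ _ := Unitary.star_mul_self_of_mem v.2

theorem ev_pathDet_conj (hξ : IsSmoothPath ξ u) (v : Un A n) :
    ev (pathDet fun t => (v : CStarMatrix (Fin n) (Fin n) A) * ξ t *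
      star (v : CStarMatrix _ _ A)) = ev (pathDet ξ) := by
  have e : wind (hξ.conj v).toInv = wind (((constPath v).mul hξ.toInv).mul (constPath v).symm) :=
    wind_congr fun _ _ => rfl
  rw [(hξ.conj v).ev_pathDet, hξ.ev_pathDet, e, wind_mul, wind_mul, wind_symm]
  abel

/-- The path `diag(ξ, 1)`. -/
theorem pad (hξ : IsSmoothPath ξ u) (h : n ≤ m) :
    IsSmoothPath (fun t => padMat n m (ξ t)) (NielsenThomsen.pad n m h u) where
  unitary t ht := (NielsenThomsen.pad n m h ⟨ξ t, hξ.unitary t ht⟩).2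
  smooth i j := by
    simp only [padMat_apply]
    split_ifs
    · exact hξ.smooth _ _
    · exact contDiffOn_const
    · exact contDiffOn_const
  source := by rw [hξ.source, padMat_one]
  target := by rw [hξ.target]; rfl

theorem pathDet_pad (ξ : ℝ → CStarMatrix (Fin n) (Fin n) A) (h : n ≤ m) :
    pathDet (fun t => padMat n m (ξ t)) = pathDet ξ := by
  obtain ⟨k, rfl⟩ := Nat.exists_eq_add_of_le h
  unfold pathDet
  congr 2
  funext t
  rw [Fin.sum_univ_add]
  simp only [Fin.sum_univ_add, padMat_apply]
  simp

/-- The path `t ↦ exp(2πi t h)`. -/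
theorem exp (h : selfAdjoint (CStarMatrix (Fin n) (Fin n) A)) :
    IsSmoothPath (fun t => (selfAdjoint.expUnitary (t • h) : CStarMatrix (Fin n) (Fin n) A))
      (selfAdjoint.expUnitary h) where
  unitary t _ := (selfAdjoint.expUnitary (t • h)).2
  smooth i j := by
    refine ContDiff.contDiffOn ?_
    have h1 : ContDiff ℝ ∞ (NormedSpace.exp : CStarMatrix (Fin n) (Fin n) A → _) :=
      contDiff_iff_contDiffAt.2 fun x => (NormedSpace.exp_analytic (𝕂 := ℝ) x).contDiffAt
    have h2 : ContDiff ℝ ∞ fun t : ℝ => t • (Complex.I • (h : CStarMatrix (Fin n) (Fin n) A)) :=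
      (ContinuousLinearMap.toSpanSingleton ℝ
        (Complex.I • (h : CStarMatrix (Fin n) (Fin n) A))).contDiff
    have h3 := ((entryL i j).restrictScalars ℝ).contDiff.comp (h1.comp h2)
    refine (congrArg (ContDiff ℝ ∞) (funext fun t => ?_)).mp h3
    symm
    change NormedSpace.exp (Complex.I • (t • (h : CStarMatrix (Fin n) (Fin n) A))) i j =
      NormedSpace.exp (t • (Complex.I • (h : CStarMatrix (Fin n) (Fin n) A))) i j
    rw [smul_comm]
  source := by rw [zero_smul, selfAdjoint.expUnitary_zero]; rfl
  target := by rw [one_smul]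

/-- The logarithmic derivative of `exp(ith)` is the constant `ih`, and `i/(2πi) = 1/(2π)`. -/
theorem ev_pathDet_exp (h : selfAdjoint (CStarMatrix (Fin n) (Fin n) A)) :
    ev (pathDet fun t => (selfAdjoint.expUnitary (t • h) : CStarMatrix (Fin n) (Fin n) A)) =
      (2 * Real.pi)⁻¹ • trL A (Fin n) (h : CStarMatrix (Fin n) (Fin n) A) := by
  let X : CStarMatrix (Fin n) (Fin n) A := Complex.I • (h : CStarMatrix (Fin n) (Fin n) A)
  have hX : ∀ t : ℝ, (selfAdjoint.expUnitary (t • h) : CStarMatrix (Fin n) (Fin n) A) =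
      NormedSpace.exp (t • X) := fun t => by
    change NormedSpace.exp (Complex.I • (t • (h : CStarMatrix (Fin n) (Fin n) A))) = _
    rw [smul_comm]
  have hP := exp h
  have hd : ∀ t ∈ Icc (0 : ℝ) 1, hP.toInv.der t = X * hP.toInv.val t := by
    intro t ht
    refine (uniqueDiffOn_Icc zero_lt_one t ht).eq_deriv _ (hP.toInv.hasDeriv t ht) ?_
    have := (hasDerivAt_exp_smul_const' (𝕂 := ℝ) X t).hasDerivWithinAt (s := Icc 0 1)
    change HasDerivWithinAt _ (X * (selfAdjoint.expUnitary (t • h) : CStarMatrix _ _ A)) _ _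
    rw [hX]
    exact this.congr (fun s _ => hX s) (hX t)
  rw [hP.ev_pathDet, wind_eq]
  have e : ∫ t in (0 : ℝ)..1, trI A (Fin n) (hP.toInv.der t * hP.toInv.inv t) =
      ∫ _ in (0 : ℝ)..1, trI A (Fin n) X :=
    InvPath.integral_congr_Icc fun t ht => by
      rw [hd t ht, mul_assoc, hP.toInv.mul_inv t ht, mul_one]
  rw [e, intervalIntegral.integral_const, sub_zero, one_smul, trI_apply, smul_smul, ← map_smul]
  have ec : (2 * Real.pi * Complex.I : ℂ)⁻¹ * Complex.I = (((2 * Real.pi)⁻¹ : ℝ) : ℂ) := by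
    push_cast
    field_simp
  rw [ec]
  exact congrArg _ (CStarMatrix.ext fun i j => Complex.coe_smul _ _)

theorem one : IsSmoothPath (fun _ => (1 : CStarMatrix (Fin n) (Fin n) A)) (1 : Un A n) where
  unitary _ _ := one_mem _
  smooth _ _ := contDiffOn_const
  source := rfl
  target := rfl

/-- A unitary connected to `1` is a finite product of exponentials, and each exponential comes with
the smooth path `t ↦ exp(ith)`. Thus a merely continuous path can be traded for a smooth one. -/
theorem exists_of_joined (h : Joined 1 u) : ∃ ξ, IsSmoothPath ξ u := by
  obtain ⟨l, rfl⟩ := Unitary.mem_pathComponentOne_iff.1 h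
  clear h
  induction l with
  | nil => exact ⟨_, one⟩
  | cons x l ih =>
    obtain ⟨ξ, hξ⟩ := ih
    exact ⟨_, (exp x).mul hξ⟩

/-- The determinant of a path is determined by its endpoint, up to the image of `K₀`. -/
theorem toH_ev_pathDet_eq (hξ : IsSmoothPath ξ u) (hη : IsSmoothPath η u) :
    toH (ev (pathDet ξ)) = toH (ev (pathDet η)) := by
  have h := hξ.mul hη.inv
  have e := hξ.ev_pathDet_mul hη.inv
  rw [hη.ev_pathDet_inv, h.ev_pathDet] at e
  -- The path `ξη*` is a loop at `1`, so its winding number, the difference of the two determinants,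
  -- is in the image of `K₀`.
  have hmem : wind h.toInv ∈ imageK0 A := wind_loop_mem _ (by
    change ξ 0 * star (η 0) = ξ 1 * star (η 1)
    rw [hξ.source, hη.source, hξ.target, hη.target, star_one, mul_one,
      Unitary.mul_star_self_of_mem u.2])
  refine QuotientAddGroup.eq.2 (AddSubgroup.le_topologicalClosure _ ?_)
  rw [e] at hmem
  have := neg_mem hmem
  rwa [neg_add, neg_neg] at this

end IsSmoothPath

/-! ### The determinant on `U^∞_0(A)` -/

section DetBar

variable {A B : Type*} [CStarAlgebra A] [CStarAlgebra B]

theorem UInf.exists_pad_eq {n m : ℕ} {u : Un A n} {v : Un A m} (h : UInf.of n u = UInf.of m v) :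
    ∃ (N : ℕ) (hn : n ≤ N) (hm : m ≤ N), pad n N hn u = pad m N hm v := by
  obtain ⟨N, hn, hm, e⟩ := Quotient.exact h
  exact ⟨N, hn, hm, e⟩

theorem toH_add (f g : AffT1 A) : toH (f + g) = toH f + toH g := rfl

theorem toH_neg (f : AffT1 A) : toH (-f) = -toH f := rfl

theorem IsSmoothPath.isDetBar {n : ℕ} {u : Un A n} {ξ : ℝ → CStarMatrix (Fin n) (Fin n) A}
    (hξ : IsSmoothPath ξ u) : IsDetBar (UInf.of n u) (toH (ev (pathDet ξ))) :=
  ⟨n, u, ξ, rfl, hξ, rfl⟩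

namespace IsDetBar

theorem exists_large {x : UInf A} {y : H A} (h : IsDetBar x y) : ∃ N₀, ∀ N, N₀ ≤ N →
    ∃ (u : Un A N) (ξ : ℝ → CStarMatrix (Fin N) (Fin N) A),
      UInf.of N u = x ∧ IsSmoothPath ξ u ∧ y = toH (ev (pathDet ξ)) := by
  obtain ⟨n, u, ξ, rfl, hξ, rfl⟩ := h
  exact ⟨n, fun N hN => ⟨_, _, UInf.of_pad hN u, hξ.pad hN, by
    rw [IsSmoothPath.pathDet_pad ξ hN]⟩⟩

/-- Representatives of different sizes agree after padding by `1`, which does not change the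
determinant of a path. -/
theorem unique {x : UInf A} {y y' : H A} (h : IsDetBar x y) (h' : IsDetBar x y') : y = y' := by
  obtain ⟨n, u, ξ, rfl, hξ, rfl⟩ := h
  obtain ⟨m, v, η, e, hη, rfl⟩ := h'
  obtain ⟨N, hm, hn, e⟩ := UInf.exists_pad_eq e
  rw [← IsSmoothPath.pathDet_pad ξ hn, ← IsSmoothPath.pathDet_pad η hm]
  have h2 := hη.pad hm
  rw [e] at h2
  exact (hξ.pad hn).toH_ev_pathDet_eq h2

theorem mul {x x' : UInf A} {y y' : H A} (h : IsDetBar x y) (h' : IsDetBar x' y') :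
    IsDetBar (x * x') (y + y') := by
  obtain ⟨N, hN⟩ := h.exists_large
  obtain ⟨N', hN'⟩ := h'.exists_large
  obtain ⟨u, ξ, rfl, hξ, rfl⟩ := hN (max N N') (le_max_left _ _)
  obtain ⟨v, η, rfl, hη, rfl⟩ := hN' (max N N') (le_max_right _ _)
  rw [← map_mul, ← toH_add, ← hξ.ev_pathDet_mul hη]
  exact (hξ.mul hη).isDetBar

theorem inv {x : UInf A} {y : H A} (h : IsDetBar x y) : IsDetBar x⁻¹ (-y) := by
  obtain ⟨n, u, ξ, rfl, hξ, rfl⟩ := h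
  rw [← map_inv, ← toH_neg, ← hξ.ev_pathDet_inv]
  exact hξ.inv.isDetBar

theorem conj {x : UInf A} {y : H A} (h : IsDetBar x y) (g : UInf A) :
    IsDetBar (g * x * g⁻¹) y := by
  obtain ⟨N, hN⟩ := h.exists_large
  obtain ⟨m, v, rfl⟩ := g.exists_of
  obtain ⟨u, ξ, rfl, hξ, rfl⟩ := hN (max N m) (le_max_left _ _)
  rw [← UInf.of_pad (le_max_right N m) v, ← map_inv, ← map_mul, ← map_mul,
    ← hξ.ev_pathDet_conj (pad m _ (le_max_right N m) v)]
  exact (hξ.conj _).isDetBar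

theorem one : IsDetBar (1 : UInf A) 0 := by
  have h := (IsSmoothPath.one (A := A) (n := 0)).isDetBar
  rw [map_one] at h
  have e : ev (pathDet fun _ : ℝ => (1 : CStarMatrix (Fin 0) (Fin 0) A)) = 0 := by
    have : pathDet (fun _ : ℝ => (1 : CStarMatrix (Fin 0) (Fin 0) A)) = 0 := by simp [pathDet]
    rw [this, ← evL_apply, map_zero]
  rw [e] at h
  exact h

theorem detBar_eq {x : UInf A} {y : H A} (h : IsDetBar x y) : detBar x = y := by
  have h' : ∃ y, IsDetBar x y := ⟨y, h⟩
  rw [detBar, dif_pos h']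
  exact h'.choose_spec.unique h

end IsDetBar

theorem isDetBar_detBar {x : UInf A} (hx : x ∈ UInf0 A) : IsDetBar x (detBar x) := by
  obtain ⟨n, u, hu, rfl⟩ := hx
  obtain ⟨ξ, hξ⟩ := IsSmoothPath.exists_of_joined hu
  have h := hξ.isDetBar
  rwa [← h.detBar_eq] at h

theorem isDetBar_iff {x : UInf A} (hx : x ∈ UInf0 A) (y : H A) : IsDetBar x y ↔ y = detBar x :=
  ⟨fun h => h.detBar_eq.symm, fun h => h ▸ isDetBar_detBar hx⟩

theorem detBar_mul {x y : UInf A} (hx : x ∈ UInf0 A) (hy : y ∈ UInf0 A) :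
    detBar (x * y) = detBar x + detBar y :=
  ((isDetBar_detBar hx).mul (isDetBar_detBar hy)).detBar_eq

theorem detBar_inv {x : UInf A} (hx : x ∈ UInf0 A) : detBar x⁻¹ = -detBar x :=
  (isDetBar_detBar hx).inv.detBar_eq

theorem detBar_conj {x : UInf A} (hx : x ∈ UInf0 A) (g : UInf A) :
    detBar (g * x * g⁻¹) = detBar x :=
  ((isDetBar_detBar hx).conj g).detBar_eq

theorem detBar_one : detBar (1 : UInf A) = 0 := IsDetBar.one.detBar_eq

/-- The self-adjoint matrices of size `n`. -/
abbrev Sn (A : Type*) [CStarAlgebra A] (n : ℕ) : Type _ :=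
  selfAdjoint (CStarMatrix (Fin n) (Fin n) A)

/-- The unitary matrix `exp(2πi h)`. -/
def uexp {n : ℕ} (h : Sn A n) : Un A n := selfAdjoint.expUnitary ((2 * Real.pi) • h)

theorem isDetBar_uexp {n : ℕ} (h : Sn A n) :
    IsDetBar (UInf.of n (uexp h)) (toH (trL A (Fin n) (h : CStarMatrix (Fin n) (Fin n) A))) := by
  have e := IsSmoothPath.ev_pathDet_exp ((2 * Real.pi) • h)
  rw [selfAdjoint.val_smul, map_smul, smul_smul, inv_mul_cancel₀ (by positivity), one_smul] at e
  rw [← e]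
  exact (IsSmoothPath.exp _).isDetBar

theorem joined_one_uexp {n : ℕ} (h : Sn A n) : Joined 1 (uexp h) :=
  selfAdjoint.joined_one_expUnitary _

theorem exists_list_uexp {n : ℕ} {u : Un A n} (h : Joined 1 u) :
    ∃ l : List (Sn A n), u = (l.map uexp).prod := by
  obtain ⟨l, rfl⟩ := Unitary.mem_pathComponentOne_iff.1 h
  refine ⟨l.map fun x => (2 * Real.pi)⁻¹ • x, ?_⟩
  rw [List.map_map]
  congr 2
  funext x
  simp only [uexp, Function.comp_apply, smul_smul]
  rw [mul_inv_cancel₀ (by positivity), one_smul]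

/-! ### Naturality of the determinant -/

variable (φ : A →⋆ₙₐ[ℂ] B)

/-- A `*`-homomorphism, as a continuous linear map. -/
def homL : A →L[ℂ] B := ⟨(φ : A →ₗ[ℂ] B), continuous_hom φ⟩

theorem IsSmoothPath.map {n : ℕ} {u : Un A n} {ξ : ℝ → CStarMatrix (Fin n) (Fin n) A}
    (hξ : IsSmoothPath ξ u) :
    IsSmoothPath (fun t => CStarMatrix.mapₙₐ φ (ξ t) + (1 - CStarMatrix.mapₙₐ φ 1))
      (Un.map φ n u) where
  unitary t ht := (Un.map φ n ⟨ξ t, hξ.unitary t ht⟩).2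
  smooth i j := by
    have h := ((homL φ).restrictScalars ℝ).contDiff.comp_contDiffOn (hξ.smooth i j)
    exact h.add contDiffOn_const
  source := by rw [hξ.source, add_sub_cancel]
  target := by rw [hξ.target]; rfl

/-- The summand `1 - φ(1)` is constant, so the derivative ignores it, and its contribution to the
inverse is killed because `φ(a)(1 - φ(1)) = 0`. -/
theorem IsSmoothPath.pathDet_map {n : ℕ} {u : Un A n} {ξ : ℝ → CStarMatrix (Fin n) (Fin n) A}
    (hξ : IsSmoothPath ξ u) :
    pathDet (fun t => CStarMatrix.mapₙₐ φ (ξ t) + (1 - CStarMatrix.mapₙₐ φ 1)) =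
      φ (pathDet ξ) := by
  have hent : ∀ t i j, (CStarMatrix.mapₙₐ φ (ξ t) + (1 - CStarMatrix.mapₙₐ φ 1) :
      CStarMatrix (Fin n) (Fin n) B) i j = φ (ξ t i j) + if i = j then 1 - φ 1 else 0 := by
    intro t i j
    change φ (ξ t i j) + ((1 : CStarMatrix (Fin n) (Fin n) B) i j -
      φ ((1 : CStarMatrix (Fin n) (Fin n) A) i j)) = _
    rw [CStarMatrix.one_apply, CStarMatrix.one_apply]
    split_ifs <;> simp
  let g : ℝ → A := fun t => ∑ i, ∑ j, derivWithin (fun s => ξ s i j) (Icc 0 1) t * star (ξ t i j)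
  have hg : ContinuousOn g (Icc 0 1) := continuousOn_finsetSum _ fun i _ =>
    continuousOn_finsetSum _ fun j _ => (hξ.cont_deriv i j).mul (hξ.cont_entry i j).star
  have hI : IntervalIntegrable g MeasureTheory.volume 0 1 :=
    ContinuousOn.intervalIntegrable (by rwa [uIcc_of_le zero_le_one])
  have e : ∫ t in (0 : ℝ)..1, homL φ (g t) = homL φ (∫ t in (0 : ℝ)..1, g t) :=
    ContinuousLinearMap.intervalIntegral_comp_comm _ hI
  unfold pathDet
  rw [map_smul]
  congr 1
  refine Eq.trans ?_ e
  refine InvPath.integral_congr_Icc fun t ht => ?_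
  simp only [hent]
  have hd : ∀ i j, derivWithin (fun s => φ (ξ s i j) + if i = j then 1 - φ 1 else 0) (Icc 0 1) t =
      φ (derivWithin (fun s => ξ s i j) (Icc 0 1) t) := fun i j =>
    ((((homL φ).restrictScalars ℝ).hasFDerivAt.comp_hasDerivWithinAt t
      (hξ.diff i j ht)).add_const _).derivWithin (uniqueDiffOn_Icc zero_lt_one t ht)
  have h1 : star (φ 1) = φ 1 := by rw [← map_star, star_one]
  have hz : ∀ a, φ a * (1 - φ 1) = 0 := fun a => by
    rw [mul_sub, mul_one, ← map_mul, mul_one, sub_self]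
  change _ = φ (g t)
  simp only [g, map_sum, hd]
  refine Finset.sum_congr rfl fun i _ => Finset.sum_congr rfl fun j _ => ?_
  rw [map_mul, map_star, star_add, mul_add]
  split_ifs
  · rw [star_sub, star_one, h1, hz, add_zero]
  · rw [star_zero, mul_zero, add_zero]

theorem H.map_toH (f : AffT1 A) : H.map φ (toH f) = toH (AffT1.map φ f) := rfl

/-- The image of a smooth path is a smooth path to the image of its endpoint, and `H(φ)` carries the
class of `ev_a` to that of `ev_{φ(a)}`. -/
theorem detBar_map {x : UInf A} (hx : x ∈ UInf0 A) :
    detBar (UInf.map φ x) = H.map φ (detBar x) := by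
  obtain ⟨n, u, ξ, rfl, hξ, e⟩ := isDetBar_detBar hx
  have h := (hξ.map φ).isDetBar
  rw [hξ.pathDet_map φ, ← AffT1.map_ev, ← H.map_toH, ← e] at h
  exact h.detBar_eq

end DetBar

/-! ### Unitarily invariant functionals and traces -/

section PositivePart

variable {R : Type*} [CStarAlgebra R]

theorem norm_one_le : ‖(1 : R)‖ ≤ 1 := by
  rcases subsingleton_or_nontrivial R with h | h
  · rw [Subsingleton.elim (1 : R) 0, norm_zero]; exact zero_le_one
  · rw [CStarRing.norm_one]

/-- An additive unitarily invariant map is tracial. -/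
theorem map_mul_comm_of_conj {G : Type*} [AddCommGroup G] (f : R →+ G)
    (hf : ∀ (u : unitary R) (x : R), f (u * x * star (u : R)) = f x) (x y : R) :
    f (x * y) = f (y * x) := by
  -- Unitaries span the algebra, and for a unitary `y` the claim is invariance under conjugation by
  -- `y`, applied to `xy`. The map is only additive, so a scalar in front of a unitary is moved to
  -- the other factor; this is why `x` is generalized.
  have hy : y ∈ Submodule.span ℂ (unitary R : Set R) := by
    rw [CStarAlgebra.span_unitary]; exact Submodule.mem_top
  induction hy using Submodule.span_induction generalizing x with
  | mem u hu =>
    have := hf ⟨u, hu⟩ (x * u)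
    rw [← this]
    congr 1
    simp only [mul_assoc]
    rw [Unitary.mul_star_self_of_mem hu, mul_one]
  | zero => simp
  | add a b _ _ ha hb => rw [mul_add, add_mul, map_add, map_add, ha, hb]
  | smul c a _ ha => rw [mul_smul_comm, ← smul_mul_assoc, ha, mul_smul_comm, smul_mul_assoc]

/-- A weak form of the Riesz decomposition property, up to conjugation. -/
theorem exists_riesz {s c : R} (hs : 0 ≤ s) (hc : 0 ≤ c) (hcs : c ≤ s) {ε : ℝ} (hε : 0 < ε) :
    ∃ w : R, 0 ≤ w ∧ w ≤ 1 ∧ ∀ f : R →L[ℝ] ℝ, (∀ x y, f (x * y) = f (y * x)) →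
      f (w * s) = f c - ε * f w := by
  have hεp : IsStrictlyPositive (algebraMap ℝ R ε) := by
    rw [Algebra.algebraMap_eq_smul_one]
    exact IsStrictlyPositive.smul hε isStrictlyPositive_one
  have hle : algebraMap ℝ R ε ≤ s + algebraMap ℝ R ε := le_add_of_nonneg_left hs
  have h0 : 0 ≤ s + algebraMap ℝ R ε := add_nonneg hs hεp.nonneg
  have hu : IsUnit (s + algebraMap ℝ R ε) := CStarAlgebra.isUnit_of_le _ hle
  set t := CFC.sqrt (s + algebraMap ℝ R ε) with ht
  have htt : t * t = s + algebraMap ℝ R ε := CFC.sqrt_mul_sqrt_self _ h0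
  have htu : IsUnit t := by
    rw [← htt] at hu
    exact ((Commute.refl t).isUnit_mul_iff.1 hu).1
  have hts : IsSelfAdjoint t := (CFC.sqrt_nonneg _).isSelfAdjoint
  obtain ⟨T, hT⟩ := htu
  set r : R := ((T⁻¹ : Rˣ) : R) with hr
  have hrt : r * t = 1 := by rw [← hT, hr, Units.inv_mul]
  have htr : t * r = 1 := by rw [← hT, hr, Units.mul_inv]
  have hrs : IsSelfAdjoint r := by
    have : star r * t = 1 := by
      have := congrArg star htr
      rwa [star_mul, hts.star_eq, star_one] at this
    exact left_inv_eq_right_inv this htr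
  -- Here `r = (s + ε)^{-1/2}`, so `w = rcr ≤ 1` follows from `c ≤ s + ε`, and traciality gives
  -- `f(w(s + ε)) = f(c)`. The shift by `ε` makes the square root invertible.
  refine ⟨r * c * r, ?_, ?_, fun f hf => ?_⟩
  · simpa using hrs.conjugate_le_conjugate hc
  · have h1 := hrs.conjugate_le_conjugate (hcs.trans (le_add_of_nonneg_right hεp.nonneg))
    rwa [← htt, ← mul_assoc, hrt, one_mul, htr] at h1
  · have h1 : f (r * c * r * (s + algebraMap ℝ R ε)) = f c := by
      rw [← htt]
      calc f (r * c * r * (t * t)) = f (r * (c * (r * t) * t)) := by simp only [mul_assoc]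
        _ = f (c * t * r) := by rw [hrt, mul_one, hf]
        _ = f c := by rw [mul_assoc, htr, mul_one]
    rw [mul_add, map_add, Algebra.algebraMap_eq_smul_one, mul_smul_comm, mul_one, map_smul,
      smul_eq_mul] at h1
    linarith

variable (f : R →L[ℝ] ℝ)

/-- The positive part of a functional, on positive elements. -/
def posFun (a : R) : ℝ := sSup (f '' {c | 0 ≤ c ∧ c ≤ a})

theorem posFun_bdd (a : R) : ∀ y ∈ f '' {c | 0 ≤ c ∧ c ≤ a}, y ≤ ‖f‖ * ‖a‖ := by
  rintro _ ⟨c, ⟨h0, h1⟩, rfl⟩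
  calc f c ≤ ‖f c‖ := Real.le_norm_self _
    _ ≤ ‖f‖ * ‖c‖ := f.le_opNorm c
    _ ≤ ‖f‖ * ‖a‖ := by
      gcongr
      exact CStarAlgebra.norm_le_norm_of_nonneg_of_le h0 h1

variable {f}

theorem le_posFun {a c : R} (h0 : 0 ≤ c) (h1 : c ≤ a) : f c ≤ posFun f a :=
  le_csSup ⟨_, posFun_bdd f a⟩ ⟨c, ⟨h0, h1⟩, rfl⟩

theorem posFun_le {a : R} (ha : 0 ≤ a) {C : ℝ} (h : ∀ c, 0 ≤ c → c ≤ a → f c ≤ C) :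
    posFun f a ≤ C := by
  refine csSup_le ⟨f 0, 0, ⟨le_rfl, ha⟩, rfl⟩ ?_
  rintro _ ⟨c, ⟨h0, h1⟩, rfl⟩
  exact h c h0 h1

theorem posFun_nonneg {a : R} (ha : 0 ≤ a) : 0 ≤ posFun f a := by
  simpa using le_posFun (f := f) le_rfl ha

theorem posFun_le_norm {a : R} (ha : 0 ≤ a) : posFun f a ≤ ‖f‖ * ‖a‖ :=
  posFun_le ha fun c h0 h1 => posFun_bdd f a _ ⟨c, ⟨h0, h1⟩, rfl⟩

/-- Superadditivity is formal. For the converse, an element `0 ≤ c ≤ a + b` need not split into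
parts below `a` and `b`, but the `w` of `exists_riesz` gives `√a w √a ≤ a` and `√b w √b ≤ b`, whose
values under the tracial `f` add up to `f(c)` up to a small error. -/
theorem posFun_add (hf : ∀ x y, f (x * y) = f (y * x)) {a b : R} (ha : 0 ≤ a) (hb : 0 ≤ b) :
    posFun f (a + b) = posFun f a + posFun f b := by
  refine le_antisymm ?_ ?_
  · refine le_of_forall_pos_le_add fun ε hε => ?_
    refine posFun_le (add_nonneg ha hb) fun c h0 h1 => ?_
    -- The error is this constant times `f(w) ≤ ‖f‖`, hence at most `ε`; the `+ 1` covers `f = 0`.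
    have hδ : 0 < ε / (‖f‖ + 1) := by positivity
    obtain ⟨w, hw0, hw1, hw⟩ := exists_riesz (add_nonneg ha hb) h0 h1 hδ
    have key : ∀ x : R, 0 ≤ x → f (w * x) ≤ posFun f x := by
      intro x hx
      have hs : IsSelfAdjoint (CFC.sqrt x) := (CFC.sqrt_nonneg x).isSelfAdjoint
      have hxx : CFC.sqrt x * CFC.sqrt x = x := CFC.sqrt_mul_sqrt_self x hx
      have h2 : f (w * x) = f (CFC.sqrt x * w * CFC.sqrt x) := by
        conv_lhs => rw [← hxx]
        rw [← mul_assoc, hf, mul_assoc]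
      rw [h2]
      refine le_posFun ?_ ?_
      · simpa using hs.conjugate_le_conjugate hw0
      · simpa [hxx] using hs.conjugate_le_conjugate hw1
    have h3 := hw f hf
    rw [mul_add, map_add] at h3
    have h4 : f w ≤ ‖f‖ := by
      have h5 : ‖w‖ ≤ 1 := (CStarAlgebra.norm_le_one_iff_of_nonneg w hw0).2 hw1
      exact (Real.le_norm_self _).trans ((f.le_opNorm w).trans
        (mul_le_of_le_one_right (norm_nonneg _) h5))
    have h6 : ε / (‖f‖ + 1) * f w ≤ ε := by
      rw [div_mul_eq_mul_div, div_le_iff₀ (by positivity)]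
      nlinarith
    linarith [key a ha, key b hb]
  · have h1 : ∀ c, 0 ≤ c → c ≤ a → f c ≤ posFun f (a + b) - posFun f b := by
      intro c h0 h1
      have : posFun f b ≤ posFun f (a + b) - f c := posFun_le hb fun d g0 g1 => by
        have := le_posFun (f := f) (add_nonneg h0 g0) (add_le_add h1 g1)
        rw [map_add] at this
        linarith
      linarith
    linarith [posFun_le ha h1]

theorem conj_nonneg {u : unitary R} {a : R} : 0 ≤ (u : R) * a * star (u : R) ↔ 0 ≤ a := by
  refine ⟨fun h => ?_, fun h => by simpa using star_right_conjugate_le_conjugate h (u : R)⟩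
  have := star_left_conjugate_le_conjugate h (u : R)
  simpa [mul_assoc, Unitary.star_mul_self_of_mem u.2, ← mul_assoc (star (u : R)) (u : R)] using this

theorem posFun_conj (hf : ∀ (u : unitary R) (x : R), f (u * x * star (u : R)) = f x)
    (u : unitary R) {a : R} (ha : 0 ≤ a) : posFun f (u * a * star (u : R)) = posFun f a := by
  have key : ∀ (v : unitary R) (b : R), 0 ≤ b →
      posFun f b ≤ posFun f (v * b * star (v : R)) := by
    intro v b hb
    refine posFun_le hb fun c h0 h1 => ?_
    rw [← hf v c]
    exact le_posFun (conj_nonneg.2 h0) (star_right_conjugate_le_conjugate h1 (v : R))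
  refine le_antisymm ?_ (key u a ha)
  have h := key u⁻¹ _ (conj_nonneg (u := u).2 ha)
  have e : ((u⁻¹ : unitary R) : R) * (u * a * star (u : R)) * star ((u⁻¹ : unitary R) : R) = a := by
    rw [← Unitary.star_eq_inv, Unitary.coe_star, star_star, ← mul_assoc, ← mul_assoc,
      Unitary.star_mul_self_of_mem u.2, one_mul, mul_assoc, Unitary.star_mul_self_of_mem u.2, mul_one]
  rwa [e] at h

/-- An additive bounded functional on the positive cone extends to a continuous linear functional
on the algebra, which only depends on the real part. -/
theorem exists_extension_of_cone {g : R → ℝ} {C : ℝ}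
    (hadd : ∀ a b, 0 ≤ a → 0 ≤ b → g (a + b) = g a + g b)
    (hbd : ∀ a, 0 ≤ a → |g a| ≤ C * ‖a‖) :
    ∃ F : R →L[ℝ] ℝ, (∀ a, 0 ≤ a → F a = g a) ∧ ∀ x, F (star x) = F x := by
  -- The value `g(a) - g(b)` depends only on `a - b`, so it may be computed from any decomposition
  -- into positive elements; in particular it is additive in the difference.
  have key : ∀ a b c d : R, 0 ≤ a → 0 ≤ b → 0 ≤ c → 0 ≤ d → a - b = c - d →
      g a - g b = g c - g d := by
    intro a b c d ha hb hc hd h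
    have h1 : a + d = c + b := by
      rw [sub_eq_sub_iff_add_eq_add] at h; exact h
    have := congrArg g h1
    rw [hadd _ _ ha hd, hadd _ _ hc hb] at this
    linarith
  have hp : ∀ x : R, 0 ≤ x⁺ := fun x => CFC.posPart_nonneg x
  have hn : ∀ x : R, 0 ≤ x⁻ := fun x => CFC.negPart_nonneg x
  let G₀ : selfAdjoint R →+ ℝ :=
    { toFun := fun h => g ((h : R)⁺) - g ((h : R)⁻)
      map_zero' := by simp
      map_add' := fun h k => by
        have := key _ _ ((h : R)⁺ + (k : R)⁺) ((h : R)⁻ + (k : R)⁻) (hp ((h + k : selfAdjoint R) : R))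
          (hn ((h + k : selfAdjoint R) : R)) (add_nonneg (hp _) (hp _)) (add_nonneg (hn _) (hn _)) (by
            rw [CFC.posPart_sub_negPart _ (h + k).2, add_sub_add_comm,
              CFC.posPart_sub_negPart _ h.2, CFC.posPart_sub_negPart _ k.2]
            rfl)
        rw [this, hadd _ _ (hp _) (hp _), hadd _ _ (hn _) (hn _)]
        ring }
  have hG : ∀ h, ‖G₀ h‖ ≤ (2 * |C|) * ‖h‖ := by
    intro h
    have h1 := hbd _ (hp (h : R))
    have h2 := hbd _ (hn (h : R))
    have h3 : C * ‖(h : R)⁺‖ ≤ |C| * ‖(h : R)‖ := by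
      gcongr
      · exact le_abs_self C
      · exact CStarAlgebra.norm_posPart_le _
    have h4 : C * ‖(h : R)⁻‖ ≤ |C| * ‖(h : R)‖ := by
      gcongr
      · exact le_abs_self C
      · exact CStarAlgebra.norm_negPart_le _
    change |g ((h : R)⁺) - g ((h : R)⁻)| ≤ (2 * |C|) * ‖(h : R)‖
    have := abs_sub (g ((h : R)⁺)) (g ((h : R)⁻))
    linarith
  -- Homogeneity of `g` is not assumed: a continuous additive map of real vector spaces is
  -- real-linear.
  let G : selfAdjoint R →L[ℝ] ℝ :=
    G₀.toRealLinearMap (AddMonoidHomClass.continuous_of_bound G₀ _ hG)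
  have hGa : ∀ h, G h = g ((h : R)⁺) - g ((h : R)⁻) := fun h => rfl
  let P : R →L[ℝ] selfAdjoint R :=
    LinearMap.mkContinuous realPart 1 fun x => by rw [one_mul]; exact realPart.norm_le x
  have hP : ∀ x, ((P x : selfAdjoint R) : R) = (realPart x : R) := fun x => rfl
  refine ⟨G.comp P, fun a ha => ?_, fun x => ?_⟩
  · change G (P a) = _
    rw [hGa, hP, (IsSelfAdjoint.of_nonneg ha).coe_realPart]
    have := key _ _ a 0 (hp a) (hn a) ha le_rfl (by
      rw [CFC.posPart_sub_negPart _ (IsSelfAdjoint.of_nonneg ha), sub_zero])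
    have h0 : g 0 = 0 := by
      have := hadd 0 0 le_rfl le_rfl
      rw [add_zero] at this; linarith
    rw [this, h0, sub_zero]
  · change G (P (star x)) = G (P x)
    congr 1
    refine Subtype.ext ?_
    rw [hP, hP, realPart_apply_coe, realPart_apply_coe, star_star, add_comm]

end PositivePart

/-! ### Duality between tracial states and unitarily invariant functionals. -/

section TraceDuality

variable {R : Type*} [CStarAlgebra R]

/-- A positive trace is controlled by tracial states. -/
theorem abs_le_of_positive_trace (F : R →L[ℝ] ℝ)
    (hu : ∀ (u : unitary R) (x : R), F (u * x * star (u : R)) = F x)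
    (hs : ∀ x, F (star x) = F x) (hp : ∀ a, 0 ≤ F (star a * a)) (x : R) :
    |F x| ≤ F 1 * ‖ev x‖ := by
  let τ : R →L[ℂ] ℂ := StrongDual.extendRCLike (𝕜 := ℂ) F
  have hre : ∀ y, (τ y).re = F y := fun y => StrongDual.re_extendRCLike_apply (𝕜 := ℂ) F y
  have hτ : ∀ y, τ y = (F y : ℂ) - Complex.I * (F (Complex.I • y) : ℂ) := fun y =>
    StrongDual.extendRCLike_apply (𝕜 := ℂ) F y
  -- The complex extension `τ(y) = F(y) - iF(iy)` must be real on positive elements. Invariance of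
  -- `F` under the adjoint gives this, since `i a*a` is skew-adjoint.
  have him : ∀ a : R, F (Complex.I • (star a * a)) = 0 := by
    intro a
    have h := hs (Complex.I • (star a * a))
    rw [star_smul, star_mul, star_star, Complex.star_def, Complex.conj_I, neg_smul, map_neg] at h
    linarith
  have hpos' : ∀ a : R, τ (star a * a) = (F (star a * a) : ℂ) := by
    intro a
    rw [hτ, him, Complex.ofReal_zero, mul_zero, sub_zero]
  have hpos : ∀ a : R, 0 ≤ (τ : R →ₗ[ℂ] ℂ) (star a * a) := by
    intro a
    refine Complex.nonneg_iff.2 ⟨?_, ?_⟩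
    · exact (hp a).trans_eq (hre _).symm
    · change 0 = (τ (star a * a)).im
      rw [hpos', Complex.ofReal_im]
  have h1 : τ 1 = (F 1 : ℂ) := by simpa using hpos' 1
  have htr : ∀ a b, τ (a * b) = τ (b * a) := by
    refine map_mul_comm_of_conj (τ : R →+ ℂ) fun u y => ?_
    change τ _ = τ _
    rw [hτ, hτ, hu, ← smul_mul_assoc, ← mul_smul_comm, hu]
  have hF1 : 0 ≤ F 1 := by simpa using hp 1
  rcases hF1.eq_or_lt with h0 | h0
  · have := positive_bound (τ : R →ₗ[ℂ] ℂ) hpos x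
    change ‖τ x‖ ≤ (τ 1).re * _ at this
    rw [hre, ← h0, zero_mul] at this
    rw [← h0, zero_mul, ← hre, norm_le_zero_iff.1 this, Complex.zero_re, abs_zero]
  · have hF0 : (F 1 : ℂ) ≠ 0 := Complex.ofReal_ne_zero.2 h0.ne'
    let σ : TracialState R := ⟨StrongDual.toWeakDual (((F 1 : ℂ)⁻¹) • τ), by
      have key : ∀ a, (StrongDual.toWeakDual (((F 1 : ℂ)⁻¹) • τ)) a = (F 1 : ℂ)⁻¹ * τ a :=
        fun a => rfl
      refine ⟨fun a => ?_, ?_, fun a b => ?_⟩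
      · rw [key, ← Complex.ofReal_inv]
        exact mul_nonneg (Complex.zero_le_real.2 (inv_nonneg.2 h0.le)) (hpos a)
      · rw [key, h1, inv_mul_cancel₀ hF0]
      · rw [key, key, htr]⟩
    have hσ : (ev x).1 σ = (F 1)⁻¹ * F x := by
      rw [ev_apply]
      change (((F 1 : ℂ)⁻¹) * τ x).re = _
      rw [← Complex.ofReal_inv, Complex.re_ofReal_mul, hre]
    have h2 : |(ev x).1 σ| ≤ ‖ev x‖ := (ev x).1.norm_coe_le_norm σ
    rw [hσ, abs_mul, abs_of_pos (inv_pos.2 h0), inv_mul_le_iff₀ h0] at h2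
    exact h2

/-- A unitarily invariant functional that only depends on real parts is controlled by tracial
states, since it is a difference of positive traces. -/
theorem abs_le_of_conj_invariant (f : R →L[ℝ] ℝ)
    (hu : ∀ (u : unitary R) (x : R), f (u * x * star (u : R)) = f x)
    (hs : ∀ x, f (star x) = f x) (x : R) : |f x| ≤ 3 * ‖f‖ * ‖ev x‖ := by
  have htr : ∀ a b, f (a * b) = f (b * a) := map_mul_comm_of_conj (f : R →+ ℝ) hu
  -- Jordan decomposition: `F` is the positive part of `f`, and `F - f` is positive because `posFun
  -- f a ≥ f a` for `a ≥ 0`. Both inherit invariance under conjugation and adjoints.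
  obtain ⟨F, hF, hFs⟩ := exists_extension_of_cone (g := posFun f) (C := ‖f‖)
    (fun a b ha hb => posFun_add htr ha hb)
    (fun a ha => by rw [abs_of_nonneg (posFun_nonneg ha)]; exact posFun_le_norm ha)
  have hre : ∀ (g : R →L[ℝ] ℝ), (∀ y, g (star y) = g y) → (∀ a b, 0 ≤ a → 0 ≤ b →
      ∀ y, y + star y = a - b → 2 * g y = g a - g b) := by
    intro g hg a b _ _ y h
    rw [← map_sub, ← h, map_add, hg, two_mul]
  have hdec : ∀ y : R, ∃ a b : R, 0 ≤ a ∧ 0 ≤ b ∧ y + star y = a - b := fun y =>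
    ⟨_, _, CFC.posPart_nonneg (y + star y), CFC.negPart_nonneg _,
      (CFC.posPart_sub_negPart _ (IsSelfAdjoint.add_star_self y)).symm⟩
  have hFu : ∀ (u : unitary R) (y : R), F (u * y * star (u : R)) = F y := by
    intro u y
    obtain ⟨a, b, ha, hb, h⟩ := hdec y
    have h1 := hre F hFs a b ha hb y h
    have h2 := hre F hFs _ _ (conj_nonneg (u := u).2 ha) (conj_nonneg (u := u).2 hb)
      (u * y * star (u : R)) (by
        rw [star_mul, star_mul, star_star, ← sub_mul, ← mul_sub, ← h]
        simp only [mul_add, add_mul, mul_assoc])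
    rw [hF _ ha, hF _ hb] at h1
    rw [hF _ (conj_nonneg.2 ha), hF _ (conj_nonneg.2 hb), posFun_conj hu u ha,
      posFun_conj hu u hb] at h2
    linarith
  have hFp : ∀ a, 0 ≤ F (star a * a) := fun a => by
    rw [hF _ (star_mul_self_nonneg a)]
    exact posFun_nonneg (star_mul_self_nonneg a)
  have b1 := abs_le_of_positive_trace F hFu hFs hFp x
  have b2 := abs_le_of_positive_trace (F - f)
    (fun u y => by simp only [_root_.sub_apply, hFu, hu])
    (fun y => by simp only [_root_.sub_apply, hFs, hs])
    (fun a => by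
      rw [_root_.sub_apply, hF _ (star_mul_self_nonneg a), sub_nonneg]
      exact le_posFun (star_mul_self_nonneg a) le_rfl) x
  rw [_root_.sub_apply, _root_.sub_apply] at b2
  -- The constant 3: the positive traces `F` and `F - f` have masses at most `‖f‖` and `2‖f‖`.
  have h1 : F 1 ≤ ‖f‖ := by
    rw [hF _ zero_le_one]
    exact (posFun_le_norm zero_le_one).trans (mul_le_of_le_one_right (norm_nonneg _) norm_one_le)
  have h2 : -f 1 ≤ ‖f‖ := (neg_le_abs _).trans ((f.le_opNorm 1).trans
    (mul_le_of_le_one_right (norm_nonneg _) norm_one_le))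
  have h3 : |f x| ≤ |F x| + |F x - f x| := by
    have := abs_sub (F x) (F x - f x)
    rwa [sub_sub_cancel] at this
  have := norm_nonneg (ev x)
  nlinarith

variable (R) in
/-- The closed real subspace spanned by the elements `x - u x u*` and `x - x*`. -/
def traceKer : Submodule ℝ R :=
  (Submodule.span ℝ ({y | ∃ (u : unitary R) (x : R), y = x - u * x * star (u : R)} ∪
    {y | ∃ x : R, y = x - star x})).topologicalClosure

theorem sub_conj_mem_traceKer (u : unitary R) (x : R) :
    x - u * x * star (u : R) ∈ traceKer R :=
  Submodule.le_topologicalClosure _ (Submodule.subset_span (Or.inl ⟨u, x, rfl⟩))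

theorem sub_star_mem_traceKer (x : R) : x - star x ∈ traceKer R :=
  Submodule.le_topologicalClosure _ (Submodule.subset_span (Or.inr ⟨x, rfl⟩))

theorem traceKer_le {S : Submodule ℝ R} (hS : IsClosed (S : Set R))
    (h1 : ∀ (u : unitary R) (x : R), x - u * x * star (u : R) ∈ S)
    (h2 : ∀ x : R, x - star x ∈ S) : traceKer R ≤ S := by
  refine Submodule.topologicalClosure_minimal _ (Submodule.span_le.2 ?_) hS
  rintro _ (⟨u, x, rfl⟩ | ⟨x, rfl⟩)
  · exact h1 u x
  · exact h2 x

/-- Tracial states are real on self-adjoint elements; this is applied to `i(x* - x)`. -/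
theorem ev_star (x : R) : ev (star x) = ev x := by
  refine Subtype.ext (ContinuousMap.ext fun τ => ?_)
  rw [ev_apply, ev_apply]
  have hsa : ∀ h : R, IsSelfAdjoint h → (τ.1 h).im = 0 := by
    intro h hh
    have hp : ∀ a : R, 0 ≤ a → (τ.1 a).im = 0 := by
      intro a ha
      obtain ⟨b, rfl⟩ := CStarAlgebra.nonneg_iff_eq_star_mul_self.1 ha
      exact (Complex.nonneg_iff.1 (τ.2.1 b)).2.symm
    rw [← CFC.posPart_sub_negPart h hh, map_sub, Complex.sub_im,
      hp _ (CFC.posPart_nonneg h), hp _ (CFC.negPart_nonneg h), sub_zero]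
  have h := hsa (Complex.I • (star x - x)) (by
    rw [IsSelfAdjoint, star_smul, star_sub, star_star, Complex.star_def, Complex.conj_I, neg_smul,
      ← smul_neg, neg_sub])
  rw [map_smul, map_sub, smul_eq_mul, Complex.I_mul_im, Complex.sub_re] at h
  linarith

theorem ev_eq_zero_of_mem {x : R} (hx : x ∈ traceKer R) : ev x = 0 := by
  have h : traceKer R ≤ LinearMap.ker ((evL : R →L[ℝ] AffT1 R) : R →ₗ[ℝ] AffT1 R) := by
    refine traceKer_le (ContinuousLinearMap.isClosed_ker _) (fun u x => ?_) fun x => ?_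
    · rw [LinearMap.mem_ker, ContinuousLinearMap.coe_coe, map_sub, evL_apply, evL_apply,
        ev_mul_comm, ← mul_assoc, Unitary.star_mul_self_of_mem u.2, one_mul, sub_self]
    · rw [LinearMap.mem_ker, ContinuousLinearMap.coe_coe, map_sub, evL_apply, evL_apply, ev_star,
        sub_self]
  exact h hx

/-- By Hahn–Banach the quotient norm is attained by a functional of norm at most one. Pulled back to
`R` it kills `traceKer R`, that is, it is invariant under unitary conjugation and adjoints, so
`abs_le_of_conj_invariant` applies. -/
theorem norm_mk_traceKer_le (x : R) :
    ‖(Submodule.Quotient.mk x : R ⧸ traceKer R)‖ ≤ 3 * ‖ev x‖ := by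
  obtain ⟨g, hg, hgx⟩ := exists_dual_vector'' ℝ (Submodule.Quotient.mk x : R ⧸ traceKer R)
  let q : R →L[ℝ] R ⧸ traceKer R := (traceKer R).mkQL
  have hq : ‖q‖ ≤ 1 := ContinuousLinearMap.opNorm_le_bound _ zero_le_one fun y => by
    rw [one_mul]; exact Submodule.Quotient.norm_mk_le _ y
  have h0 : ∀ y ∈ traceKer R, q y = 0 := fun y hy => (Submodule.Quotient.mk_eq_zero _).2 hy
  have hb := abs_le_of_conj_invariant (g.comp q)
    (fun u y => by
      have := h0 _ (sub_conj_mem_traceKer u y)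
      rw [map_sub, sub_eq_zero] at this
      change g (q _) = g (q _)
      rw [this])
    (fun y => by
      have := h0 _ (sub_star_mem_traceKer y)
      rw [map_sub, sub_eq_zero] at this
      change g (q _) = g (q _)
      rw [this]) x
  have hn : ‖g.comp q‖ ≤ 1 := (g.opNorm_comp_le q).trans (mul_le_one₀ hg (norm_nonneg _) hq)
  have e : (g.comp q) x = ‖(Submodule.Quotient.mk x : R ⧸ traceKer R)‖ := hgx
  rw [e, abs_of_nonneg (norm_nonneg _)] at hb
  refine hb.trans ?_
  have := norm_nonneg (ev x)
  nlinarith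

theorem mem_traceKer_iff {x : R} : x ∈ traceKer R ↔ ev x = 0 := by
  refine ⟨ev_eq_zero_of_mem, fun h => ?_⟩
  have h1 := norm_mk_traceKer_le x
  have h2 : ‖ev x‖ = 0 := by rw [h]; exact norm_zero
  rw [h2, mul_zero] at h1
  have hcl : IsClosed (traceKer R : Set R) := Submodule.isClosed_topologicalClosure _
  exact (Submodule.Quotient.mk_eq_zero _).1 (norm_le_zero_iff.1 h1)

end TraceDuality

/-! ### Every continuous affine function is an evaluation -/

section EvSurjective

variable {R : Type*} [CStarAlgebra R]

instance : IsScalarTower ℝ ℂ (WeakDual ℂ R) :=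
  ⟨fun r c τ => ContinuousLinearMap.ext fun a => by
    change (r • c) * τ a = r • (c * τ a)
    rw [Complex.real_smul, Complex.real_smul, mul_assoc]⟩

theorem locallyConvexSpace_weakDual : LocallyConvexSpace ℝ (WeakDual ℂ R) :=
  inferInstanceAs (LocallyConvexSpace ℝ (WeakBilin (topDualPairing ℂ R)))

/-- The last coordinate is complex so that the separating functional may be complex-linear; on
points with real last coordinate its real part is `Re F(x) + sγ`, which is all that graphs of real
functions need. -/
theorem exists_separating_prod {E : Type*} [AddCommGroup E] [TopologicalSpace E] [Module ℝ E]
    [Module ℂ E] [IsScalarTower ℝ ℂ E] [IsTopologicalAddGroup E] [ContinuousSMul ℂ E]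
    [T2Space E] (_ : LocallyConvexSpace ℝ E) {S T : Set (E × ℂ)} (hS : Convex ℝ S) (hS' : IsCompact S)
    (hT : Convex ℝ T) (hT' : IsCompact T) (h : Disjoint S T) :
    ∃ (F : E →L[ℂ] ℂ) (γ u : ℝ), (∀ (x : E) (s : ℝ), (x, (s : ℂ)) ∈ S → (F x).re + s * γ < u) ∧
      ∀ (x : E) (s : ℝ), (x, (s : ℂ)) ∈ T → u < (F x).re + s * γ := by
  obtain ⟨F, u, v, h1, h2, h3⟩ := RCLike.geometric_hahn_banach_compact_closed (𝕜 := ℂ)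
    hS hS' hT hT'.isClosed h
  have hF : ∀ (x : E) (s : ℝ),
      (F (x, (s : ℂ))).re = (F.comp (ContinuousLinearMap.inl ℂ E ℂ) x).re + s * (F (0, 1)).re := by
    intro x s
    have : ((x, (s : ℂ)) : E × ℂ) = (x, 0) + (s : ℂ) • ((0, 1) : E × ℂ) := by
      simp
    rw [this, map_add, map_smul, Complex.add_re, smul_eq_mul, Complex.re_ofReal_mul]
    rfl
  refine ⟨F.comp (ContinuousLinearMap.inl ℂ E ℂ), (F (0, 1)).re, u, fun x s hx => ?_,
    fun x s hx => ?_⟩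
  · rw [← hF]; exact h1 _ hx
  · rw [← hF]; exact h2.trans (h3 _ hx)

/-- The graph of a function on the tracial states, as a subset of `A* × ℂ`. -/
def traceGraph (f : C(TracialState R, ℝ)) : Set (WeakDual ℂ R × ℂ) :=
  range fun τ : TracialState R => (τ.1, (f τ : ℂ))

theorem isCompact_traceGraph (f : C(TracialState R, ℝ)) : IsCompact (traceGraph f) :=
  isCompact_range (continuous_subtype_val.prodMk (Complex.continuous_ofReal.comp f.continuous))

theorem convex_traceGraph (f : AffT1 R) : Convex ℝ (traceGraph f.1) := by
  rintro _ ⟨σ, rfl⟩ _ ⟨τ, rfl⟩ s t hs ht hst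
  have ht' : (t : ℂ) = 1 - s := by
    rw [← Complex.ofReal_one, ← hst]; push_cast; ring
  have e : ∀ a, ((s • σ.1 + t • τ.1 : WeakDual ℂ R)) a = (s : ℂ) * σ.1 a + (1 - s : ℂ) * τ.1 a := by
    intro a
    change s • σ.1 a + t • τ.1 a = _
    rw [Complex.real_smul, Complex.real_smul, ht']
  let ρ : TracialState R := ⟨s • σ.1 + t • τ.1, by
    refine ⟨fun a => ?_, ?_, fun a b => ?_⟩
    · rw [e, ← ht']
      exact add_nonneg (mul_nonneg (Complex.zero_le_real.2 hs) (σ.2.1 a))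
        (mul_nonneg (Complex.zero_le_real.2 ht) (τ.2.1 a))
    · rw [e, σ.2.2.1, τ.2.2.1]; ring
    · rw [e, e, σ.2.2.2, τ.2.2.2]⟩
  refine ⟨ρ, Prod.ext rfl ?_⟩
  have h := f.2 ρ σ τ s hs (by linarith) e
  change ((f.1 ρ : ℝ) : ℂ) = s • (f.1 σ : ℂ) + t • (f.1 τ : ℂ)
  rw [h, Complex.real_smul, Complex.real_smul, ht']
  push_cast
  rfl

/-- The graphs of `f` and `f + ε` are disjoint compact convex sets. A hyperplane separating them is
itself the graph of an affine function caught between the two, and weak-* continuous functionals are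
evaluations at elements of `R`. -/
theorem exists_ev_near (f : AffT1 R) {ε : ℝ} (hε : 0 < ε) : ∃ a : R, ‖f - ev a‖ ≤ ε := by
  rcases isEmpty_or_nonempty (TracialState R) with hE | ⟨⟨τ₀⟩⟩
  · exact ⟨0, (ContinuousMap.norm_le _ hε.le).2 fun τ => hE.elim τ⟩
  let g : AffT1 R := f + ev (algebraMap ℝ R ε)
  have hev1 : ∀ (r : ℝ) (τ : TracialState R), (ev (algebraMap ℝ R r)).1 τ = r := by
    intro r τ
    rw [ev_apply, Algebra.algebraMap_eq_smul_one, ← Complex.coe_smul, map_smul, τ.2.2.1,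
      smul_eq_mul, mul_one, Complex.ofReal_re]
  have hg : ∀ τ, g.1 τ = f.1 τ + ε := fun τ => by
    change f.1 τ + (ev (algebraMap ℝ R ε)).1 τ = _
    rw [hev1]
  have hdisj : Disjoint (traceGraph f.1) (traceGraph g.1) := by
    rw [Set.disjoint_left]
    rintro _ ⟨σ, rfl⟩ ⟨τ, h⟩
    have h1 : τ = σ := Subtype.ext (congrArg Prod.fst h)
    have h2 : ((g.1 τ : ℝ) : ℂ) = (f.1 σ : ℝ) := congrArg Prod.snd h
    rw [h1, hg] at h2
    have := Complex.ofReal_injective h2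
    linarith
  obtain ⟨F, γ, u, h1, h3⟩ := exists_separating_prod locallyConvexSpace_weakDual (convex_traceGraph f)
    (isCompact_traceGraph f.1) (convex_traceGraph g) (isCompact_traceGraph g.1) hdisj
  obtain ⟨a, ha⟩ := LinearMap.dualEmbedding_surjective (topDualPairing ℂ R) F
  have ha' : ∀ τ : WeakDual ℂ R, F τ = τ a := fun τ => (DFunLike.congr_fun ha τ).symm
  have h1' : ∀ τ : TracialState R, (τ.1 a).re + f.1 τ * γ < u := fun τ => by
    rw [← ha']; exact h1 _ _ ⟨τ, rfl⟩
  have h3' : ∀ τ : TracialState R, u < (τ.1 a).re + (f.1 τ + ε) * γ := fun τ => by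
    rw [← hg, ← ha']; exact h3 _ _ ⟨τ, rfl⟩
  -- The hyperplane is not vertical, because the two graphs lie over the same points; a tracial
  -- state is needed to see this, and the empty case was settled separately.
  have hγ0 : 0 < γ := by
    have e1 := h1' τ₀
    have e2 := h3' τ₀
    have : 0 < ε * γ := by linarith
    exact pos_of_mul_pos_right this hε.le
  refine ⟨γ⁻¹ • (algebraMap ℝ R u - a), (ContinuousMap.norm_le _ hε.le).2 fun τ => ?_⟩
  have e : (ev (γ⁻¹ • (algebraMap ℝ R u - a))).1 τ = γ⁻¹ * (u - (τ.1 a).re) := by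
    rw [← evL_apply, map_smul, map_sub, evL_apply, evL_apply]
    change γ⁻¹ * ((ev (algebraMap ℝ R u)).1 τ - (ev a).1 τ) = _
    rw [hev1, ev_apply]
  change |f.1 τ - (ev _).1 τ| ≤ ε
  rw [e, abs_le]
  have e1 := h1' τ
  have e2 := h3' τ
  have e3 : γ⁻¹ * (u - (τ.1 a).re) = (u - (τ.1 a).re) / γ := by rw [div_eq_inv_mul]
  have e4 : f.1 τ ≤ (u - (τ.1 a).re) / γ := by rw [le_div_iff₀ hγ0]; linarith
  have e5 : (u - (τ.1 a).re) / γ ≤ f.1 τ + ε := by rw [div_le_iff₀ hγ0]; linarith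
  rw [e3]
  constructor <;> linarith

variable (R) in
/-- Every continuous affine function on the tracial states is the evaluation at a self-adjoint
element, with a bound on the norm. -/
theorem exists_selfAdjoint_ev :
    ∃ C : ℝ, 0 < C ∧ ∀ f : AffT1 R, ∃ h : selfAdjoint R, ev (h : R) = f ∧ ‖h‖ ≤ C * ‖f‖ := by
  let e : NormedAddGroupHom R (AffT1 R) :=
    { toFun := ev
      map_add' := fun a b => (evL : R →L[ℝ] AffT1 R).map_add a b
      bound' := ⟨1, fun a => by rw [one_mul]; exact norm_ev_le a⟩ }
  -- The quotient norm is at most `3‖ev x‖`; any larger constant leaves room for an actual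
  -- representative of that norm.
  have h4 : e.SurjectiveOnWith e.range 4 := by
    rintro _ ⟨x, rfl⟩
    change ∃ g, ev g = ev x ∧ ‖g‖ ≤ 4 * ‖ev x‖
    by_cases h0 : ev x = 0
    · refine ⟨0, ?_, ?_⟩
      · rw [h0]; exact (evL : R →L[ℝ] AffT1 R).map_zero
      · rw [norm_zero]
        have := norm_nonneg (ev x)
        linarith
    · have hp : 0 < ‖ev x‖ := norm_pos_iff.2 h0
      have hlt : ‖(Submodule.Quotient.mk x : R ⧸ traceKer R)‖ < 4 * ‖ev x‖ :=
        (norm_mk_traceKer_le x).trans_lt (by linarith)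
      obtain ⟨y, hy, hy'⟩ := QuotientAddGroup.norm_lt_iff.1 hlt
      refine ⟨y, ?_, hy'.le⟩
      have h5 : y - x ∈ traceKer R := (Submodule.Quotient.eq _).1 hy
      have h6 := ev_eq_zero_of_mem h5
      rw [← evL_apply, map_sub, sub_eq_zero] at h6
      exact h6
  -- Lifting with bounded norm passes from the range of `ev` to its closure, which is everything by
  -- `exists_ev_near`; the constant grows by one.
  have h5 := controlled_closure_of_complete (by norm_num : (0 : ℝ) < 4) one_pos h4
  refine ⟨4 + 1, by norm_num, fun f => ?_⟩
  have hf : f ∈ e.range.topologicalClosure := by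
    refine Metric.mem_closure_iff.2 fun ε hε => ?_
    obtain ⟨a, ha⟩ := exists_ev_near f (half_pos hε)
    refine ⟨ev a, ⟨a, rfl⟩, ?_⟩
    rw [dist_eq_norm]
    exact ha.trans_lt (half_lt_self hε)
  obtain ⟨a, ha, hb⟩ := h5 f hf
  refine ⟨realPart a, ?_, (realPart.norm_le a).trans hb⟩
  rw [realPart_apply_coe]
  have e1 : ev (star a) = ev a := ev_star a
  rw [← evL_apply, map_smul, map_add, evL_apply, evL_apply, e1, ← two_smul ℝ, smul_smul]
  norm_num
  exact ha

end EvSurjective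

/-! ### Exponentials of self-adjoint elements -/

section Exponential

variable {R S : Type*} [CStarAlgebra R] [CStarAlgebra S]

open NormedSpace in
/-- The exponential and homomorphisms that need not be unital. -/
theorem exp_map_of_mul (f : S →L[ℂ] R) (hf : ∀ x y, f (x * y) = f x * f y) (x : S) :
    exp (f x) = f (exp x) + (1 - f 1) := by
  have h1 := (exp_series_hasSum_exp' (𝕂 := ℂ) x).mapL f
  -- The two exponential series differ only in the term of order zero, which is `f(1)` on one side
  -- and `1` on the other.
  have h2 := h1.add (hasSum_ite_eq 0 (1 - f 1))
  refine (exp_series_hasSum_exp' (𝕂 := ℂ) (f x)).unique (h2.congr_fun fun k => ?_)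
  have hp : ∀ k : ℕ, f (x ^ (k + 1)) = f x ^ (k + 1) := by
    intro k
    induction k with
    | zero => simp
    | succ k ih => rw [pow_succ, hf, ih, ← pow_succ]
  cases k with
  | zero => simp
  | succ k => simp [hp]

/-- `exp(2πi h)`, for a self-adjoint element `h`. -/
def cexp (h : selfAdjoint R) : unitary R := selfAdjoint.expUnitary ((2 * Real.pi) • h)

theorem coe_cexp (h : selfAdjoint R) :
    (cexp h : R) = NormedSpace.exp ((2 * Real.pi * Complex.I : ℂ) • (h : R)) := by
  rw [cexp, selfAdjoint.expUnitary_coe, selfAdjoint.val_smul, ← Complex.coe_smul, smul_smul]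
  congr 2
  push_cast
  ring

theorem continuous_cexp : Continuous (cexp : selfAdjoint R → unitary R) :=
  selfAdjoint.continuous_expUnitary.comp (continuous_const_smul _)

theorem cexp_zero : cexp (0 : selfAdjoint R) = 1 := by
  rw [cexp, smul_zero, selfAdjoint.expUnitary_zero]

theorem cexp_add_of_commute {h k : selfAdjoint R} (hk : Commute (h : R) (k : R)) :
    cexp (h + k) = cexp h * cexp k := by
  rw [cexp, smul_add]
  exact Commute.expUnitary_add ((hk.smul_left _).smul_right _)

theorem cexp_nsmul (n : ℕ) (h : selfAdjoint R) : cexp (n • h) = cexp h ^ n := by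
  induction n with
  | zero => rw [zero_smul, cexp_zero, pow_zero]
  | succ n ih =>
    rw [succ_nsmul, cexp_add_of_commute (by
      rw [AddSubgroup.coe_nsmul]; exact (Commute.refl (h : R)).smul_left n), ih, pow_succ]

/-- The map `z ↦ zp` is multiplicative, so `exp(2πip) = e^{2πi}p + (1 - p)`. This is why `K₀` has to
be divided out of `Aff T₁(A)`. -/
theorem cexp_projection {p : selfAdjoint R} (hp : IsIdempotentElem (p : R)) : cexp p = 1 := by
  refine Subtype.ext ?_
  have h := exp_map_of_mul (ContinuousLinearMap.toSpanSingleton ℂ (p : R)) (fun x y => by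
    simp only [ContinuousLinearMap.toSpanSingleton_apply]
    rw [smul_mul_smul_comm, hp.eq]) (2 * Real.pi * Complex.I)
  simp only [ContinuousLinearMap.toSpanSingleton_apply, one_smul] at h
  rw [coe_cexp, h, ← Complex.exp_eq_exp_ℂ, Complex.exp_two_pi_mul_I, one_smul, add_sub_cancel]
  rfl

/-- The conjugate of a self-adjoint element by a unitary. -/
def saConj (u : unitary R) (h : selfAdjoint R) : selfAdjoint R :=
  ⟨u * h * star (u : R), h.2.conjugate (u : R)⟩

theorem cexp_saConj (u : unitary R) (h : selfAdjoint R) :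
    cexp (saConj u h) = u * cexp h * u⁻¹ := by
  refine Subtype.ext ?_
  rw [coe_cexp]
  let _ : NormedAlgebra ℚ R := NormedAlgebra.restrictScalars ℚ ℂ R
  have e := NormedSpace.exp_units_conj (Unitary.toUnits u)
    ((2 * Real.pi * Complex.I : ℂ) • (h : R))
  rw [← coe_cexp] at e
  refine Eq.trans ?_ e
  congr 1
  change _ = (u : R) * _ * star (u : R)
  rw [mul_smul_comm, smul_mul_assoc]
  rfl

theorem norm_unitary_pow_sub_le (a b : unitary R) (n : ℕ) :
    ‖((a ^ n : unitary R) : R) - ((b ^ n : unitary R) : R)‖ ≤ n * ‖(a : R) - b‖ := by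
  induction n with
  | zero => simp
  | succ n ih =>
    have e : ((a ^ (n + 1) : unitary R) : R) - ((b ^ (n + 1) : unitary R) : R) =
        (((a ^ n : unitary R) : R) - ((b ^ n : unitary R) : R)) * (a : R) +
          ((b ^ n : unitary R) : R) * ((a : R) - b) := by
      rw [pow_succ, pow_succ, Submonoid.coe_mul, Submonoid.coe_mul]
      noncomm_ring
    rw [e]
    refine (norm_add_le _ _).trans ?_
    rw [CStarRing.norm_mul_coe_unitary, CStarRing.norm_coe_unitary_mul]
    rw [Nat.cast_succ]
    linarith

/-- The Lie-Trotter product formula. -/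
theorem tendsto_cexp_mul_pow (h k : selfAdjoint R) :
    Filter.Tendsto (fun n : ℕ => (cexp (((n : ℝ) + 1)⁻¹ • h) * cexp (((n : ℝ) + 1)⁻¹ • k)) ^ (n + 1))
      Filter.atTop (𝓝 (cexp (h + k))) := by
  set x : R := (2 * Real.pi * Complex.I : ℂ) • (h : R) with hx
  set y : R := (2 * Real.pi * Complex.I : ℂ) • (k : R) with hy
  -- The error of one factor vanishes to first order at `0`, so `(n + 1)‖f(1/(n + 1))‖ → 0`; this
  -- bounds the error of the product because powers of unitaries differ by at most `n` times the
  -- difference of the bases.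
  let f : ℝ → R := fun s => NormedSpace.exp (s • x) * NormedSpace.exp (s • y) -
    NormedSpace.exp (s • (x + y))
  have hd : ∀ z : R, HasDerivAt (fun s : ℝ => NormedSpace.exp (s • z)) z 0 := fun z => by
    have := hasDerivAt_exp_smul_const (𝕂 := ℝ) z 0
    rwa [zero_smul, NormedSpace.exp_zero, one_mul] at this
  have hf : HasDerivAt f 0 0 := by
    have := ((hd x).mul (hd y)).sub (hd (x + y))
    simp only [zero_smul, NormedSpace.exp_zero, mul_one, one_mul, sub_self] at this
    exact this
  have hf0 : f 0 = 0 := by simp [f]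
  have hc : ∀ (s : ℝ) (l : selfAdjoint R),
      (cexp (s • l) : R) = NormedSpace.exp (s • ((2 * Real.pi * Complex.I : ℂ) • (l : R))) := by
    intro s l
    rw [coe_cexp, selfAdjoint.val_smul, smul_comm]
  have hfs : ∀ s : ℝ, ((cexp (s • h) * cexp (s • k) : unitary R) : R) - (cexp (s • (h + k)) : R) =
      f s := by
    intro s
    rw [Submonoid.coe_mul, hc, hc, hc, AddSubgroup.coe_add, smul_add (2 * Real.pi * Complex.I : ℂ)]
  have hs : Filter.Tendsto (fun n : ℕ => ((n : ℝ) + 1)⁻¹) Filter.atTop (𝓝[≠] 0) := by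
    refine tendsto_nhdsWithin_iff.2 ⟨?_, Filter.Eventually.of_forall fun n => ?_⟩
    · simpa [one_div] using tendsto_one_div_add_atTop_nhds_zero_nat (𝕜 := ℝ)
    · have : (0 : ℝ) < (n : ℝ) + 1 := by positivity
      exact (inv_pos.2 this).ne'
  have hl := ((hasDerivAt_iff_tendsto_slope_zero.1 hf).comp hs).norm
  rw [norm_zero] at hl
  refine tendsto_subtype_rng.2 (tendsto_iff_norm_sub_tendsto_zero.2 ?_)
  refine squeeze_zero (fun _ => norm_nonneg _) (fun n => ?_) hl
  have hn : (0 : ℝ) < (n : ℝ) + 1 := by positivity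
  have e1 : cexp (h + k) = cexp (((n : ℝ) + 1)⁻¹ • (h + k)) ^ (n + 1) := by
    rw [← cexp_nsmul]
    congr 1
    rw [← Nat.cast_smul_eq_nsmul ℝ, smul_smul]
    push_cast
    rw [mul_inv_cancel₀ hn.ne', one_smul]
  rw [e1]
  refine (norm_unitary_pow_sub_le _ _ _).trans (le_of_eq ?_)
  rw [hfs, Function.comp_apply, zero_add, hf0, sub_zero, inv_inv, norm_smul, Real.norm_of_nonneg hn.le]
  push_cast
  rfl

end Exponential

/-! ### Classes of exponentials in the Hausdorffized algebraic `K₁`-group -/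

section ExpClass

variable {A : Type*} [CStarAlgebra A] {n m : ℕ}

theorem toK1bar_mul (x y : UInf A) : toK1bar (x * y) = toK1bar x + toK1bar y := rfl

theorem toK1bar_inv (x : UInf A) : toK1bar x⁻¹ = -toK1bar x := rfl

theorem toK1bar_one : toK1bar (1 : UInf A) = 0 := rfl

theorem toK1bar_eq_zero {x : UInf A} : toK1bar x = 0 ↔ x ∈ closureDU A :=
  QuotientGroup.eq_one_iff x

theorem toK1bar_eq_iff {x y : UInf A} : toK1bar x = toK1bar y ↔ x * y⁻¹ ∈ closureDU A := by
  rw [← toK1bar_eq_zero, toK1bar_mul, toK1bar_inv, ← sub_eq_add_neg, sub_eq_zero]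

theorem toK1bar_conj (x y : UInf A) : toK1bar (x * y * x⁻¹) = toK1bar y := by
  rw [toK1bar_mul, toK1bar_mul, toK1bar_inv, add_comm (toK1bar x), add_neg_cancel_right]

theorem isClosed_closureDU : IsClosed (closureDU A : Set (UInf A)) := isClosed_closure

/-- The class of `exp(2πi h)`. -/
def expClass (h : Sn A n) : K1bar A := toK1bar (UInf.of n (uexp h))

theorem uexp_eq_cexp (h : Sn A n) : uexp h = cexp h := rfl

theorem continuous_uexp : Continuous (uexp : Sn A n → Un A n) := continuous_cexp

/-- In an abelian quotient `(exp(h/N) exp(k/N))^N` has the class of `exp(h) exp(k)` (up to the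
factors `2πi`). It converges to `exp(h + k)` by Lie–Trotter, and `closureDU A` is closed. -/
theorem expClass_add (h k : Sn A n) : expClass (h + k) = expClass h + expClass k := by
  let a : ℕ → Un A n := fun N => (uexp (((N : ℝ) + 1)⁻¹ • h) * uexp (((N : ℝ) + 1)⁻¹ • k)) ^ (N + 1)
  have hlim : Filter.Tendsto a Filter.atTop (𝓝 (uexp (h + k))) := tendsto_cexp_mul_pow h k
  have hpow : ∀ (N : ℕ) (l : Sn A n), uexp (((N : ℝ) + 1)⁻¹ • l) ^ (N + 1) = uexp l := by
    intro N l
    rw [uexp_eq_cexp, ← cexp_nsmul, uexp_eq_cexp]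
    congr 1
    have hn : (0 : ℝ) < (N : ℝ) + 1 := by positivity
    rw [← Nat.cast_smul_eq_nsmul ℝ, smul_smul]
    push_cast
    rw [mul_inv_cancel₀ hn.ne', one_smul]
  have hmem : ∀ N, UInf.of n (uexp h * uexp k * (a N)⁻¹) ∈ closureDU A := by
    intro N
    rw [map_mul, map_inv, ← toK1bar_eq_iff]
    have hn : ∀ (y : UInf A) (j : ℕ), toK1bar (y ^ j) = j • toK1bar y := by
      intro y j
      induction j with
      | zero => rw [pow_zero, zero_smul, toK1bar_one]
      | succ j ih => rw [pow_succ, toK1bar_mul, ih, succ_nsmul]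
    simp only [a]
    rw [map_pow, hn, map_mul, map_mul, toK1bar_mul, toK1bar_mul, nsmul_add, ← hn, ← hn, ← map_pow,
      ← map_pow, hpow, hpow]
  have hlim' : Filter.Tendsto (fun N => UInf.of n (uexp h * uexp k * (a N)⁻¹)) Filter.atTop
      (𝓝 (UInf.of n (uexp h * uexp k * (uexp (h + k))⁻¹))) :=
    ((UInf.continuous_of n).tendsto _).comp (tendsto_const_nhds.mul hlim.inv)
  have := isClosed_closureDU.mem_of_tendsto hlim' (Filter.Eventually.of_forall hmem)
  rw [map_mul, map_inv] at this
  have := (toK1bar_eq_iff.2 this).symm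
  rwa [map_mul, toK1bar_mul] at this

theorem expClass_zero : expClass (0 : Sn A n) = 0 := by
  rw [expClass, uexp_eq_cexp, cexp_zero, map_one, toK1bar_one]

variable (A n) in
/-- The class of `exp(2πi h)`, as a homomorphism. -/
def expHom : Sn A n →+ K1bar A where
  toFun := expClass
  map_zero' := expClass_zero
  map_add' := expClass_add

theorem expHom_apply (h : Sn A n) : expHom A n h = toK1bar (UInf.of n (uexp h)) := rfl

theorem isClosed_ker_expHom : IsClosed {h : Sn A n | expHom A n h = 0} := by
  have e : {h : Sn A n | expHom A n h = 0} =
      (fun h => UInf.of n (uexp h)) ⁻¹' (closureDU A : Set (UInf A)) := by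
    ext h
    exact toK1bar_eq_zero
  rw [e]
  exact isClosed_closureDU.preimage ((UInf.continuous_of n).comp continuous_uexp)

theorem expHom_saConj (u : Un A n) (h : Sn A n) : expHom A n (saConj u h) = expHom A n h := by
  rw [expHom_apply, uexp_eq_cexp, cexp_saConj, map_mul, map_mul, map_inv, toK1bar_conj]
  rfl

/-- It is enough to test the generators of `traceKer`: conjugation by a unitary does not change the
class of an exponential, and `x - x*` has real part zero. -/
theorem expHom_realPart_eq_zero {x : CStarMatrix (Fin n) (Fin n) A} (hx : x ∈ traceKer _) :
    expHom A n (realPart x) = 0 := by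
  let P : CStarMatrix (Fin n) (Fin n) A →L[ℝ] Sn A n :=
    LinearMap.mkContinuous realPart 1 fun x => by rw [one_mul]; exact realPart.norm_le x
  have hP : ∀ x, P x = realPart x := fun x => rfl
  -- The kernel of `expHom` is only a closed subgroup; asking for all real multiples turns it into a
  -- closed real subspace.
  let S : Submodule ℝ (CStarMatrix (Fin n) (Fin n) A) :=
    { carrier := {x | ∀ t : ℝ, expHom A n (P (t • x)) = 0}
      zero_mem' := fun t => by rw [smul_zero, map_zero, map_zero]
      add_mem' := fun {x y} hx hy t => by rw [smul_add, map_add, map_add, hx, hy, add_zero]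
      smul_mem' := fun c x hx t => by rw [smul_smul]; exact hx _ }
  have hS : IsClosed (S : Set (CStarMatrix (Fin n) (Fin n) A)) := by
    have e : (S : Set (CStarMatrix (Fin n) (Fin n) A)) =
        ⋂ t : ℝ, (fun x => P (t • x)) ⁻¹' {h : Sn A n | expHom A n h = 0} := by
      ext x
      rw [mem_iInter]
      rfl
    rw [e]
    exact isClosed_iInter fun t => isClosed_ker_expHom.preimage
      (P.continuous.comp (continuous_const_smul t))
  have hle : traceKer _ ≤ S := by
    refine traceKer_le hS (fun u x t => ?_) fun x t => ?_
    · have e : ∀ z, P (u * z * star (u : CStarMatrix (Fin n) (Fin n) A)) = saConj u (P z) := by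
        intro z
        refine Subtype.ext ?_
        change _ = (u : CStarMatrix (Fin n) (Fin n) A) * (realPart z : CStarMatrix (Fin n) (Fin n) A) * _
        rw [hP, realPart_apply_coe, realPart_apply_coe, star_mul, star_mul, star_star,
          mul_smul_comm, smul_mul_assoc, mul_add, add_mul, mul_assoc _ (star z)]
      have e2 : t • (u * x * star (u : CStarMatrix (Fin n) (Fin n) A)) =
          u * (t • x) * star (u : CStarMatrix (Fin n) (Fin n) A) := by
        rw [mul_smul_comm, smul_mul_assoc]
      rw [smul_sub, map_sub, map_sub, e2, e, expHom_saConj, sub_self]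
    · have e : P (t • (x - star x)) = 0 := by
        rw [map_smul]
        refine (congrArg (t • ·) (?_ : P (x - star x) = 0)).trans (smul_zero t)
        refine Subtype.ext ?_
        rw [hP, realPart_apply_coe, star_sub, star_star, sub_add_sub_cancel, sub_self]
        exact smul_zero _
      rw [e, map_zero]
  have := hle hx 1
  rwa [one_smul] at this

theorem singleL_mul_singleL (i j k l : Fin n) (a b : A) :
    singleL i j a * singleL k l b = if j = k then singleL i l (a * b) else 0 := by
  refine CStarMatrix.ext fun p q => ?_
  rw [CStarMatrix.mul_apply]
  simp only [singleL_apply]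
  rw [Finset.sum_eq_single j (by intro b _ hb; simp [hb]) (by simp)]
  by_cases hjk : j = k
  · subst hjk
    by_cases hp : p = i <;> by_cases hq : q = l <;> simp [singleL_apply, hp, hq]
  · simp [hjk]

theorem star_singleL (i j : Fin n) (a : A) : star (singleL i j a) = singleL j i (star a) := by
  refine CStarMatrix.ext fun p q => ?_
  rw [CStarMatrix.star_apply, singleL_apply, singleL_apply]
  by_cases hp : p = j <;> by_cases hq : q = i <;> simp [hp, hq]

/-- A tracial state of a matrix algebra vanishes at matrices whose trace vanishes. -/
theorem ev_eq_zero_of_trL {x : CStarMatrix (Fin n) (Fin n) A} (hx : trL A (Fin n) x = 0) :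
    ev x = 0 := by
  rcases Nat.eq_zero_or_pos n with rfl | hn
  · have : x = 0 := CStarMatrix.ext fun i => i.elim0
    rw [this, ← evL_apply, map_zero]
  let o : Fin n := ⟨0, hn⟩
  refine Subtype.ext (ContinuousMap.ext fun τ => ?_)
  rw [ev_apply]
  change _ = (0 : ℝ)
  -- The restriction of `τ` to a diagonal corner is a positive trace on `A`, not normalized.
  -- Conjugation by matrix units gives `τ(x) = ∑ τ(e_oo ⊗ x_ii)`, so `τ(x)` is controlled by the
  -- trace of `x`.
  let F : A →L[ℝ] ℝ := Complex.reCLM.comp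
    (((WeakDual.toStrongDual τ.1).comp (singleL o o)).restrictScalars ℝ)
  have hF : ∀ a, F a = (τ.1 (singleL o o a)).re := fun a => rfl
  have hsingle : ∀ i j a, τ.1 (singleL i j a) = if i = j then τ.1 (singleL o o a) else 0 := by
    intro i j a
    have h1 : singleL i j a = singleL i o 1 * singleL o j a := by
      rw [singleL_mul_singleL, if_pos rfl, one_mul]
    rw [h1, τ.2.2.2, singleL_mul_singleL, mul_one]
    by_cases hij : i = j
    · rw [if_pos hij, if_pos hij.symm]
    · rw [if_neg hij, if_neg (Ne.symm hij), map_zero]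
  have htr : ∀ a b, F (a * b) = F (b * a) := by
    intro a b
    have h1 : ∀ a b : A, singleL o o (a * b) = singleL o o a * singleL o o b := fun a b => by
      rw [singleL_mul_singleL, if_pos rfl]
    rw [hF, hF, h1, τ.2.2.2, ← h1]
  have key : (τ.1 x).re = F (∑ i, x i i) := by
    conv_lhs => rw [sum_singleL x]
    rw [hF, map_sum, map_sum, map_sum, Complex.re_sum, Complex.re_sum]
    refine Finset.sum_congr rfl fun i _ => ?_
    rw [map_sum, Finset.sum_eq_single i (by intro j _ hj; rw [hsingle, if_neg (Ne.symm hj)])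
      (by simp), hsingle, if_pos rfl]
  have hb := abs_le_of_positive_trace F
    (fun u y => by
      rw [htr, ← mul_assoc, Unitary.star_mul_self_of_mem u.2, one_mul])
    (fun y => by
      have h1 := congrArg (fun f : AffT1 _ => f.1 τ) (ev_star (singleL o o y))
      simp only [ev_apply, star_singleL] at h1
      exact h1)
    (fun a => by
      have h1 := τ.2.1 (singleL o o a)
      rw [star_singleL, singleL_mul_singleL, if_pos rfl] at h1
      exact (Complex.nonneg_iff.1 h1).1) (∑ i, x i i)
  rw [trL_apply] at hx
  have h0 : ‖ev (∑ i, x i i)‖ = 0 := by rw [hx]; exact norm_zero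
  rw [h0, mul_zero] at hb
  rw [key]
  exact abs_nonpos_iff.1 hb

theorem expHom_eq_zero_of_trL {h : Sn A n}
    (hh : trL A (Fin n) (h : CStarMatrix (Fin n) (Fin n) A) = 0) : expHom A n h = 0 := by
  have := expHom_realPart_eq_zero (mem_traceKer_iff.2 (ev_eq_zero_of_trL hh))
  rwa [show realPart (h : CStarMatrix (Fin n) (Fin n) A) = h from
    Subtype.ext h.2.coe_realPart] at this

end ExpClass

/-! ### The homomorphism `H(A) → U^∞(A) / closure (DU^∞(A))` -/

section Inclusion

variable {A : Type*} [CStarAlgebra A] {n m : ℕ}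

/-- The matrix `diag(x, 0)`. -/
def padZero (n m : ℕ) : CStarMatrix (Fin n) (Fin n) A →L[ℂ] CStarMatrix (Fin m) (Fin m) A where
  toFun x := CStarMatrix.ofMatrix fun i j =>
    if h : (i : ℕ) < n ∧ (j : ℕ) < n then x ⟨i, h.1⟩ ⟨j, h.2⟩ else 0
  map_add' x y := CStarMatrix.ext fun i j => by
    change (if h : (i : ℕ) < n ∧ (j : ℕ) < n then (x + y) ⟨i, h.1⟩ ⟨j, h.2⟩ else 0) =
      (if h : (i : ℕ) < n ∧ (j : ℕ) < n then x ⟨i, h.1⟩ ⟨j, h.2⟩ else 0) +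
      (if h : (i : ℕ) < n ∧ (j : ℕ) < n then y ⟨i, h.1⟩ ⟨j, h.2⟩ else 0)
    split_ifs
    · rfl
    · rw [add_zero]
  map_smul' c x := CStarMatrix.ext fun i j => by
    change (if h : (i : ℕ) < n ∧ (j : ℕ) < n then (c • x) ⟨i, h.1⟩ ⟨j, h.2⟩ else 0) =
      c • (if h : (i : ℕ) < n ∧ (j : ℕ) < n then x ⟨i, h.1⟩ ⟨j, h.2⟩ else 0)
    split_ifs
    · rfl
    · rw [smul_zero]
  cont := by
    refine continuous_pi fun i => continuous_pi fun j => ?_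
    change Continuous fun x : CStarMatrix (Fin n) (Fin n) A =>
      if h : (i : ℕ) < n ∧ (j : ℕ) < n then x ⟨i, h.1⟩ ⟨j, h.2⟩ else 0
    split_ifs with h
    · exact (entryL (⟨i, h.1⟩ : Fin n) ⟨j, h.2⟩).continuous
    · exact continuous_const

theorem padZero_apply (x : CStarMatrix (Fin n) (Fin n) A) (i j : Fin m) :
    padZero n m x i j = if h : (i : ℕ) < n ∧ (j : ℕ) < n then x ⟨i, h.1⟩ ⟨j, h.2⟩ else 0 := rfl

theorem padZero_mul (h : n ≤ m) (x y : CStarMatrix (Fin n) (Fin n) A) :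
    padZero n m (x * y) = padZero n m x * padZero n m y := by
  obtain ⟨k, rfl⟩ := Nat.exists_eq_add_of_le h
  refine CStarMatrix.ext fun i j => ?_
  rw [CStarMatrix.mul_apply, Fin.sum_univ_add]
  simp only [padZero_apply]
  by_cases hi : (i : ℕ) < n <;> by_cases hj : (j : ℕ) < n <;> simp [hi, hj, CStarMatrix.mul_apply]

theorem padZero_star (x : CStarMatrix (Fin n) (Fin n) A) :
    padZero n m (star x) = star (padZero n m x) := by
  refine CStarMatrix.ext fun i j => ?_
  rw [CStarMatrix.star_apply, padZero_apply, padZero_apply]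
  by_cases h : (i : ℕ) < n ∧ (j : ℕ) < n
  · rw [dif_pos h, dif_pos h.symm, CStarMatrix.star_apply]
  · rw [dif_neg h, dif_neg fun h' => h h'.symm, star_zero]

theorem padMat_eq_padZero (x : CStarMatrix (Fin n) (Fin n) A) :
    padMat n m x = padZero n m x + (1 - padZero n m 1) := by
  refine CStarMatrix.ext fun i j => ?_
  change padMat n m x i j = padZero n m x i j +
    ((1 : CStarMatrix (Fin m) (Fin m) A) i j - padZero n m 1 i j)
  rw [padMat_apply, padZero_apply, padZero_apply]
  by_cases h : (i : ℕ) < n ∧ (j : ℕ) < n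
  · rw [dif_pos h, dif_pos h, dif_pos h, CStarMatrix.one_apply, CStarMatrix.one_apply]
    simp [Fin.ext_iff]
  · rw [dif_neg h, dif_neg h, dif_neg h, CStarMatrix.one_apply, zero_add, sub_zero]

theorem trL_padZero (h : n ≤ m) (x : CStarMatrix (Fin n) (Fin n) A) :
    trL A (Fin m) (padZero n m x) = trL A (Fin n) x := by
  obtain ⟨k, rfl⟩ := Nat.exists_eq_add_of_le h
  rw [trL_apply, trL_apply, Fin.sum_univ_add]
  congr 1
  simp [padZero_apply]

/-- The self-adjoint matrix `diag(h, 0)`. -/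
def saPad (m : ℕ) (h : Sn A n) : Sn A m :=
  ⟨padZero n m h, by
    rw [selfAdjoint.mem_iff, ← padZero_star, h.2.star_eq]⟩

theorem uexp_saPad (hnm : n ≤ m) (h : Sn A n) : uexp (saPad m h) = pad n m hnm (uexp h) := by
  refine Subtype.ext ?_
  change _ = padMat n m (uexp h : CStarMatrix (Fin n) (Fin n) A)
  rw [uexp_eq_cexp, uexp_eq_cexp, coe_cexp, coe_cexp, padMat_eq_padZero,
    ← exp_map_of_mul _ (padZero_mul hnm), map_smul]
  rfl

theorem expHom_saPad (hnm : n ≤ m) (h : Sn A n) : expHom A m (saPad m h) = expHom A n h := by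
  rw [expHom_apply, uexp_saPad hnm, UInf.of_pad, expHom_apply]

/-- The class of `exp(2πi h)` only depends on the trace of `h`. -/
theorem expHom_congr {h : Sn A n} {k : Sn A m}
    (e : trL A (Fin n) (h : CStarMatrix (Fin n) (Fin n) A) =
      trL A (Fin m) (k : CStarMatrix (Fin m) (Fin m) A)) : expHom A n h = expHom A m k := by
  rw [← expHom_saPad (le_max_left n m) h, ← expHom_saPad (le_max_right n m) k, ← sub_eq_zero,
    ← map_sub]
  refine expHom_eq_zero_of_trL ?_
  rw [AddSubgroup.coe_sub, map_sub]
  change trL A _ (padZero _ _ _) - trL A _ (padZero _ _ _) = 0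
  rw [trL_padZero (le_max_left n m), trL_padZero (le_max_right n m), e, sub_self]

/-- A self-adjoint element, as a matrix of size one. -/
def saOne (h : selfAdjoint A) : Sn A 1 :=
  ⟨singleL 0 0 (h : A), by rw [selfAdjoint.mem_iff, star_singleL, h.2.star_eq]⟩

theorem continuous_saOne : Continuous (saOne : selfAdjoint A → Sn A 1) :=
  ((singleL (0 : Fin 1) 0).continuous.comp continuous_subtype_val).subtype_mk _

theorem trL_saOne (h : selfAdjoint A) :
    trL A (Fin 1) (saOne h : CStarMatrix (Fin 1) (Fin 1) A) = ev (h : A) := by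
  rw [trL_apply]
  change ev (∑ i, singleL 0 0 (h : A) i i) = _
  rw [Fin.sum_univ_one, singleL_apply, if_pos ⟨rfl, rfl⟩]

theorem exists_ev_eq (f : AffT1 A) : ∃ h : selfAdjoint A, ev (h : A) = f := by
  obtain ⟨_, _, hC⟩ := exists_selfAdjoint_ev A
  obtain ⟨h, hh, _⟩ := hC f
  exact ⟨h, hh⟩

variable (A) in
/-- The homomorphism `Aff T₁(A) → U^∞(A) / closure (DU^∞(A))` that sends the trace of a self-adjoint
matrix `h` to the class of `exp(2πi h)`. -/
def affHom : AffT1 A →+ K1bar A where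
  -- By `expHom_congr` the choice of the self-adjoint element is immaterial, which is also why the
  -- map is additive.
  toFun f := expHom A 1 (saOne (exists_ev_eq f).choose)
  map_zero' := by
    refine expHom_eq_zero_of_trL ?_
    rw [trL_saOne, (exists_ev_eq 0).choose_spec]
  map_add' f g := by
    rw [← map_add]
    refine expHom_congr ?_
    rw [AddSubgroup.coe_add, map_add, trL_saOne, trL_saOne, trL_saOne, (exists_ev_eq _).choose_spec,
      (exists_ev_eq _).choose_spec, (exists_ev_eq _).choose_spec]

theorem affHom_trL (h : Sn A n) :
    affHom A (trL A (Fin n) (h : CStarMatrix (Fin n) (Fin n) A)) = expHom A n h := by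
  refine expHom_congr ?_
  rw [trL_saOne, (exists_ev_eq _).choose_spec]

theorem affHom_ev (h : selfAdjoint A) : affHom A (ev (h : A)) = expHom A 1 (saOne h) := by
  rw [← trL_saOne, affHom_trL]

theorem affHom_of_mem_imageK0 {f : AffT1 A} (hf : f ∈ imageK0 A) : affHom A f = 0 := by
  have h : imageK0 A ≤ (affHom A).ker := by
    refine (AddSubgroup.closure_le _).2 ?_
    rintro _ ⟨n, p, hp, rfl⟩
    change affHom A (trL A (Fin n) p) = 0
    have e := affHom_trL (⟨p, hp.isSelfAdjoint⟩ : Sn A n)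
    rw [expHom_apply, uexp_eq_cexp, cexp_projection hp.isIdempotentElem, map_one] at e
    exact e
  exact h hf

/-- Write `f = ev h` and let `g` in the image of `K₀` be close to `f`. The difference lifts to a
small `k`, so `h` is a limit of elements `h - k` whose exponentials have trivial class. The norm
bound on lifts is essential here. -/
theorem affHom_of_mem_closure {f : AffT1 A} (hf : f ∈ (imageK0 A).topologicalClosure) :
    affHom A f = 0 := by
  obtain ⟨C, hC, hb⟩ := exists_selfAdjoint_ev A
  obtain ⟨h, rfl⟩ := exists_ev_eq f
  rw [affHom_ev]
  have hcl : IsClosed {k : selfAdjoint A | expHom A 1 (saOne k) = 0} :=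
    isClosed_ker_expHom.preimage continuous_saOne
  refine hcl.closure_subset_iff.2 subset_rfl (Metric.mem_closure_iff.2 fun ε hε => ?_)
  obtain ⟨g, hg, hd⟩ := Metric.mem_closure_iff.1 hf (ε / C) (by positivity)
  obtain ⟨k, hk, hkn⟩ := hb (ev (h : A) - g)
  refine ⟨h - k, ?_, ?_⟩
  · change expHom A 1 (saOne (h - k)) = 0
    rw [← affHom_ev, AddSubgroup.coe_sub]
    have e : ev ((h : A) - k) = g := by
      rw [← evL_apply, map_sub, evL_apply, evL_apply, hk, sub_sub_cancel]
    rw [e, affHom_of_mem_imageK0 hg]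
  · rw [dist_eq_norm, sub_sub_cancel]
    have hd' : ‖ev (h : A) - g‖ < ε / C := by
      have := dist_eq_norm (ev (h : A)) g
      rw [← this]; exact hd
    calc ‖k‖ ≤ C * ‖ev (h : A) - g‖ := hkn
      _ < C * (ε / C) := by gcongr
      _ = ε := by field_simp

variable (A) in
/-- The homomorphism of the Nielsen-Thomsen sequence. -/
def inclusion : H A →+ K1bar A :=
  QuotientAddGroup.lift _ (affHom A) fun _ hf => affHom_of_mem_closure hf

theorem inclusion_toH (f : AffT1 A) : inclusion A (toH f) = affHom A f := rfl

/-- Both sides are homomorphisms on `UInf0 A`, which is generated by exponentials, and on an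
exponential the identity is the definition of `affHom`. -/
theorem isInclusion_inclusion : IsInclusion (inclusion A) := by
  rintro _ ⟨n, u, hu, rfl⟩
  obtain ⟨l, rfl⟩ := exists_list_uexp hu
  clear hu
  have hmem : ∀ h : Sn A n, UInf.of n (uexp h) ∈ UInf0 A := fun h => ⟨n, _, joined_one_uexp h, rfl⟩
  suffices hs : UInf.of n (l.map uexp).prod ∈ UInf0 A ∧
      inclusion A (detBar (UInf.of n (l.map uexp).prod)) = toK1bar (UInf.of n (l.map uexp).prod) from
    hs.2
  induction l with
  | nil => rw [List.map_nil, List.prod_nil, map_one, detBar_one, map_zero]; exact ⟨one_mem _, rfl⟩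
  | cons h l ih =>
    rw [List.map_cons, List.prod_cons, map_mul]
    refine ⟨mul_mem (hmem h) ih.1, ?_⟩
    rw [detBar_mul (hmem h) ih.1, map_add, ih.2, toK1bar_mul, (isDetBar_uexp h).detBar_eq,
      inclusion_toH, affHom_trL, expHom_apply]

/-- The determinant of `exp(2πih)` is the class of `ev_h`, and every affine function is of this
form. Surjectivity of the determinant makes the defining property of `i` determine it uniquely. -/
theorem exists_detBar_eq (y : H A) : ∃ x ∈ UInf0 A, detBar x = y := by
  obtain ⟨f, rfl⟩ := QuotientAddGroup.mk_surjective y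
  obtain ⟨h, rfl⟩ := exists_ev_eq f
  refine ⟨UInf.of 1 (uexp (saOne h)), ⟨1, _, joined_one_uexp _, rfl⟩, ?_⟩
  rw [(isDetBar_uexp _).detBar_eq, trL_saOne]
  rfl

theorem isInclusion_iff {i : H A →+ K1bar A} : IsInclusion i ↔ i = inclusion A := by
  refine ⟨fun hi => AddMonoidHom.ext fun y => ?_, fun h => h ▸ isInclusion_inclusion⟩
  obtain ⟨x, hx, rfl⟩ := exists_detBar_eq y
  rw [hi x hx, isInclusion_inclusion x hx]

end Inclusion

/-! ### Permutation matrices -/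

section Perm

variable {A : Type*} [CStarAlgebra A] {n m : ℕ}

/-- The matrix of a permutation. -/
def permMat (σ : Equiv.Perm (Fin n)) : CStarMatrix (Fin n) (Fin n) A :=
  CStarMatrix.ofMatrix fun i j => if i = σ j then 1 else 0

theorem permMat_apply (σ : Equiv.Perm (Fin n)) (i j : Fin n) :
    (permMat σ : CStarMatrix (Fin n) (Fin n) A) i j = if i = σ j then 1 else 0 := rfl

theorem permMat_mul_apply (σ : Equiv.Perm (Fin n)) (x : CStarMatrix (Fin n) (Fin n) A)
    (i j : Fin n) : (permMat σ * x : CStarMatrix (Fin n) (Fin n) A) i j = x (σ⁻¹ i) j := by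
  rw [CStarMatrix.mul_apply, Finset.sum_eq_single (σ⁻¹ i)]
  · simp [permMat_apply]
  · intro b _ hb
    rw [permMat_apply, if_neg, zero_mul]
    rintro rfl
    simp at hb
  · simp

theorem mul_permMat_apply (σ : Equiv.Perm (Fin n)) (x : CStarMatrix (Fin n) (Fin n) A)
    (i j : Fin n) : (x * permMat σ : CStarMatrix (Fin n) (Fin n) A) i j = x i (σ j) := by
  rw [CStarMatrix.mul_apply, Finset.sum_eq_single (σ j)]
  · simp [permMat_apply]
  · intro b _ hb
    rw [permMat_apply, if_neg hb, mul_zero]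
  · simp

theorem permMat_mul (σ τ : Equiv.Perm (Fin n)) :
    (permMat (σ * τ) : CStarMatrix (Fin n) (Fin n) A) = permMat σ * permMat τ :=
  CStarMatrix.ext fun i j => by
    rw [mul_permMat_apply, permMat_apply, permMat_apply]
    rfl

theorem permMat_one : (permMat 1 : CStarMatrix (Fin n) (Fin n) A) = 1 :=
  CStarMatrix.ext fun i j => by
    rw [permMat_apply, CStarMatrix.one_apply]
    rfl

theorem star_permMat (σ : Equiv.Perm (Fin n)) :
    star (permMat σ : CStarMatrix (Fin n) (Fin n) A) = permMat σ⁻¹ :=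
  CStarMatrix.ext fun i j => by
    rw [CStarMatrix.star_apply, permMat_apply, permMat_apply]
    have : j = σ i ↔ i = σ⁻¹ j := by
      rw [Equiv.Perm.eq_inv_iff_eq]; exact eq_comm
    by_cases h : j = σ i
    · rw [if_pos h, if_pos (this.1 h), star_one]
    · rw [if_neg h, if_neg fun h' => h (this.2 h'), star_zero]

variable (A) in
/-- The unitary matrix of a permutation. -/
def permUn (n : ℕ) : Equiv.Perm (Fin n) →* Un A n where
  toFun σ := ⟨permMat σ, by
    rw [Unitary.mem_iff, star_permMat, ← permMat_mul, ← permMat_mul, inv_mul_cancel, mul_inv_cancel,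
      permMat_one]
    exact ⟨rfl, rfl⟩⟩
  map_one' := Subtype.ext permMat_one
  map_mul' σ τ := Subtype.ext (permMat_mul σ τ)

/-- A unitary involution is the exponential of a self-adjoint element. -/
theorem exists_cexp_of_involution {R : Type*} [CStarAlgebra R] (w : unitary R) (hw : w * w = 1) :
    ∃ h, w = cexp h := by
  have hs : star (w : R) = w := by
    have : w⁻¹ = w := inv_eq_of_mul_eq_one_left hw
    rw [← Unitary.star_eq_inv] at this
    exact congrArg Subtype.val this
  have hww : (w : R) * w = 1 := congrArg Subtype.val hw
  -- For the projection `p = (1 - w)/2` one has `w = exp(πip)`, so `h = p/2`.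
  have hp : IsIdempotentElem ((2⁻¹ : ℂ) • (1 - (w : R))) := by
    change (2⁻¹ : ℂ) • (1 - (w : R)) * (2⁻¹ : ℂ) • (1 - (w : R)) = _
    rw [smul_mul_smul_comm]
    have : (1 - (w : R)) * (1 - w) = (2 : ℂ) • (1 - (w : R)) := by
      simp only [sub_mul, mul_sub, hww, mul_one, one_mul, two_smul]
      abel
    rw [this, smul_smul]
    norm_num
  have hsa : IsSelfAdjoint ((2⁻¹ : ℂ) • (2⁻¹ : ℂ) • (1 - (w : R))) := by
    rw [IsSelfAdjoint, star_smul, star_smul, star_sub, star_one, hs]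
    simp
  refine ⟨⟨_, hsa⟩, Subtype.ext ?_⟩
  have h := exp_map_of_mul (ContinuousLinearMap.toSpanSingleton ℂ ((2⁻¹ : ℂ) • (1 - (w : R))))
    (fun x y => by
      simp only [ContinuousLinearMap.toSpanSingleton_apply]
      rw [smul_mul_smul_comm, hp.eq]) (Real.pi * Complex.I)
  simp only [ContinuousLinearMap.toSpanSingleton_apply, one_smul] at h
  rw [coe_cexp]
  have e : (2 * Real.pi * Complex.I : ℂ) • (2⁻¹ : ℂ) • (2⁻¹ : ℂ) • (1 - (w : R)) =
      (Real.pi * Complex.I : ℂ) • (2⁻¹ : ℂ) • (1 - (w : R)) := by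
    rw [smul_smul (2 * Real.pi * Complex.I : ℂ)]
    congr 1
    ring
  rw [e, h, ← Complex.exp_eq_exp_ℂ, Complex.exp_pi_mul_I, neg_smul, one_smul]
  have : (2⁻¹ : ℂ) • (1 - (w : R)) + (2⁻¹ : ℂ) • (1 - (w : R)) = 1 - w := by
    rw [← add_smul]; norm_num
  have key : ∀ a b : R, b = 1 - (a + a) → b = -a + (1 - a) := fun a b h => by rw [h]; abel
  exact key _ _ (by rw [this, sub_sub_cancel])

/-- Permutations are products of transpositions, and the matrix of a transposition is a unitary
involution, hence an exponential. -/
theorem permUn_mem_UInf0 (σ : Equiv.Perm (Fin n)) : UInf.of n (permUn A n σ) ∈ UInf0 A := by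
  induction σ using Equiv.Perm.swap_induction_on with
  | one => rw [map_one, map_one]; exact one_mem _
  | swap_mul f x y _ ih =>
    rw [map_mul, map_mul]
    refine mul_mem ?_ ih
    obtain ⟨h, hh⟩ := exists_cexp_of_involution (permUn A n (Equiv.swap x y)) (by
      rw [← map_mul, Equiv.swap_mul_self, map_one])
    rw [hh]
    exact ⟨n, _, joined_one_uexp h, rfl⟩

theorem blockMat_apply (u : CStarMatrix (Fin n) (Fin n) A) (v : CStarMatrix (Fin m) (Fin m) A)
    (i j : Fin (n + m)) : blockMat u v i j = Matrix.fromBlocks (CStarMatrix.ofMatrix.symm u) 0 0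
      (CStarMatrix.ofMatrix.symm v) (finSumFinEquiv.symm i) (finSumFinEquiv.symm j) := rfl

theorem blockDiag_mul (u u' : Un A n) (v v' : Un A m) :
    blockDiag (u * u') (v * v') = blockDiag u v * blockDiag u' v' :=
  Subtype.ext (blockMat_mul _ _ _ _).symm

theorem of_blockDiag_one (u : Un A n) : UInf.of _ (blockDiag u (1 : Un A m)) = UInf.of n u := by
  rw [← UInf.of_pad (Nat.le_add_right n m) u]
  congr 1
  refine Subtype.ext (CStarMatrix.ext fun i j => ?_)
  change blockMat (u : CStarMatrix (Fin n) (Fin n) A) 1 i j =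
    padMat n (n + m) (u : CStarMatrix (Fin n) (Fin n) A) i j
  rw [blockMat_apply, padMat_apply]
  refine Fin.addCases (fun i => ?_) (fun i => ?_) i <;>
  refine Fin.addCases (fun j => ?_) (fun j => ?_) j
  · simp
  · have : ¬ ((i : ℕ) = n + j) := by omega
    simp [Fin.ext_iff, this]
  · have : ¬ (n + (i : ℕ) = j) := by omega
    simp [Fin.ext_iff, this]
  · simp [Fin.ext_iff]
    rw [CStarMatrix.one_apply]
    simp [Fin.ext_iff]

/-- A block permutation moves `v` to the other end of the diagonal. It matters that the conjugating
element is connected to `1`: the determinant is available only there. -/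
theorem of_one_blockDiag (v : Un A m) : ∃ w ∈ UInf0 A,
    UInf.of _ (blockDiag (1 : Un A n) v) = w * UInf.of m v * w⁻¹ := by
  let σ : Equiv.Perm (Fin (n + m)) := (finCongr (Nat.add_comm n m)).trans finAddFlip
  have h1 : ∀ i : Fin n, ((σ⁻¹ (Fin.castAdd m i) : Fin (n + m)) : ℕ) = m + i := fun i => by
    have : σ⁻¹ (Fin.castAdd m i) = (finCongr (Nat.add_comm m n)) (Fin.natAdd m i) := by
      rw [Equiv.Perm.inv_eq_iff_eq]
      simp [σ]
    rw [this]; rfl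
  have h2 : ∀ i : Fin m, ((σ⁻¹ (Fin.natAdd n i) : Fin (n + m)) : ℕ) = i := fun i => by
    have : σ⁻¹ (Fin.natAdd n i) = (finCongr (Nat.add_comm m n)) (Fin.castAdd n i) := by
      rw [Equiv.Perm.inv_eq_iff_eq]
      simp [σ]
    rw [this]; rfl
  refine ⟨_, permUn_mem_UInf0 σ, ?_⟩
  rw [← UInf.of_pad (Nat.le_add_left m n) v, ← map_inv (UInf.of _), ← map_mul (UInf.of _),
    ← map_mul (UInf.of _), ← map_inv (permUn A _)]
  congr 1
  refine Subtype.ext (CStarMatrix.ext fun i j => ?_)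
  change blockMat 1 (v : CStarMatrix (Fin m) (Fin m) A) i j =
    (permMat σ * padMat m (n + m) (v : CStarMatrix (Fin m) (Fin m) A) * permMat σ⁻¹ :
      CStarMatrix (Fin (n + m)) (Fin (n + m)) A) i j
  rw [mul_permMat_apply, permMat_mul_apply, blockMat_apply, padMat_apply]
  refine Fin.addCases (fun i => ?_) (fun i => ?_) i <;>
  refine Fin.addCases (fun j => ?_) (fun j => ?_) j
  · simp only [h1, EmbeddingLike.apply_eq_iff_eq]
    rw [dif_neg (by omega)]
    simp
    rw [CStarMatrix.one_apply]
  · simp only [h1, EmbeddingLike.apply_eq_iff_eq]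
    rw [dif_neg (by omega), if_neg (by rw [Fin.ext_iff]; simp; omega)]
    simp
  · simp only [h1, EmbeddingLike.apply_eq_iff_eq]
    rw [dif_neg (by omega), if_neg (by rw [Fin.ext_iff]; simp; omega)]
    simp
  · simp only [h2]
    rw [dif_pos ⟨i.2, j.2⟩]
    simp

theorem of_blockDiag (u : Un A n) (v : Un A m) : ∃ w ∈ UInf0 A,
    UInf.of _ (blockDiag u v) = UInf.of n u * (w * UInf.of m v * w⁻¹) := by
  obtain ⟨w, hw, e⟩ := of_one_blockDiag (n := n) v
  refine ⟨w, hw, ?_⟩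
  rw [← e, ← of_blockDiag_one (m := m) u, ← map_mul, ← blockDiag_mul, mul_one, one_mul]

/-- Any two elements commute up to conjugation by an element that is connected to `1`. -/
theorem exists_conj_commute (x y : UInf A) : ∃ w ∈ UInf0 A, Commute (w * x * w⁻¹) y := by
  obtain ⟨n, u, rfl⟩ := x.exists_of
  obtain ⟨m, v, rfl⟩ := y.exists_of
  obtain ⟨w, hw, e⟩ := of_one_blockDiag (n := m) u
  refine ⟨w, hw, ?_⟩
  rw [← e, ← of_blockDiag_one (m := n) v]
  change _ * _ = _ * _
  rw [← map_mul, ← map_mul, ← blockDiag_mul, ← blockDiag_mul, one_mul, mul_one, mul_one, one_mul]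

end Perm

/-! ### The kernel of the determinant -/

section Kernel

variable {A : Type*} [CStarAlgebra A]

variable (A) in
/-- The kernel of the determinant. -/
def detKer : Subgroup (UInf A) where
  carrier := {x | x ∈ UInf0 A ∧ detBar x = 0}
  one_mem' := ⟨one_mem _, detBar_one⟩
  mul_mem' := fun {x y} hx hy => ⟨mul_mem hx.1 hy.1, by
    rw [detBar_mul hx.1 hy.1, hx.2, hy.2, add_zero]⟩
  inv_mem' := fun {x} hx => ⟨inv_mem hx.1, by rw [detBar_inv hx.1, hx.2, neg_zero]⟩

-- Let `x' = wxw⁻¹` commute with `y`, with `w` connected to `1`, and put `c = xx'⁻¹`. Then `c` is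
-- connected to `1` by normality and `[x, y] = c · yc⁻¹y⁻¹`, whose determinant vanishes since the
-- determinant is invariant under conjugation. This reaches commutators of arbitrary unitaries,
-- whose own determinants need not exist.
open scoped commutatorElement in
theorem commutator_le_detKer : commutator (UInf A) ≤ detKer A := by
  rw [commutator_def, Subgroup.commutator_le]
  intro x _ y _
  obtain ⟨w, hw, hc⟩ := exists_conj_commute x y
  set x' := w * x * w⁻¹ with hx'
  set c := x * x'⁻¹ with hcdef
  have hcm : c ∈ UInf0 A := by
    have : c = (x * w * x⁻¹) * w⁻¹ := by rw [hcdef, hx']; group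
    rw [this]
    exact mul_mem (Subgroup.Normal.conj_mem inferInstance w hw x) (inv_mem hw)
  have e : ⁅x, y⁆ = c * (y * c⁻¹ * y⁻¹) := by
    have h1 : x'⁻¹ * y * x' = y := by rw [mul_assoc, ← hc.eq, inv_mul_cancel_left]
    have h2 : c * (y * c⁻¹ * y⁻¹) = x * (x'⁻¹ * y * x') * x⁻¹ * y⁻¹ := by rw [hcdef]; group
    rw [h2, h1, commutatorElement_def]
  have hcm' : y * c⁻¹ * y⁻¹ ∈ UInf0 A := Subgroup.Normal.conj_mem inferInstance _ (inv_mem hcm) y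
  rw [e]
  exact ⟨mul_mem hcm hcm', by
    rw [detBar_mul hcm hcm', detBar_conj (inv_mem hcm), detBar_inv hcm, add_neg_cancel]⟩

theorem UInf.isClosed_iff {S : Set (UInf A)} :
    IsClosed S ↔ ∀ n, IsClosed (UInf.of (A := A) n ⁻¹' S) := by
  have h : IsOpen Sᶜ ↔ Continuous fun x => x ∈ Sᶜ := continuous_Prop.symm
  rw [← isOpen_compl_iff, h, UInf.continuous_iff]
  refine forall_congr' fun n => ?_
  rw [← isOpen_compl_iff]
  exact continuous_Prop

theorem eventually_exists_cexp {R : Type*} [CStarAlgebra R] {ε : ℝ} (hε : 0 < ε) :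
    ∀ᶠ u in 𝓝 (1 : unitary R), ∃ h, ‖h‖ < ε ∧ cexp h = u := by
  have h1 : Metric.ball (1 : unitary R) 2 ∈ 𝓝 (1 : unitary R) := Metric.ball_mem_nhds _ two_pos
  have h0 : Unitary.argSelfAdjoint (1 : unitary R) = 0 := by
    rw [← selfAdjoint.expUnitary_zero]
    exact argSelfAdjoint_expUnitary (by rw [norm_zero]; exact Real.pi_pos)
  have hc := (Unitary.continuousOn_argSelfAdjoint (A := R)).continuousAt h1
  have h2 := hc.eventually (Metric.ball_mem_nhds _ (show 0 < 2 * Real.pi * ε by positivity))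
  filter_upwards [h1, h2] with u hu1 hu2
  refine ⟨(2 * Real.pi)⁻¹ • Unitary.argSelfAdjoint u, ?_, ?_⟩
  · rw [h0, dist_zero_right] at hu2
    rw [norm_smul, Real.norm_of_nonneg (by positivity), inv_mul_lt_iff₀ (by positivity)]
    exact hu2
  · rw [cexp, smul_smul, mul_inv_cancel₀ (by positivity), one_smul]
    refine expUnitary_argSelfAdjoint ?_
    rw [Metric.mem_ball, Subtype.dist_eq, dist_eq_norm] at hu1
    exact hu1

/-- Closedness may be tested at each size `n`. A limit `u` equals `exp(2πih)v` with `v` in the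
kernel and `h` as small as desired, so its determinant is represented by arbitrarily small functions
and vanishes in the quotient by the closure. -/
theorem isClosed_detKer : IsClosed (detKer A : Set (UInf A)) := by
  refine UInf.isClosed_iff.2 fun n => isClosed_of_closure_subset fun u hu => ?_
  have key : ∀ ε : ℝ, 0 < ε → ∃ h : Sn A n, ‖h‖ < ε ∧ UInf.of n u ∈ UInf0 A ∧
      detBar (UInf.of n u) = toH (trL A (Fin n) (h : CStarMatrix (Fin n) (Fin n) A)) := by
    intro ε hε
    have hc : Continuous fun v : Un A n => u * v⁻¹ := continuous_const.mul continuous_inv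
    have ht := hc.tendsto u
    rw [mul_inv_cancel] at ht
    have hev := ht.eventually (eventually_exists_cexp hε)
    obtain ⟨v, ⟨h, hh, e⟩, hv⟩ := mem_closure_iff_nhds.1 hu _ hev
    have hv' : UInf.of n v ∈ UInf0 A ∧ detBar (UInf.of n v) = 0 := hv
    have e' : UInf.of n u = UInf.of n (uexp h) * UInf.of n v := by
      rw [← map_mul, uexp_eq_cexp, e, inv_mul_cancel_right]
    have hm : UInf.of n (uexp h) ∈ UInf0 A := ⟨n, _, joined_one_uexp h, rfl⟩
    refine ⟨h, hh, ?_, ?_⟩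
    · rw [e']; exact mul_mem hm hv'.1
    · rw [e', detBar_mul hm hv'.1, hv'.2, add_zero, (isDetBar_uexp h).detBar_eq]
  obtain ⟨_, _, hu0, _⟩ := key 1 one_pos
  refine ⟨hu0, ?_⟩
  obtain ⟨f, hf⟩ := QuotientAddGroup.mk_surjective (detBar (UInf.of n u))
  rw [← hf]
  refine (QuotientAddGroup.eq_zero_iff f).2 ?_
  have hcl : IsClosed ((imageK0 A).topologicalClosure : Set (AffT1 A)) :=
    (imageK0 A).isClosed_topologicalClosure
  refine hcl.closure_subset_iff.2 subset_rfl (Metric.mem_closure_iff.2 fun ε hε => ?_)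
  have hL : Continuous fun h : Sn A n => trL A (Fin n) (h : CStarMatrix (Fin n) (Fin n) A) :=
    (trL A (Fin n)).continuous.comp continuous_subtype_val
  obtain ⟨δ, hδ, hLδ⟩ := Metric.continuous_iff.1 hL 0 ε hε
  obtain ⟨h, hh, _, hd⟩ := key δ hδ
  rw [← hf] at hd
  have hd' : -trL A (Fin n) (h : CStarMatrix (Fin n) (Fin n) A) + f ∈
      (imageK0 A).topologicalClosure := QuotientAddGroup.eq.1 hd.symm
  refine ⟨_, hd', ?_⟩
  have e := hLδ h (by rwa [dist_zero_right])
  have e0 : trL A (Fin n) ((0 : Sn A n) : CStarMatrix (Fin n) (Fin n) A) = 0 :=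
    map_zero (trL A (Fin n))
  rw [e0, dist_eq_norm] at e
  rw [dist_eq_norm]
  convert e using 2
  abel

theorem closureDU_le_detKer : closureDU A ≤ detKer A := fun _ hx =>
  closure_minimal commutator_le_detKer isClosed_detKer hx

/-- Every element of `H A` is the determinant of some `x`. If its image, the class of `x`, is
trivial, then `x` lies in `closureDU A` and hence in the kernel of the determinant. -/
theorem inclusion_injective : Function.Injective (inclusion A) := by
  rw [injective_iff_map_eq_zero]
  intro y hy
  obtain ⟨x, hx, rfl⟩ := exists_detBar_eq y
  rw [isInclusion_inclusion x hx, toK1bar_eq_zero] at hy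
  exact (closureDU_le_detKer hy).2

end Kernel

/-! ### The Nielsen-Thomsen sequence -/

section Sequence

variable {A B : Type*} [CStarAlgebra A] [CStarAlgebra B] {n m : ℕ}

theorem toK1_mul (x y : UInf A) : toK1 (x * y) = toK1 x + toK1 y := rfl

theorem toK1_inv (x : UInf A) : toK1 x⁻¹ = -toK1 x := rfl

theorem toK1_eq_zero {x : UInf A} : toK1 x = 0 ↔ x ∈ UInf0 A := QuotientGroup.eq_one_iff x

/-- Makes the projection from `K̄₁` to `K₁` well defined; it is a by-product of the result on the
kernel of the determinant. -/
theorem closureDU_le_UInf0 : closureDU A ≤ UInf0 A := fun _ hx => (closureDU_le_detKer hx).1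

variable (A) in
/-- The projection of the Nielsen-Thomsen sequence. -/
def projK1 : K1bar A →+ K1 A :=
  MonoidHom.toAdditive (QuotientGroup.map (closureDU A) (UInf0 A) (MonoidHom.id _)
    closureDU_le_UInf0)

theorem projK1_toK1bar (x : UInf A) : projK1 A (toK1bar x) = toK1 x := rfl

theorem toK1bar_surjective (x : K1bar A) : ∃ u, toK1bar u = x :=
  QuotientGroup.mk_surjective (Additive.toMul x)

theorem projK1_inclusion (y : H A) : projK1 A (inclusion A y) = 0 := by
  obtain ⟨x, hx, rfl⟩ := exists_detBar_eq y
  rw [isInclusion_inclusion x hx, projK1_toK1bar, toK1_eq_zero]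
  exact hx

theorem exists_inclusion_eq {x : K1bar A} (hx : projK1 A x = 0) : ∃ y, inclusion A y = x := by
  obtain ⟨u, rfl⟩ := toK1bar_surjective x
  rw [projK1_toK1bar, toK1_eq_zero] at hx
  exact ⟨_, isInclusion_inclusion u hx⟩

/-- Up to conjugation `diag(u, v*)` is the product of `u` and `v⁻¹`, so its class is the difference
of those of `u` and `v`. If these agree in `K₁`, the determinant exists and `i` recovers the
difference. The formulas for `ν` and for the rotation map are both instances. -/
theorem of_blockDiag_star (u : Un A n) (v : Un A m) (h : toK1 (UInf.of n u) = toK1 (UInf.of m v)) :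
    UInf.of _ (blockDiag u (star v)) ∈ UInf0 A ∧
    inclusion A (detBar (UInf.of _ (blockDiag u (star v)))) =
      toK1bar (UInf.of n u) - toK1bar (UInf.of m v) := by
  obtain ⟨w, hw, e⟩ := of_blockDiag u (star v)
  rw [Unitary.star_eq_inv, map_inv] at e
  have hm : UInf.of _ (blockDiag u (star v)) ∈ UInf0 A := by
    rw [Unitary.star_eq_inv, e, ← toK1_eq_zero, toK1_mul, toK1_mul, toK1_mul, toK1_inv, toK1_inv, h,
      toK1_eq_zero.2 hw, zero_add, neg_zero, add_zero, add_neg_cancel]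
  refine ⟨hm, ?_⟩
  rw [isInclusion_inclusion _ hm, Unitary.star_eq_inv, e, toK1bar_mul, toK1bar_conj, toK1bar_inv,
    sub_eq_add_neg]

namespace NTBasis

variable (C : NTBasis A)

theorem sec_apply (k : K1 A) : C.sec k = toK1bar (C.c k) := rfl

theorem projK1_sec (k : K1 A) : projK1 A (C.sec k) = k := C.class_c k

/-- The element `x - s([x])` dies in `K₁`, so exactness in the middle provides `y`; injectivity of
`i` makes it unique and additive in `x`. -/
theorem exists_retract (x : K1bar A) : ∃ y, inclusion A y + C.sec (projK1 A x) = x := by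
  obtain ⟨y, hy⟩ := exists_inclusion_eq (x := x - C.sec (projK1 A x)) (by
    rw [sub_eq_add_neg, map_add, map_neg, C.projK1_sec, add_neg_cancel])
  exact ⟨y, by rw [hy, sub_add_cancel]⟩

/-- The map underlying the retract induced by a basis. -/
def retractFun (x : K1bar A) : H A := (C.exists_retract x).choose

theorem inclusion_retractFun (x : K1bar A) :
    inclusion A (C.retractFun x) + C.sec (projK1 A x) = x := (C.exists_retract x).choose_spec

/-- The retract induced by a basis. -/
def retract : K1bar A →+ H A :=
  AddMonoidHom.mk' C.retractFun fun x y => by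
    apply inclusion_injective
    have h3 := C.inclusion_retractFun (x + y)
    rw [map_add (projK1 A), map_add C.sec] at h3
    rw [map_add]
    refine add_right_cancel (h3.trans ?_)
    conv_lhs => rw [← C.inclusion_retractFun x, ← C.inclusion_retractFun y]
    abel

theorem inclusion_retract (x : K1bar A) :
    inclusion A (C.retract x) + C.sec (projK1 A x) = x := C.inclusion_retractFun x

theorem retract_inclusion_add_sec (y : H A) (k : K1 A) :
    C.retract (inclusion A y + C.sec k) = y := by
  apply inclusion_injective
  have := C.inclusion_retract (inclusion A y + C.sec k)
  rw [map_add (projK1 A), projK1_inclusion, C.projK1_sec, zero_add] at this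
  exact add_right_cancel this

theorem projK1_inclusion_add_sec (y : H A) (k : K1 A) :
    projK1 A (inclusion A y + C.sec k) = k := by
  rw [map_add, projK1_inclusion, C.projK1_sec, zero_add]

theorem isInducedRetract_iff {r : K1bar A →+ H A} :
    C.IsInducedRetract (inclusion A) r ↔ r = C.retract := by
  constructor
  · rintro ⟨h1, h2⟩
    refine AddMonoidHom.ext fun x => ?_
    conv_lhs => rw [← C.inclusion_retract x]
    rw [map_add, h1, h2, add_zero]
  · rintro rfl
    refine ⟨fun y => ?_, fun k => ?_⟩
    · have := C.retract_inclusion_add_sec y 0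
      rwa [map_zero, add_zero] at this
    · have := C.retract_inclusion_add_sec 0 k
      rwa [map_zero, zero_add] at this

/-- The isomorphism induced by a basis. -/
def iso : K1bar A ≃+ H A × K1 A where
  toFun x := (C.retract x, projK1 A x)
  invFun y := inclusion A y.1 + C.sec y.2
  left_inv x := C.inclusion_retract x
  right_inv _ := Prod.ext (C.retract_inclusion_add_sec _ _) (C.projK1_inclusion_add_sec _ _)
  map_add' _ _ := Prod.ext (map_add _ _ _) (map_add _ _ _)

theorem iso_apply (x : K1bar A) : C.iso x = (C.retract x, projK1 A x) := rfl

theorem isInducedIso_iso : C.IsInducedIso C.iso := by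
  intro n m u v hv
  have h : toK1 (UInf.of n u) = toK1 (UInf.of m v) := by rw [hv, C.class_c]
  obtain ⟨h1, h2⟩ := of_blockDiag_star u v h
  refine ⟨h1, Prod.ext ?_ rfl⟩
  apply inclusion_injective
  rw [h2, hv, eq_sub_iff_add_eq]
  exact C.inclusion_retract _

theorem isInducedIso_iff {ν : K1bar A ≃+ H A × K1 A} : C.IsInducedIso ν ↔ ν = C.iso := by
  refine ⟨fun h => AddEquiv.ext fun x => ?_, fun h => h ▸ C.isInducedIso_iso⟩
  obtain ⟨u, rfl⟩ := toK1bar_surjective x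
  obtain ⟨n, u, rfl⟩ := u.exists_of
  obtain ⟨m, v, hv⟩ := (C.c (toK1 (UInf.of n u))).exists_of
  rw [(h n m u v hv.symm).2, (C.isInducedIso_iso n m u v hv.symm).2]

end NTBasis

variable (φ : A →⋆ₙₐ[ℂ] B)

theorem K1bar.map_toK1bar (x : UInf A) : K1bar.map φ (toK1bar x) = toK1bar (UInf.map φ x) := rfl

theorem K1.map_toK1 (x : UInf A) : K1.map φ (toK1 x) = toK1 (UInf.map φ x) := rfl

/-- Naturality of the determinant, transported through its surjectivity; it yields both the entry
`H(φ)` and the zero of the matrix. -/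
theorem map_inclusion (y : H A) : K1bar.map φ (inclusion A y) = inclusion B (H.map φ y) := by
  obtain ⟨x, hx, rfl⟩ := exists_detBar_eq y
  rw [isInclusion_inclusion x hx, K1bar.map_toK1bar, ← detBar_map φ hx,
    isInclusion_inclusion _ (UInf0_le φ hx)]

theorem projK1_map (x : K1bar A) : projK1 B (K1bar.map φ x) = K1.map φ (projK1 A x) := by
  obtain ⟨u, rfl⟩ := toK1bar_surjective x
  rfl

variable (C : NTBasis A) (D : NTBasis B)

theorem rotation_formula {k : K1 A} {u : Un A n} {v : Un B m} (hu : UInf.of n u = C.c k)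
    (hv : UInf.of m v = D.c (K1.map φ k)) :
    UInf.of _ (blockDiag (Un.map φ n u) (star v)) ∈ UInf0 B ∧
      D.retract (K1bar.map φ (C.sec k)) =
        detBar (UInf.of _ (blockDiag (Un.map φ n u) (star v))) := by
  have hk : toK1 (UInf.of n (Un.map φ n u)) = K1.map φ k := by
    rw [← UInf.map_of, ← K1.map_toK1, hu, C.class_c]
  obtain ⟨h1, h2⟩ := of_blockDiag_star (Un.map φ n u) v (by rw [hk, hv, D.class_c])
  refine ⟨h1, ?_⟩
  apply inclusion_injective
  rw [h2, hv, eq_sub_iff_add_eq, C.sec_apply, ← hu, K1bar.map_toK1bar, UInf.map_of]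
  have := D.inclusion_retract (toK1bar (UInf.of n (Un.map φ n u)))
  rwa [projK1_toK1bar, hk] at this

/-- Decompose `x = i(r(x)) + s([x])` and apply `K̄₁(φ)`: the first summand stays in the image of `i`
and contributes `H(φ)(r(x))`, the second contributes the rotation map. -/
theorem iso_map (x : K1bar A) :
    D.iso (K1bar.map φ x) = (⟨H.map φ, D.retract.comp ((K1bar.map φ).comp C.sec), 0, K1.map φ⟩ :
      HomMatrix (H A) (K1 A) (H B) (K1 B)).apply (C.iso x) := by
  rw [D.iso_apply, C.iso_apply]
  refine Prod.ext ?_ ?_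
  · change D.retract (K1bar.map φ x) = H.map φ (C.retract x) +
      D.retract (K1bar.map φ (C.sec (projK1 A x)))
    conv_lhs => rw [← C.inclusion_retract x]
    rw [map_add, map_add, map_inclusion, (D.isInducedRetract_iff.2 rfl).1]
  · change projK1 B (K1bar.map φ x) = 0 + K1.map φ (projK1 A x)
    rw [zero_add, projK1_map]

theorem HomMatrix.ext_of_apply {G₁ G₂ G₁' G₂' : Type*} [AddGroup G₁] [AddGroup G₂] [AddGroup G₁']
    [AddGroup G₂'] {M N : HomMatrix G₁ G₂ G₁' G₂'} (h : ∀ x, M.apply x = N.apply x) : M = N := by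
  obtain ⟨a, b, c, d⟩ := M
  obtain ⟨a', b', c', d'⟩ := N
  have h1 : ∀ x, a x = a' x ∧ c x = c' x := fun x => by
    simpa [HomMatrix.apply] using h (x, 0)
  have h2 : ∀ x, b x = b' x ∧ d x = d' x := fun x => by
    simpa [HomMatrix.apply] using h (0, x)
  obtain rfl : a = a' := AddMonoidHom.ext fun x => (h1 x).1
  obtain rfl : b = b' := AddMonoidHom.ext fun x => (h2 x).1
  obtain rfl : c = c' := AddMonoidHom.ext fun x => (h1 x).2
  obtain rfl : d = d' := AddMonoidHom.ext fun x => (h2 x).2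
  rfl

/-- Since the isomorphism of `A` is surjective, the commuting square determines the map given by `M`
on all pairs, and the entries are read off on the two summands. -/
theorem isMatrixOf_iff {M : HomMatrix (H A) (K1 A) (H B) (K1 B)} :
    IsMatrixOf C.iso D.iso (K1bar.map φ) M ↔
      M = ⟨H.map φ, D.retract.comp ((K1bar.map φ).comp C.sec), 0, K1.map φ⟩ := by
  refine ⟨fun h => HomMatrix.ext_of_apply fun y => ?_, fun h => h ▸ iso_map φ C D⟩
  obtain ⟨x, rfl⟩ := C.iso.surjective y
  rw [← h x, iso_map φ C D x]

end Sequence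

end NielsenThomsen

end

theorem mainTheorem4 {A B : Type*} [CStarAlgebra A] [CStarAlgebra B] (φ : A →⋆ₙₐ[ℂ] B)
    (C : NTBasis A) (D : NTBasis B) :
    -- the determinants are well defined: every smooth path gives the same value, and there is one
    (∀ x ∈ UInf0 A, ∀ y, IsDetBar x y ↔ y = detBar x) ∧
    (∀ x ∈ UInf0 B, ∀ y, IsDetBar x y ↔ y = detBar x) ∧
    -- the inclusion `i`, the retract `r` and the isomorphisms `νA`, `νB` exist and are unique
    ∃ (i : H B →+ K1bar B) (r : K1bar B →+ H B)
      (νA : K1bar A ≃+ H A × K1 A) (νB : K1bar B ≃+ H B × K1 B),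
      (∀ i', IsInclusion i' ↔ i' = i) ∧
      (∀ r', D.IsInducedRetract i r' ↔ r' = r) ∧
      (∀ ν, C.IsInducedIso ν ↔ ν = νA) ∧
      (∀ ν, D.IsInducedIso ν ↔ ν = νB) ∧
      -- the formula for the rotation map
      (∀ (k : K1 A) (n m : ℕ) (u : Un A n) (v : Un B m),
        UInf.of n u = C.c k → UInf.of m v = D.c (K1.map φ k) →
        UInf.of _ (blockDiag (Un.map φ n u) (star v)) ∈ UInf0 B ∧
        r (K1bar.map φ (C.sec k)) = detBar (UInf.of _ (blockDiag (Un.map φ n u) (star v)))) ∧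
      -- the matrix
      (∀ M, IsMatrixOf νA νB (K1bar.map φ) M ↔
        M = ⟨H.map φ, r.comp ((K1bar.map φ).comp C.sec), 0, K1.map φ⟩) := by
  refine ⟨fun x hx y => isDetBar_iff hx y, fun x hx y => isDetBar_iff hx y, inclusion B, D.retract,
    C.iso, D.iso, fun _ => isInclusion_iff, fun _ => D.isInducedRetract_iff,
    fun _ => C.isInducedIso_iff, fun _ => D.isInducedIso_iff, ?_, fun _ => isMatrixOf_iff φ C D⟩
  intro k n m u v hu hv
  exact rotation_formula φ C D hu hv
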